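/- Let $M$ be a complex manifold of dimension $n$ with a holomorphic Poisson tensor $\pi$. For a holomorphic function $H$ put $X_H=i(dH)\pi$. A Casimir function is a holomorphic function $f$ with $X_f=0$. Let $\mathcal O_M$ be the sheaf of holomorphic functions, $\mathcal C_M\subset\mathcal O_M$ the sheaf of Casimir functions, $\underline{Der}$ the sheaf of Poisson vector fields (holomorphic $X$ with $\mathcal L_X\pi=0$), and $\underline{Ham}\subset\underline{Der}$ the sheaf of locally hamiltonian vector fields (those locally of the form $X_H$); $H\mapsto X_H$ induces a map of sheaves $\mathcal O_M/\mathcal C_M\to\underline{Ham}$. Let $U$ be the regular set, i.e. the open set of points near which the rank of $\pi$ is constant, and $S=M\setminus U$ the singular set. For a holomorphic volume form $\nu$ on an open set, let $D_\nu$ be the corresponding Koszul operator; if $\nu=h\,dz_1\wedge\cdots\wedge dz_n$ and $\pi^{ij}=\pi(dz_i,dz_j)$ in local coordinates, then $$D_\nu\pi=-\frac1h\sum_{i,j}\frac{\partial(h\,\pi^{ij})}{\partial z_i}\,\frac{\partial}{\partial z_j}.$$ (1) Let $\nu$ be a holomorphic volume form on $M$. Then $D_\nu\pi$ is a Poisson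 vector field on $M$ whose restriction to $U$ is locally hamiltonian, and there is a unique section $\bar f_\nu\in H^0(U,\mathcal O_M/\mathcal C_M)$ that is mapped to $D_\nu\pi|_U$ by $\mathcal O_M/\mathcal C_M\to\underline{Ham}$. (2) There is a unique section $\xi$ of $\underline{Der}/\underline{Ham}$ over $M$ (the outer vector field) that over every open set $V$ with a holomorphic volume form $\nu$ is the class of $D_\nu\pi$. It vanishes on $U$, so it comes from a unique element $\xi_S\in H^0_S(M,\underline{Der}/\underline{Ham})$, and there is a unique class $c\in H^1_S(M,\mathcal O_M/\mathcal C_M)$ whose image in $H^1_S(M,\underline{Ham})$ is the image of $\xi_S$ under the connecting homomorphism of $0\to\underline{Ham}\to\underline{Der}\to\underline{Der}/\underline{Ham}\to0$. For every open $V\subseteq M$ and every holomorphic volume form $\nu$ on $V$, there is a section $\bar f_\nu\in H^0(V\cap U,\mathcal O_M/\mathcal C_M)$ corresponding to $D_\nu\pi|_{V\cap U}$, and the restriction of $c$ to $H^1_{S\cap V}(V,\mathcal O_M/\mathcal C_M)$ is $\partial\bar f_\nu$, where $\partial:H^0(V\cap U,\mathcal O_M/\mathcal C_M)\to H^1_{S\cap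 V}(V,\mathcal O_M/\mathcal C_M)$ is the boundary operator. In particular, if $\nu$ is a holomorphic volume form on all of $M$, then $c$ is the image $\partial\bar f_\nu$ of the class in (1). -/

import Mathlib

open CategoryTheory Limits TopologicalSpace Opposite Topology Bundle
open scoped Manifold ContDiff

set_option linter.unusedSectionVars false

universe u

namespace OuterPoisson

noncomputable section

section
variable {M : Type u} [TopologicalSpace M] 

open Classical in
/-- Extension by zero of a section over `W` to all of `M`. -/
def extendZero {T : M → Type} [∀ x, AddCommGroup (T x)] {W : Opens M} (s : ∀ x : W, T x) : ∀ x : M, T x :=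
  fun x => if h : x ∈ W then s ⟨x, h⟩ else 0

/-- A condition on germs of sections of the family of abelian groups `T`: at every point `x` a
subgroup `germs x` of sections, membership in which depends on the germ at `x` only. -/
structure GermCondition (T : M → Type) [∀ x, AddCommGroup (T x)] where
  germs : M → AddSubgroup (∀ x, T x)
  congr : ∀ {x : M} {s t : ∀ x, T x}, (∀ᶠ y in 𝓝 x, s y = t y) → s ∈ germs x → t ∈ germs x

variable {T : M → Type} [∀ x, AddCommGroup (T x)] {T' : M → Type} [∀ x, AddCommGroup (T' x)]

theorem extendZero_apply {W : Opens M} (s : ∀ x : W, T x) {x : M} (h : x ∈ W) :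
    extendZero s x = s ⟨x, h⟩ := dif_pos h

theorem extendZero_add {W : Opens M} (s t : ∀ x : W, T x) :
    extendZero (s + t) = extendZero s + extendZero t := by
  funext x
  by_cases h : x ∈ W <;> simp [extendZero, h]

theorem extendZero_neg {W : Opens M} (s : ∀ x : W, T x) :
    extendZero (-s) = -extendZero s := by
  funext x
  by_cases h : x ∈ W <;> simp [extendZero, h]

theorem extendZero_zero {W : Opens M} :
    extendZero (0 : ∀ x : W, T x) = 0 := by
  funext x
  by_cases h : x ∈ W <;> simp [extendZero, h]

theorem extendZero_restrict {W W' : Opens M} (i : W' ≤ W) (s : ∀ x : W, T x) {x : M}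
    (hx : x ∈ W') : ∀ᶠ y in 𝓝 x, extendZero s y = extendZero (fun y : W' => s ⟨y, i y.2⟩) y := by
  filter_upwards [W'.isOpen.mem_nhds hx] with y hy
  rw [extendZero_apply _ (show y ∈ W' from hy), extendZero_apply _ (i hy)]

namespace GermCondition
variable (P : GermCondition T) 

/-- The sections over `W` that satisfy the condition at every point of `W`. -/
def sections (W : Opens M) : AddSubgroup (∀ x : W, T x) where
  carrier := {s | ∀ x ∈ W, extendZero s ∈ P.germs x}
  add_mem' := fun {a b} ha hb x hx => by
    rw [extendZero_add]; exact add_mem (ha x hx) (hb x hx)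
  zero_mem' := fun x hx => by
    rw [extendZero_zero]; exact zero_mem _
  neg_mem' := fun {a} ha x hx => by
    rw [extendZero_neg]; exact neg_mem (ha x hx)

/-- Restriction of sections to a smaller open set. -/
def restrict {W W' : Opens M} (i : W' ≤ W) : P.sections W →+ P.sections W' where
  toFun s := ⟨fun x => s.1 ⟨x, i x.2⟩, fun x hx => P.congr (extendZero_restrict i s.1 hx) (s.2 x (i hx))⟩
  map_zero' := rfl
  map_add' _ _ := rfl

/-- The presheaf of sections that satisfy the condition. -/
def presheaf : (Opens M)ᵒᵖ ⥤ AddCommGrpCat.{u} where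
  obj W := AddCommGrpCat.of (P.sections W.unop)
  map i := AddCommGrpCat.ofHom (P.restrict i.unop.le)
  map_id _ := rfl
  map_comp _ _ := rfl

/-- The same condition as a local predicate; used for the sheaf property. -/
def localPredicate : TopCat.LocalPredicate (X := TopCat.of M) T where
  pred {W} s := s ∈ P.sections W
  res {W' W} i s hs := (P.restrict i.le ⟨s, hs⟩).2
  locality {W} s hs x hx := by
    obtain ⟨V, hxV, i, hV⟩ := hs ⟨x, hx⟩
    refine P.congr ?_ (hV x hxV)
    filter_upwards [extendZero_restrict i.le s hxV] with y hy using hy.symm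

theorem isSheaf : Presheaf.IsSheaf (Opens.grothendieckTopology M) P.presheaf := by
  rw [CategoryTheory.Presheaf.isSheaf_iff_isSheaf_forget _ _ (CategoryTheory.forget AddCommGrpCat)]
  exact (TopCat.subsheafToTypes P.localPredicate).property

/-- The sheaf of abelian groups of the sections that satisfy the condition. -/
def sheaf : Sheaf (Opens.grothendieckTopology M) AddCommGrpCat.{u} := ⟨P.presheaf, P.isSheaf⟩

/-- An additive operator between two such sheaves, given by a map on sections over `M` whose
value at `x` depends only on the germ at `x`. -/
structure LocalOperator (P : GermCondition T) (Q : GermCondition T') where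
  toFun : (∀ x, T x) → ∀ x, T' x
  congr : ∀ {x : M} {s t : ∀ x, T x}, (∀ᶠ y in 𝓝 x, s y = t y) → toFun s x = toFun t x
  add : ∀ {x : M} {s t : ∀ x, T x}, s ∈ P.germs x → t ∈ P.germs x →
    toFun (s + t) x = toFun s x + toFun t x
  mem : ∀ {x : M} {s : ∀ x, T x}, s ∈ P.germs x → toFun s ∈ Q.germs x

variable {P} {Q : GermCondition T'} 

namespace LocalOperator

/-- The operator on sections over `W`. -/
def onSections (Φ : LocalOperator P Q) (W : Opens M) : P.sections W →+ Q.sections W :=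
  AddMonoidHom.mk' (fun s => ⟨fun x => Φ.toFun (extendZero s.1) x, fun x hx => by
      refine Q.congr ?_ (Φ.mem (s.2 x hx))
      filter_upwards [W.isOpen.mem_nhds hx] with y hy
      rw [extendZero_apply _ (show y ∈ W from hy)]⟩) (fun s t => by
      apply Subtype.ext
      funext x
      change Φ.toFun (extendZero (s.1 + t.1)) x = _
      rw [extendZero_add]
      exact Φ.add (s.2 x x.2) (t.2 x x.2))

/-- The homomorphism of sheaves defined by the operator. -/
def sheafHom (Φ : LocalOperator P Q) : P.sheaf ⟶ Q.sheaf := ⟨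
  { app W := AddCommGrpCat.ofHom (Φ.onSections W.unop)
    naturality := fun W W' i => by
      ext s
      apply Subtype.ext
      funext x
      exact Φ.congr (by filter_upwards [extendZero_restrict i.unop.le s.1 x.2] with y hy using hy.symm) }⟩

end LocalOperator
end GermCondition
end

section
variable {M : Type u} [TopologicalSpace M] 
/-- Sheaves of abelian groups on a topological space. -/
abbrev AbSheaf (M : Type u) [TopologicalSpace M] :=
  Sheaf (Opens.grothendieckTopology M) AddCommGrpCat.{u}

/-- `Γ(V, F) = H⁰(V, F)`. -/
abbrev Sec (F : AbSheaf M) (V : Opens M) : Type u := F.obj.obj (op V)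

/-- Restriction `Γ(V, F) → Γ(W, F)`. -/
def restrictSec (F : AbSheaf M) {V W : Opens M} (h : W ≤ V) : Sec F V →+ Sec F W :=
  (F.obj.map (homOfLE h).op).hom
/-- The map on sections over `V` induced by a homomorphism of sheaves. -/
def mapSec {F G : AbSheaf M} (φ : F ⟶ G) (V : Opens M) : Sec F V →+ Sec G V :=
  (φ.hom.app (op V)).hom

/-- `V ↦ ℤ_V = j_! ℤ`, the free abelian sheaf on the open set `V` (the sheaf whose Ext groups
define the cohomology of `V` in Mathlib). -/
def freeSheafFunctor (M : Type u) [TopologicalSpace M] : Opens M ⥤ AbSheaf M :=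
  yoneda ⋙ (Functor.whiskeringRight _ _ _).obj AddCommGrpCat.free ⋙ presheafToSheaf _ _

/-- `ℤ_V`. -/
abbrev freeSheaf (V : Opens M) : AbSheaf M := (freeSheafFunctor M).obj V

/-- The canonical bijection `Hom(ℤ_V, F) = Γ(V, F)`. -/
def homEquivSec (F : AbSheaf M) (V : Opens M) : (freeSheaf V ⟶ F) ≃ Sec F V :=
  ((sheafificationAdjunction (Opens.grothendieckTopology M) AddCommGrpCat.{u}).homEquiv _ F).trans
    (((AddCommGrpCat.adj.whiskerRight (Opens M)ᵒᵖ).homEquiv (yoneda.obj V) F.obj).trans yonedaEquiv)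

instance {V W : Opens M} (h : W ≤ V) : Mono ((freeSheafFunctor M).map (homOfLE h)) := by
  dsimp [freeSheafFunctor]
  infer_instance

/-- `ℤ_V / ℤ_W`, the constant sheaf `ℤ` on the locally closed set `V \ W`, extended by zero. -/
abbrev relSheaf {V W : Opens M} (h : W ≤ V) : AbSheaf M :=
  cokernel ((freeSheafFunctor M).map (homOfLE h))

/-- The short exact sequence `0 → ℤ_W → ℤ_V → ℤ_V / ℤ_W → 0`. -/
def pairSequence {V W : Opens M} (h : W ≤ V) : ShortComplex (AbSheaf M) :=
  ShortComplex.mk _ _ (cokernel.condition ((freeSheafFunctor M).map (homOfLE h)))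

theorem pairSequence_shortExact {V W : Opens M} (h : W ≤ V) : (pairSequence h).ShortExact where
  exact := ShortComplex.exact_cokernel _
  mono_f := by dsimp [pairSequence]; infer_instance
  epi_g := by dsimp [pairSequence]; infer_instance

/-- The cohomology `H^k_{V \ W}(V, F)` of `V` with supports in `V \ W`, the `k`-th derived functor of
`F ↦ {s ∈ Γ(V, F) | s = 0 on W} = Hom(ℤ_V / ℤ_W, F)`. -/
abbrev LocalCohomology {V W : Opens M} (h : W ≤ V) (F : AbSheaf M) (k : ℕ) : Type u :=
  Abelian.Ext (relSheaf h) F k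

namespace LocalCohomology
variable {V W : Opens M} (h : W ≤ V)

/-- `H⁰_{V \ W}(V, F) → H⁰(V, F)`. -/
def forget (F : AbSheaf M) (x : LocalCohomology h F 0) : Sec F V :=
  homEquivSec F V (Abelian.Ext.homEquiv₀ ((Abelian.Ext.mk₀ (pairSequence h).g).comp x (zero_add 0)))

/-- The map on cohomology with supports induced by a homomorphism of sheaves. -/
def map {F G : AbSheaf M} (φ : F ⟶ G) (k : ℕ) : LocalCohomology h F k →+ LocalCohomology h G k :=
  (Abelian.Ext.mk₀ φ).postcomp (relSheaf h) (add_zero k)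

/-- The boundary operator `∂ : H⁰(W, F) → H¹_{V \ W}(V, F)` of the long exact sequence
`0 → H⁰_{V \ W}(V, F) → H⁰(V, F) → H⁰(W, F) → H¹_{V \ W}(V, F) → H¹(V, F) → ⋯`. -/
def boundary (F : AbSheaf M) (s : Sec F W) : LocalCohomology h F 1 :=
  (pairSequence_shortExact h).extClass.comp (Abelian.Ext.mk₀ ((homEquivSec F W).symm s)) (add_zero 1)

/-- The connecting homomorphism in cohomology with supports of a short exact sequence of sheaves. -/
def connecting {S : ShortComplex (AbSheaf M)} (hS : S.ShortExact) (k : ℕ) :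
    LocalCohomology h S.X₃ k →+ LocalCohomology h S.X₁ (k + 1) :=
  hS.extClass.postcomp (relSheaf h) rfl

/-- The restriction `H^k_{V \ W}(V, F) → H^k_{V' \ W'}(V', F)` for `V' ⊆ V`, `W' ⊆ W`. -/
def restrict {V' W' : Opens M} {h' : W' ≤ V'} (hV : V' ≤ V) (hW : W' ≤ W) (F : AbSheaf M) (k : ℕ) :
   LocalCohomology h F k →+ LocalCohomology h' F k :=
  (Abelian.Ext.mk₀ (cokernel.map ((freeSheafFunctor M).map (homOfLE h'))
    ((freeSheafFunctor M).map (homOfLE h)) ((freeSheafFunctor M).map (homOfLE hW))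
    ((freeSheafFunctor M).map (homOfLE hV)) (by rw [← Functor.map_comp, ← Functor.map_comp]; rfl))).precomp F (zero_add k)
end LocalCohomology
end
section
/-- The model space `ℂⁿ`. -/
abbrev Model (n : ℕ) := EuclideanSpace ℂ (Fin n)
variable {n : ℕ} {M : Type u} [TopologicalSpace M] [ChartedSpace (Model n) M] 
/-- The holomorphic tangent space of `M` at `x`. -/
abbrev Tan (n : ℕ) {M : Type u} [TopologicalSpace M] [ChartedSpace (Model n) M] (x : M) : Type :=
  TangentSpace 𝓘(ℂ, Model n) x
variable  [IsManifold 𝓘(ℂ, Model n) ω M]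
/-- The holomorphic cotangent space of `M` at `x`. -/
abbrev Cotan (n : ℕ) {M : Type u} [TopologicalSpace M] [ChartedSpace (Model n) M] (x : M) : Type :=
  Tan n x →L[ℂ] ℂ

/-- `f` is holomorphic (complex analytic) in a neighbourhood of `x`. -/
def HolAt (n : ℕ) {M : Type u} [TopologicalSpace M] [ChartedSpace (Model n) M] (f : M → ℂ) (x : M) : Prop :=
  ContMDiffAt 𝓘(ℂ, Model n) 𝓘(ℂ, ℂ) ω f x

/-- The differential of `f` at `x`. -/
def diff (n : ℕ) {M : Type u} [TopologicalSpace M] [ChartedSpace (Model n) M] (f : M → ℂ) (x : M) : Cotan n x :=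
  mfderiv 𝓘(ℂ, Model n) 𝓘(ℂ, ℂ) f x

/-- `X` is a holomorphic section of the tangent bundle in a neighbourhood of `x`. -/
def HolVFAt (X : ∀ x : M, Tan n x) (x : M) : Prop :=
  ContMDiffAt 𝓘(ℂ, Model n) 𝓘(ℂ, Model n).tangent ω
    (fun y => TotalSpace.mk' (Model n) y (X y)) x
/-- The `i`-th coordinate function `z_i` of the chart at `c`. -/
def coordFun (c : M) (i : Fin n) (x : M) : ℂ := (extChartAt 𝓘(ℂ, Model n) c x) i

/-- The `i`-th coordinate vector field `∂/∂z_i` of the chart at `c`. -/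
def coordVec (c : M) (i : Fin n) (x : M) : Tan n x :=
  (trivializationAt (Model n) (TangentSpace 𝓘(ℂ, Model n)) c).symm x (EuclideanSpace.single i 1)

theorem diff_coordFun {c x : M} (hx : x ∈ (chartAt (Model n) c).source) (i : Fin n) (v : Tan n x) :
    diff n (coordFun c i) x v =
      ((trivializationAt (Model n) (TangentSpace 𝓘(ℂ, Model n)) c).continuousLinearMapAt ℂ x v) i := by
  have h2 := (mdifferentiableAt_extChartAt (I := 𝓘(ℂ, Model n)) hx).hasMFDerivAt
  have h3 : HasMFDerivAt 𝓘(ℂ, Model n) 𝓘(ℂ, ℂ) (EuclideanSpace.proj i : Model n →L[ℂ] ℂ)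
      (extChartAt 𝓘(ℂ, Model n) c x) (EuclideanSpace.proj i : Model n →L[ℂ] ℂ) :=
    (EuclideanSpace.proj i : Model n →L[ℂ] ℂ).hasMFDerivAt
  have h5 : diff n (coordFun c i) x = _ := (h3.comp x h2).mfderiv
  rw [h5]
  exact (congrArg (fun w : Model n => w i)
    (DFunLike.congr_fun (TangentBundle.continuousLinearMapAt_trivializationAt hx) v)).symm

theorem sum_diff_coordVec {c x : M} (hx : x ∈ (chartAt (Model n) c).source) (v : Tan n x) :
    ∑ j : Fin n, diff n (coordFun c j) x v • coordVec c j x = v := by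
  have hb : x ∈ (trivializationAt (Model n) (TangentSpace 𝓘(ℂ, Model n)) c).baseSet := by
    simpa using hx
  conv_rhs => rw [← (trivializationAt (Model n) (TangentSpace 𝓘(ℂ, Model n)) c).symmL_continuousLinearMapAt
    (R := ℂ) hb v]
  set w : Model n :=
    (trivializationAt (Model n) (TangentSpace 𝓘(ℂ, Model n)) c).continuousLinearMapAt ℂ x v with hw
  have hs : w = ∑ j : Fin n, w j • EuclideanSpace.single j (1 : ℂ) := by
    ext i
    simp [Finset.sum_apply, Pi.single_apply]
  rw [hs, map_sum]
  refine Finset.sum_congr rfl fun j _ => ?_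
  rw [map_smul, diff_coordFun hx, Trivialization.symmL_apply _ hb]
  rfl

theorem HolVFAt.iff_coord {X : ∀ x : M, Tan n x} {x : M} : HolVFAt X x ↔
    ∀ i : Fin n, HolAt n (fun y => diff n (coordFun x i) y (X y)) x := by
  unfold HolVFAt
  rw [contMDiffAt_section]
  have key : (fun y => (trivializationAt (Model n) (TangentSpace 𝓘(ℂ, Model n)) x ⟨y, X y⟩).2) =ᶠ[𝓝 x]
      fun y => WithLp.toLp 2 fun i => diff n (coordFun x i) y (X y) := by
    filter_upwards [(chartAt (Model n) x).open_source.mem_nhds (mem_chart_source _ x)] with y hy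
    have e : (trivializationAt (Model n) (TangentSpace 𝓘(ℂ, Model n)) x).continuousLinearMapAt ℂ y (X y) =
        (trivializationAt (Model n) (TangentSpace 𝓘(ℂ, Model n)) x ⟨y, X y⟩).2 := by
      rw [Trivialization.continuousLinearMapAt_apply, Trivialization.linearMapAt_apply, if_pos]
      simpa using hy
    rw [← e]
    ext i
    exact (diff_coordFun hy i (X y)).symm
  have hk : ContMDiffAt 𝓘(ℂ, Model n) 𝓘(ℂ, Model n) ω
      (fun y => (trivializationAt (Model n) (TangentSpace 𝓘(ℂ, Model n)) x ⟨y, X y⟩).2) x ↔ _ :=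
    key.contMDiffAt_iff
  rw [hk]
  constructor
  · intro h i
    exact (EuclideanSpace.proj i : Model n →L[ℂ] ℂ).contMDiff.contMDiffAt.comp x h
  · intro h
    have h6 : ContMDiffAt 𝓘(ℂ, Model n) 𝓘(ℂ, Fin n → ℂ) ω
        (fun y i => diff n (coordFun x i) y (X y)) x := contMDiffAt_pi_space.2 h
    exact ((PiLp.continuousLinearEquiv 2 ℂ (fun _ : Fin n => ℂ)).symm :
      (Fin n → ℂ) →L[ℂ] Model n).contMDiff.contMDiffAt.comp x h6

theorem HolAt.diff_apply {X : ∀ x : M, Tan n x} {f : M → ℂ} {x : M} (hX : HolVFAt X x)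
    (hf : HolAt n f x) : HolAt n (fun y => diff n f y (X y)) x := by
  have h0 : ContMDiffAt 𝓘(ℂ, Model n).tangent 𝓘(ℂ, ℂ).tangent ω (tangentMap 𝓘(ℂ, Model n) 𝓘(ℂ, ℂ) f) (TotalSpace.mk' (Model n) x (X x)) := by
    obtain ⟨u, hu, hfu⟩ := (contMDiffAt_iff_contMDiffOn_nhds (n := ω) (by simp)).1 hf
    have h2 := (hfu.mono interior_subset).contMDiffOn_tangentMapWithin (m := ω) le_top isOpen_interior.uniqueMDiffOn
    have hx : x ∈ interior u := mem_interior_iff_mem_nhds.2 hu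
    have ho : IsOpen (TotalSpace.proj (F := Model n) (E := TangentSpace 𝓘(ℂ, Model n) (M := M)) ⁻¹' interior u) :=
      isOpen_interior.preimage (FiberBundle.continuous_proj (Model n) (TangentSpace 𝓘(ℂ, Model n) (M := M)))
    refine (h2.contMDiffAt (ho.mem_nhds hx)).congr_of_eventuallyEq ?_
    filter_upwards [ho.mem_nhds hx] with p hp
    simp [tangentMap, tangentMapWithin, mfderivWithin_of_isOpen isOpen_interior hp]
  have h1 := ContMDiffAt.comp x h0 hX
  rw [contMDiffAt_totalSpace] at h1
  refine h1.2.congr_of_eventuallyEq (Filter.Eventually.of_forall fun y => ?_)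
  simp [tangentMap, diff]
  rfl

theorem HolAt.eventually {f : M → ℂ} {x : M} (hf : HolAt n f x) : ∀ᶠ y in 𝓝 x, HolAt n f y :=
  (contMDiffAt_iff_contMDiffAt_nhds (by simp)).1 hf

theorem HolVFAt.eventually {X : ∀ x : M, Tan n x} {x : M} (hX : HolVFAt X x) :
    ∀ᶠ y in 𝓝 x, HolVFAt X y :=
  (contMDiffAt_iff_contMDiffAt_nhds (by simp)).1 hX

theorem HolAt.mdiff {f : M → ℂ} {x : M} (hf : HolAt n f x) :
    MDifferentiableAt 𝓘(ℂ, Model n) 𝓘(ℂ, ℂ) f x := ContMDiffAt.mdifferentiableAt hf (by simp)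

theorem HolAt.add {f g : M → ℂ} {x : M} (hf : HolAt n f x) (hg : HolAt n g x) : HolAt n (f + g) x :=
  ContMDiffAt.add hf hg

theorem HolAt.neg {f : M → ℂ} {x : M} (hf : HolAt n f x) : HolAt n (-f) x :=
  ContMDiffAt.neg hf

theorem HolAt.zero {x : M} : HolAt n (0 : M → ℂ) x := contMDiffAt_const

theorem HolAt.coordFun (x : M) (i : Fin n) : HolAt n (coordFun x i) x :=
  (EuclideanSpace.proj i : Model n →L[ℂ] ℂ).contMDiff.contMDiffAt.comp x contMDiffAt_extChartAt

theorem HolAt.congr {f g : M → ℂ} {x : M} (h : ∀ᶠ y in 𝓝 x, f y = g y) (hf : HolAt n f x) :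
    HolAt n g x :=
  ContMDiffAt.congr_of_eventuallyEq hf (by filter_upwards [h] with y hy using hy.symm)

theorem HolVFAt.congr {X Y : ∀ x : M, Tan n x} {x : M} (h : ∀ᶠ y in 𝓝 x, X y = Y y)
    (hX : HolVFAt X x) : HolVFAt Y x :=
  ContMDiffAt.congr_of_eventuallyEq hX (by filter_upwards [h] with y hy; rw [hy])

theorem diff_add {f g : M → ℂ} {x : M} (hf : HolAt n f x) (hg : HolAt n g x) :
    diff n (f + g) x = diff n f x + diff n g x := mfderiv_add hf.mdiff hg.mdiff

theorem diff_neg (f : M → ℂ) (x : M) : diff n (-f) x = - diff n f x := mfderiv_neg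

theorem diff_zero (x : M) : diff n (0 : M → ℂ) x = 0 := mfderiv_const

theorem diff_congr {f g : M → ℂ} {x : M} (h : ∀ᶠ y in 𝓝 x, f y = g y) : diff n f x = diff n g x :=
  Filter.EventuallyEq.mfderiv_eq h

theorem cotan_eq_sum {c x : M} (hx : x ∈ (chartAt (Model n) c).source) (α : Cotan n x) :
    ∑ j : Fin n, α (coordVec c j x) • diff n (coordFun c j) x = α := by
  ext v
  conv_rhs => rw [← sum_diff_coordVec hx v]
  simp [mul_comm]

/-- The fibre of `⋀²Θ_M` at `x`: alternating bilinear forms on the cotangent space, with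
`(u ∧ w)(α, β) = α(u) β(w) - α(w) β(u)`. -/
abbrev Bivector (n : ℕ) {M : Type u} [TopologicalSpace M] [ChartedSpace (Model n) M] (x : M) : Type :=
  Cotan n x [⋀^Fin 2]→ₗ[ℂ] ℂ

/-- The interior product `i(α)P`, the tangent vector with `β(i(α)P) = P(α, β)` for all `β`
(see `contract_apply`). -/
def contract (x : M) (P : Bivector n x) (α : Cotan n x) : Tan n x :=
  ∑ j : Fin n, P ![α, diff n (coordFun x j) x] • coordVec x j x

theorem bivector_update {x : M} (α γ : Cotan n x) :
    Function.update ![α, 0] 1 γ = ![α, γ] := by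
  ext i : 1
  fin_cases i <;> simp

theorem bivector_add {x : M} (P : Bivector n x) (α β γ : Cotan n x) :
    P ![α, β + γ] = P ![α, β] + P ![α, γ] := by
  simpa only [bivector_update] using P.map_update_add ![α, 0] 1 β γ

theorem bivector_smul {x : M} (P : Bivector n x) (α β : Cotan n x) (a : ℂ) :
    P ![α, a • β] = a * P ![α, β] := by
  simpa only [bivector_update, smul_eq_mul] using P.map_update_smul ![α, 0] 1 a β

theorem bivector_swap {x : M} (P : Bivector n x) (α β : Cotan n x) :
    P ![α, β] = - P ![β, α] := by
  have h := P.map_swap ![α, β] (i := 0) (j := 1) (by decide)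
  have h' : ![α, β] ∘ Equiv.swap (0 : Fin 2) 1 = ![β, α] := by
    ext i : 1
    fin_cases i <;> simp
  rw [h'] at h
  rw [h, neg_neg]

theorem contract_apply (x : M) (P : Bivector n x) (α β : Cotan n x) :
    β (contract x P α) = P ![α, β] := by
  let L : Cotan n x →ₗ[ℂ] ℂ :=
    { toFun := fun γ => P ![α, γ]
      map_add' := bivector_add P α
      map_smul' := fun a γ => bivector_smul P α γ a }
  have h : ∀ γ, P ![α, γ] = L γ := fun _ => rfl
  simp only [contract, map_sum, map_smul, h]
  conv_rhs => rw [← cotan_eq_sum (mem_chart_source (Model n) x) β]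
  simp [mul_comm]

theorem contract_unique {x : M} {v w : Tan n x} (h : ∀ β : Cotan n x, β v = β w) : v = w := by
  rw [← sum_diff_coordVec (mem_chart_source (Model n) x) v,
    ← sum_diff_coordVec (mem_chart_source (Model n) x) w]
  simp only [h]

/-- A holomorphic Poisson structure: a bivector field which is holomorphic (holomorphic functions
have holomorphic brackets `{f, g} = P(df, dg)`) and whose bracket satisfies the Jacobi identity. -/
structure PoissonStructure (n : ℕ) (M : Type u) [TopologicalSpace M] [ChartedSpace (Model n) M] where
  tensor : ∀ x : M, Bivector n x
  hol : ∀ {x : M} {f g : M → ℂ}, HolAt n f x → HolAt n g x →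
    HolAt n (fun y => tensor y ![diff n f y, diff n g y]) x
  jacobi : ∀ {x : M} {f g h : M → ℂ}, HolAt n f x → HolAt n g x → HolAt n h x →
    tensor x ![diff n f x, diff n (fun y => tensor y ![diff n g y, diff n h y]) x] +
    tensor x ![diff n g x, diff n (fun y => tensor y ![diff n h y, diff n f y]) x] +
    tensor x ![diff n h x, diff n (fun y => tensor y ![diff n f y, diff n g y]) x] = 0

namespace PoissonStructure
variable (P : PoissonStructure n M)

/-- The Poisson bracket `{f, g}`. -/
def bracket (f g : M → ℂ) (x : M) : ℂ := P.tensor x ![diff n f x, diff n g x]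

/-- The hamiltonian vector field `X_H = i(dH)P`. -/
def ham (H : M → ℂ) (x : M) : Tan n x := contract x (P.tensor x) (diff n H x)

theorem diff_ham (f H : M → ℂ) (x : M) : diff n f x (P.ham H x) = P.bracket H f x :=
  contract_apply x _ _ _

theorem ham_congr {f g : M → ℂ} {x : M} (h : ∀ᶠ y in 𝓝 x, f y = g y) : P.ham f x = P.ham g x := by
  rw [ham, diff_congr h, ham]

theorem ham_add {f g : M → ℂ} {x : M} (hf : HolAt n f x) (hg : HolAt n g x) :
    P.ham (f + g) x = P.ham f x + P.ham g x := by
  refine contract_unique fun β => ?_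
  rw [map_add]
  simp only [ham, contract_apply]
  rw [diff_add hf hg, bivector_swap, bivector_add, bivector_swap _ β, bivector_swap _ β]
  ring

theorem ham_zero (x : M) : P.ham 0 x = 0 := by
  have h := P.ham_add (x := x) HolAt.zero HolAt.zero
  rw [add_zero] at h
  exact left_eq_add.1 h

theorem ham_neg {f : M → ℂ} {x : M} (hf : HolAt n f x) : P.ham (-f) x = - P.ham f x := by
  have h := P.ham_add hf hf.neg
  rw [add_neg_cancel, ham_zero] at h
  exact (neg_eq_of_add_eq_zero_right h.symm).symm

/-- `L_X P = 0` at `x`, as an identity evaluated on exact 1-forms: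
`(L_X P)(df, dg) = X(P(df, dg)) - P(d(X f), dg) - P(df, d(X g))`. -/
def IsPoissonAt (X : ∀ x : M, Tan n x) (x : M) : Prop :=
  ∀ f g : M → ℂ, HolAt n f x → HolAt n g x →
    diff n (P.bracket f g) x (X x) =
      P.bracket (fun y => diff n f y (X y)) g x + P.bracket f (fun y => diff n g y (X y)) x

theorem bracket_swap (f g : M → ℂ) (x : M) : P.bracket f g x = - P.bracket g f x :=
  bivector_swap _ _ _

theorem bracket_add {f g h : M → ℂ} {x : M} (hg : HolAt n g x) (hh : HolAt n h x) :
    P.bracket f (g + h) x = P.bracket f g x + P.bracket f h x := by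
  unfold bracket
  rw [diff_add hg hh, bivector_add]

theorem bracket_neg (f g : M → ℂ) (x : M) : P.bracket f (-g) x = - P.bracket f g x := by
  unfold bracket
  rw [diff_neg, ← neg_one_smul ℂ, bivector_smul, neg_one_mul]

theorem bracket_zero (f : M → ℂ) (x : M) : P.bracket f 0 x = 0 := by
  unfold bracket
  rw [diff_zero, ← zero_smul ℂ (0 : Cotan n x), bivector_smul, zero_mul]

theorem bracket_congr {f g g' : M → ℂ} {x : M} (h : ∀ᶠ y in 𝓝 x, g y = g' y) :
    P.bracket f g x = P.bracket f g' x := by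
  unfold bracket
  rw [diff_congr h]

theorem isPoissonAt_add {X Y : ∀ x : M, Tan n x} {x : M} (hX : HolVFAt X x) (hY : HolVFAt Y x)
    (hX' : P.IsPoissonAt X x) (hY' : P.IsPoissonAt Y x) : P.IsPoissonAt (X + Y) x := by
  intro f g hf hg
  have e : ∀ k : M → ℂ, (fun y => diff n k y ((X + Y) y)) =
      (fun y => diff n k y (X y)) + (fun y => diff n k y (Y y)) := fun k => by
    funext y
    exact map_add _ _ _
  rw [e f, e g, bracket_add P (HolAt.diff_apply hX hg) (HolAt.diff_apply hY hg),
    P.bracket_swap (_ + _), bracket_add P (HolAt.diff_apply hX hf) (HolAt.diff_apply hY hf),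
    Pi.add_apply, map_add, hX' f g hf hg, hY' f g hf hg, P.bracket_swap _ g, P.bracket_swap _ g]
  ring

theorem isPoissonAt_neg {X : ∀ x : M, Tan n x} {x : M} (hX : P.IsPoissonAt X x) :
    P.IsPoissonAt (-X) x := by
  intro f g hf hg
  have e : ∀ k : M → ℂ, (fun y => diff n k y ((-X) y)) = -(fun y => diff n k y (X y)) := fun k => by
    funext y
    exact map_neg _ _
  rw [e f, e g, bracket_neg, P.bracket_swap (-_), bracket_neg, Pi.neg_apply, map_neg, hX f g hf hg,
    P.bracket_swap _ g]
  ring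

theorem isPoissonAt_zero (x : M) : P.IsPoissonAt 0 x := by
  intro f g _ _
  have e : ∀ k : M → ℂ, (fun y => diff n k y ((0 : ∀ x : M, Tan n x) y)) = 0 := fun k => by
    funext y
    exact map_zero _
  rw [e f, e g, bracket_zero, P.bracket_swap 0, bracket_zero, Pi.zero_apply, map_zero]
  simp

theorem isPoissonAt_congr {X Y : ∀ x : M, Tan n x} {x : M} (h : ∀ᶠ y in 𝓝 x, X y = Y y)
    (hX : P.IsPoissonAt X x) : P.IsPoissonAt Y x := by
  intro f g hf hg
  have e : ∀ k : M → ℂ, ∀ᶠ y in 𝓝 x, diff n k y (Y y) = diff n k y (X y) := fun k => by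
    filter_upwards [h] with y hy
    rw [hy]
  rw [P.bracket_swap (fun y => diff n f y (Y y)), P.bracket_congr (e f), P.bracket_congr (e g),
    ← P.bracket_swap, ← h.self_of_nhds]
  exact hX f g hf hg

theorem holVFAt_ham {H : M → ℂ} {x : M} (hH : HolAt n H x) : HolVFAt (P.ham H) x := by
  rw [HolVFAt.iff_coord]
  intro i
  simp only [diff_ham]
  exact P.hol hH (HolAt.coordFun x i)

theorem isPoissonAt_ham {H : M → ℂ} {x : M} (hH : HolAt n H x) : P.IsPoissonAt (P.ham H) x := by
  intro f g hf hg
  simp only [diff_ham]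
  have j := P.jacobi hH hf hg
  change P.bracket H (P.bracket f g) x + P.bracket f (P.bracket g H) x +
    P.bracket g (P.bracket H f) x = 0 at j
  have e : P.bracket g H = -P.bracket H g := by
    funext y
    exact P.bracket_swap g H y
  rw [e, bracket_neg] at j
  change P.bracket H (P.bracket f g) x = P.bracket (P.bracket H f) g x + P.bracket f (P.bracket H g) x
  rw [P.bracket_swap (P.bracket H f)]
  linear_combination j

/-- Holomorphic functions. -/
def holomorphicFunctions (n : ℕ) (M : Type u) [TopologicalSpace M] [ChartedSpace (Model n) M]
    [IsManifold 𝓘(ℂ, Model n) ω M] : GermCondition (fun _ : M => ℂ) where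
  germs x :=
    { carrier := {f | HolAt n f x}
      add_mem' := HolAt.add
      zero_mem' := HolAt.zero
      neg_mem' := HolAt.neg }
  congr := HolAt.congr

/-- Casimir functions: holomorphic functions `f` with `X_f = 0`. -/
def casimirs : GermCondition (fun _ : M => ℂ) where
  germs x :=
    { carrier := {f | HolAt n f x ∧ ∀ᶠ y in 𝓝 x, P.ham f y = 0}
      add_mem' := fun {f g} hf hg => ⟨hf.1.add hg.1, by
        filter_upwards [hf.2, hg.2, hf.1.eventually, hg.1.eventually] with y h1 h2 h3 h4
        rw [P.ham_add h3 h4, h1, h2, add_zero]⟩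
      zero_mem' := ⟨HolAt.zero, Filter.Eventually.of_forall P.ham_zero⟩
      neg_mem' := fun {f} hf => ⟨hf.1.neg, by
        filter_upwards [hf.2, hf.1.eventually] with y h1 h3
        rw [P.ham_neg h3, h1, neg_zero]⟩ }
  congr := fun {x f g} h hf => ⟨hf.1.congr h, by
    filter_upwards [hf.2, h.eventually_nhds] with y h1 h2
    rw [← P.ham_congr h2, h1]⟩

/-- Poisson vector fields: holomorphic vector fields `X` with `L_X P = 0`. -/
def poissonFields : GermCondition (fun x : M => Tan n x) where
  germs x :=
    { carrier := {X | HolVFAt X x ∧ ∀ᶠ y in 𝓝 x, P.IsPoissonAt X y}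
      add_mem' := fun {X Y} hX hY => ⟨ContMDiffAt.add_section hX.1 hY.1, by
        filter_upwards [hX.2, hY.2, hX.1.eventually, hY.1.eventually] with y h1 h2 h3 h4
        exact P.isPoissonAt_add h3 h4 h1 h2⟩
      zero_mem' := ⟨HolVFAt.iff_coord.2 fun i => by
          simp only [Pi.zero_apply, map_zero]
          exact HolAt.zero, Filter.Eventually.of_forall P.isPoissonAt_zero⟩
      neg_mem' := fun {X} hX => ⟨ContMDiffAt.neg_section hX.1, by
        filter_upwards [hX.2] with y h1 using P.isPoissonAt_neg h1⟩ }
  congr := fun {x X Y} h hX => ⟨hX.1.congr h, by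
    filter_upwards [hX.2, h.eventually_nhds] with y h1 h2
    exact P.isPoissonAt_congr h2 h1⟩

/-- Locally hamiltonian vector fields: locally of the form `X_H` with `H` holomorphic. -/
def hamiltonianFields : GermCondition (fun x : M => Tan n x) where
  germs x :=
    { carrier := {X | ∃ H : M → ℂ, HolAt n H x ∧ ∀ᶠ y in 𝓝 x, X y = P.ham H y}
      add_mem' := fun {X Y} ⟨H, hH, hX⟩ ⟨K, hK, hY⟩ => ⟨H + K, hH.add hK, by
        filter_upwards [hX, hY, hH.eventually, hK.eventually] with y h1 h2 h3 h4
        rw [Pi.add_apply, h1, h2, P.ham_add h3 h4]⟩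
      zero_mem' := ⟨0, HolAt.zero, Filter.Eventually.of_forall fun y => (P.ham_zero y).symm⟩
      neg_mem' := fun {X} ⟨H, hH, hX⟩ => ⟨-H, hH.neg, by
        filter_upwards [hX, hH.eventually] with y h1 h2
        rw [Pi.neg_apply, h1, P.ham_neg h2]⟩ }
  congr := fun {x X Y} h ⟨H, hH, hX⟩ => ⟨H, hH, by
    filter_upwards [hX, h] with y h1 h2
    rw [← h2, h1]⟩

/-- Casimir functions are holomorphic functions. -/
def casimirInclusion : GermCondition.LocalOperator P.casimirs (holomorphicFunctions n M) where
  toFun f := f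
  congr h := h.self_of_nhds
  add _ _ := rfl
  mem h := h.1

/-- `H ↦ X_H`. -/
def hamiltonianOperator :
    GermCondition.LocalOperator (holomorphicFunctions n M) P.hamiltonianFields where
  toFun := P.ham
  congr h := P.ham_congr h
  add hf hg := P.ham_add hf hg
  mem {_ f} hf := ⟨f, hf, Filter.Eventually.of_forall fun _ => rfl⟩

/-- Locally hamiltonian vector fields are Poisson. -/
def hamiltonianInclusion : GermCondition.LocalOperator P.hamiltonianFields P.poissonFields where
  toFun X := X
  congr h := h.self_of_nhds
  add _ _ := rfl
  mem {x X} := fun ⟨H, hH, hX⟩ => by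
    have hX' : ∀ᶠ y in 𝓝 x, P.ham H y = X y := by
      filter_upwards [hX] with y hy using hy.symm
    refine P.poissonFields.congr hX' ⟨P.holVFAt_ham hH, ?_⟩
    filter_upwards [hH.eventually] with y hy using P.isPoissonAt_ham hy
end PoissonStructure

/-- Families of alternating `n`-forms on the tangent spaces (`n = dim M`), not assumed holomorphic. -/
abbrev NForm (n : ℕ) (M : Type u) [TopologicalSpace M] [ChartedSpace (Model n) M] : Type u :=
  ∀ x : M, Tan n x [⋀^Fin n]→ₗ[ℂ] ℂ

/-- The coefficient `h = ν(∂/∂z_1, …, ∂/∂z_n)` of the `n`-form `ν = h dz_1 ∧ ⋯ ∧ dz_n` in the chart at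
`c`. -/
def volCoeff (ν : NForm n M) (c x : M) : ℂ := ν x fun i => coordVec c i x

/-- `ν` is a holomorphic volume form (nowhere zero holomorphic `n`-form) on `V`; its values outside
`V` play no role. -/
def IsVolumeFormOn (ν : NForm n M) (V : Opens M) : Prop :=
  ∀ x ∈ V, ν x ≠ 0 ∧ HolAt n (volCoeff ν x) x

/-- The Koszul operator of `ν = h dz_1 ∧ ⋯ ∧ dz_n` on bivector fields, computed at `c` in the chart at
`c`: `D P = -h⁻¹ ∑_{i,j} ∂(h P(dz_i, dz_j))/∂z_i · ∂/∂z_j`.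
This is `*⁻¹ d *` for the isomorphism `*` from multivector fields to forms given by contraction with
`ν`, with the sign for which `D` generates the Schouten bracket: `D X = -div_ν X` on vector fields
and `D(u ∧ w) = (D u) w - (D w) u - [u, w]`. -/
def koszul (ν : NForm n M) (P : ∀ x : M, Bivector n x) (c : M) : Tan n c :=
  -(volCoeff ν c c)⁻¹ • ∑ j : Fin n, (∑ i : Fin n,
    diff n (fun x => volCoeff ν c x * P x ![diff n (coordFun c i) x, diff n (coordFun c j) x]) c
      (coordVec c i c)) • coordVec c j c

namespace PoissonStructure
variable (P : PoissonStructure n M)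

/-- The rank of the Poisson tensor at `x`: the dimension of the image of `α ↦ i(α)P`. -/
def rank (x : M) : ℕ :=
  Module.finrank ℂ (Submodule.span ℂ (Set.range (contract x (P.tensor x))))

/-- The regular set: the open set of the points near which the rank is constant. The singular set is
its complement. -/
def regularSet : Opens M where
  carrier := {x | ∀ᶠ y in 𝓝 x, P.rank y = P.rank x}
  is_open' := isOpen_iff_mem_nhds.2 fun x hx => by
    filter_upwards [hx.eventually_nhds, hx] with y h1 h2
    filter_upwards [h1] with z hz
    rw [hz, h2]

/-- `O_M`. -/
def functionSheaf (n : ℕ) (M : Type u) [TopologicalSpace M] [ChartedSpace (Model n) M]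
    [IsManifold 𝓘(ℂ, Model n) ω M] : AbSheaf M := (holomorphicFunctions n M).sheaf

/-- `C_M`. -/
def casimirSheaf : AbSheaf M := P.casimirs.sheaf

/-- The sheaf `Der` of Poisson vector fields. -/
def derSheaf : AbSheaf M := P.poissonFields.sheaf

/-- The sheaf `Ham` of locally hamiltonian vector fields. -/
def hamSheaf : AbSheaf M := P.hamiltonianFields.sheaf

/-- The inclusion `C_M → O_M`. -/
def casimirToFunction : P.casimirSheaf ⟶ functionSheaf n M := P.casimirInclusion.sheafHom

/-- `O_M → Ham`, `H ↦ X_H`. -/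
def functionToHam : functionSheaf n M ⟶ P.hamSheaf := P.hamiltonianOperator.sheafHom

/-- The inclusion `Ham → Der`. -/
def hamToDer : P.hamSheaf ⟶ P.derSheaf := P.hamiltonianInclusion.sheafHom

/-- The quotient sheaf `O_M / C_M`. -/
def functionModCasimir : AbSheaf M := cokernel P.casimirToFunction

/-- The quotient sheaf `Der / Ham`; its sections are the outer Poisson vector fields. -/
def outerSheaf : AbSheaf M := cokernel P.hamToDer

/-- The projection `Der → Der / Ham`. -/
def derToOuter : P.derSheaf ⟶ P.outerSheaf := cokernel.π P.hamToDer

theorem casimir_functionToHam : P.casimirToFunction ≫ P.functionToHam = 0 := by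
  ext W s
  apply Subtype.ext
  funext x
  obtain ⟨x, hx⟩ := x
  change P.ham (extendZero _) x = 0
  refine Eq.trans (P.ham_congr ?_) (s.2 x hx).2.self_of_nhds
  filter_upwards [W.unop.isOpen.mem_nhds hx] with y hy
  rw [extendZero_apply _ (show y ∈ W.unop from hy)]
  rfl

/-- `O_M / C_M → Ham`, induced by `H ↦ X_H`. -/
def hamiltonianMap : P.functionModCasimir ⟶ P.hamSheaf :=
  cokernel.desc _ P.functionToHam P.casimir_functionToHam

instance mono_hamToDer : Mono P.hamToDer := by
  have : Mono P.hamToDer.1 := by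
    have h : ∀ W, Mono (P.hamToDer.1.app W) := fun W => by
      refine ConcreteCategory.mono_of_injective _ fun s t hst => ?_
      apply Subtype.ext
      funext x
      have h' := congrArg (fun z : P.poissonFields.sections W.unop => z.1 x) hst
      change extendZero s.1 x.1 = extendZero t.1 x.1 at h'
      rwa [extendZero_apply _ x.2, extendZero_apply _ x.2] at h'
    exact NatTrans.mono_of_mono_app _
  exact Sheaf.Hom.mono_of_presheaf_mono _ _ _

/-- `0 → Ham → Der → Der / Ham → 0`. -/
def outerSequence : ShortComplex (AbSheaf M) :=
  ShortComplex.mk P.hamToDer P.derToOuter (cokernel.condition _)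

theorem outerSequence_shortExact : P.outerSequence.ShortExact where
  exact := ShortComplex.exact_cokernel _
  mono_f := P.mono_hamToDer
  epi_g := (inferInstance : Epi (cokernel.π P.hamToDer))

/-- The Poisson vector field `v` over `V` is `D_ν P`. -/
def IsKoszulField (ν : NForm n M) {V : Opens M} (v : Sec P.derSheaf V) : Prop :=
  ∀ x : V, (show P.poissonFields.sections V from v).1 x = koszul ν P.tensor x

/-- `ξ` is the canonical outer vector field: over every open set `V` with a volume form `ν`, it is the
class of `D_ν P`. -/
def IsOuterField (ξ : Sec P.outerSheaf ⊤) : Prop :=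
  ∀ (V : Opens M) (ν : NForm n M), IsVolumeFormOn ν V →
    ∃ v : Sec P.derSheaf V, P.IsKoszulField ν v ∧
      restrictSec P.outerSheaf le_top ξ = mapSec P.derToOuter V v

/-- `s` is the section of `O_M / C_M` over `W` that corresponds to `D_ν P`, which is then locally
hamiltonian over `W`: locally, `s` is the class of a function `H` with `X_H = D_ν P`. -/
def IsSingularityClass (ν : NForm n M) {W : Opens M}
    (s : Sec P.functionModCasimir W) : Prop :=
  P.IsKoszulField ν (mapSec P.hamToDer W (mapSec P.hamiltonianMap W s))

/-- `H^k_S(M, F)`, where `S` is the singular set of `P`. -/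
abbrev SupportedCohomology (F : AbSheaf M) (k : ℕ) : Type u :=
  LocalCohomology (le_top : P.regularSet ≤ ⊤) F k

/-- The connecting homomorphism `H^k_S(M, Der / Ham) → H^{k+1}_S(M, Ham)`. -/
def outerConnecting (k : ℕ) :
    P.SupportedCohomology P.outerSheaf k →+ P.SupportedCohomology P.hamSheaf (k + 1) :=
  LocalCohomology.connecting le_top P.outerSequence_shortExact k

end PoissonStructure
end

end

end OuterPoisson

open OuterPoisson

/-! The geometric content is local; the cohomological statement then follows formally.

The field `D_ν π` acts on functions by `f ↦ div_ν X_f` (`diff_koszul`). Divergence does not depend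
on coordinates (`div_eq_div`) and satisfies `div [X, Y] = X (div Y) - Y (div X)` (`div_lie`).
Together with `[X_f, X_g] = X_{f, g}` this makes `D_ν π` a Poisson vector field. If `ν` and `ν'`
have coefficients `h` and `h'`, the two divergences of `X_f` differ by `X_f (log h - log h')`. So
`D_ν π - D_ν' π` is locally hamiltonian (`koszul_sub_koszul`), and the classes of the fields
attached to the chart volume forms glue to `ξ`.

The crux is that `D_ν π` is locally hamiltonian at a regular point (`koszul_isHam_of_regular`).
Choose coordinate functions `w_a`, as many as the rank, with an invertible matrix of brackets. Since
the rank is constant, the `X_{w_a}` generate all hamiltonian fields, and the fields `Y_b` in their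
span with `Y_b w_c = δ_bc` commute. The field `D_ν π` is a combination of the `X_{w_a}`, so it
corresponds to a 1-form `θ` along the symplectic leaves, which is closed because `D_ν π` is Poisson
(`Y_leafForm`). A function `H` with `Y_b H = θ_b` is then a hamiltonian. It is built one field at a
time from holomorphic Cauchy problems `Y u = g`, `u = 0` on a hyperplane
(`exists_common_primitive`). These are solved by analytic flows, which the inverse function theorem
on a Banach space of curves provides.

On the sheaf side, `O_M / C_M → Ham` is an isomorphism, so sections and classes may be compared in
`Ham`. Cohomology with supports is `Ext` out of `ℤ_V / ℤ_W`. A section `v` of `Der` over `V` that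
lifts `ξ` and comes from a section `w` of `Ham` over `W` gives a morphism of short exact sequences,
and naturality of extension classes says that the connecting homomorphism yields `∂ w`
(`connecting_eq_boundary`). Taking `v = D_ν π` identifies `c` over every open set that carries a
volume form. -/

namespace OuterPoisson

noncomputable section

/-! ### Analytic composition operators on spaces of continuous functions. -/

section Superposition

variable {K : Type*} [TopologicalSpace K] [CompactSpace K]
  {E F : Type*} [NormedAddCommGroup E] [NormedSpace ℂ E] [NormedAddCommGroup F] [NormedSpace ℂ F]

/-- The pointwise extension of a continuous multilinear map to continuous functions. -/
def pointwiseMultilinear (K : Type*) [TopologicalSpace K] [CompactSpace K] {k : ℕ}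
    (m : ContinuousMultilinearMap ℂ (fun _ : Fin k => E) F) :
    ContinuousMultilinearMap ℂ (fun _ : Fin k => C(K, E)) C(K, F) :=
  MultilinearMap.mkContinuous
    { toFun := fun γ => ⟨fun t => m fun i => γ i t, by fun_prop⟩
      map_update_add' := fun γ i a b => by
        ext t
        have h : ∀ c : C(K, E), (fun j => (Function.update γ i c j) t) =
            Function.update (fun j => γ j t) i (c t) := fun c => by
          funext j
          by_cases hj : j = i
          · subst hj; simp
          · simp [hj]
        simp only [ContinuousMap.coe_mk, ContinuousMap.add_apply, h, m.map_update_add]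
      map_update_smul' := fun γ i a b => by
        ext t
        have h : ∀ c : C(K, E), (fun j => (Function.update γ i c j) t) =
            Function.update (fun j => γ j t) i (c t) := fun c => by
          funext j
          by_cases hj : j = i
          · subst hj; simp
          · simp [hj]
        simp only [ContinuousMap.coe_mk, ContinuousMap.smul_apply, h, m.map_update_smul] }
    ‖m‖ fun γ => by
      rw [ContinuousMap.norm_le _ (by positivity)]
      intro t
      refine (m.le_opNorm _).trans ?_
      gcongr with i
      exact (γ i).norm_coe_le_norm t

theorem norm_pointwiseMultilinear_le {k : ℕ}
    (m : ContinuousMultilinearMap ℂ (fun _ : Fin k => E) F) : ‖pointwiseMultilinear K m‖ ≤ ‖m‖ :=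
  MultilinearMap.mkContinuous_norm_le _ (norm_nonneg _) _

/-- Composition with a function that is analytic at `x` is analytic on continuous functions near the
constant `x`. -/
theorem exists_analytic_superposition (K : Type*) [TopologicalSpace K] [CompactSpace K]
    [CompleteSpace F] {f : E → F} {x : E} (hf : AnalyticAt ℂ f x) :
    ∃ N : C(K, E) → C(K, F), AnalyticAt ℂ N (ContinuousMap.const K x) ∧
      ∀ᶠ γ in 𝓝 (ContinuousMap.const K x), ∀ t, N γ t = f (γ t) := by
  obtain ⟨p, r, hp⟩ := hf
  -- Extending the coefficients pointwise does not increase their norms, so this series converges at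
  -- least where that of `f` does. Evaluation at `t` is continuous and linear, hence carries its sum
  -- to the sum of `p` at `γ t - x`.
  let q : FormalMultilinearSeries ℂ C(K, E) C(K, F) := fun k => pointwiseMultilinear K (p k)
  have hr : p.radius ≤ q.radius :=
    FormalMultilinearSeries.radius_le_of_le fun k => norm_pointwiseMultilinear_le (p k)
  have hq := q.hasFPowerSeriesOnBall (lt_of_lt_of_le (hp.r_pos.trans_le hp.r_le) hr)
  have hq2 := hq.comp_sub (ContinuousMap.const K x)
  rw [zero_add] at hq2
  refine ⟨fun γ => q.sum (γ - ContinuousMap.const K x), hq2.analyticAt, ?_⟩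
  filter_upwards [Metric.eball_mem_nhds (ContinuousMap.const K x) hp.r_pos] with γ hγ t
  have h1 : γ - ContinuousMap.const K x ∈ Metric.eball (0 : C(K, E)) q.radius := by
    rw [Metric.mem_eball, edist_zero_right, ← edist_eq_enorm_sub]
    exact lt_of_lt_of_le hγ (hp.r_le.trans hr)
  have h2 := (hq.hasSum h1).map (ContinuousMap.evalCLM ℂ t) (ContinuousMap.evalCLM ℂ t).continuous
  have h3 : γ t - x ∈ Metric.eball (0 : E) r := by
    rw [Metric.mem_eball, edist_zero_right, ← edist_eq_enorm_sub]
    refine lt_of_le_of_lt ?_ hγ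
    simpa [edist_dist] using ENNReal.ofReal_le_ofReal (ContinuousMap.dist_apply_le_dist (f := γ) (g := ContinuousMap.const K x) t)
  have h4 := hp.hasSum h3
  rw [add_sub_cancel] at h4
  rw [zero_add] at h2
  exact h2.unique h4

end Superposition

end

end OuterPoisson


/-! ### Flows of analytic vector fields in complex time. -/

namespace OuterPoisson

noncomputable section

section Flow

open unitInterval

variable {E : Type*} [NormedAddCommGroup E] [NormedSpace ℂ E]

theorem continuous_comp_projIcc (γ : C(I, E)) :
    Continuous fun s : ℝ => γ (Set.projIcc (0 : ℝ) 1 zero_le_one s) := by fun_prop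

/-- The primitive `t ↦ ∫₀ᵗ γ` on continuous curves. -/
def curvePrimitive (E : Type*) [NormedAddCommGroup E] [NormedSpace ℂ E] [CompleteSpace E] :
    C(I, E) →L[ℂ] C(I, E) :=
  LinearMap.mkContinuous
    { toFun := fun γ => ⟨fun t => ∫ s in (0 : ℝ)..t, γ (Set.projIcc (0 : ℝ) 1 zero_le_one s),
        (intervalIntegral.continuous_primitive
          (fun a b => (continuous_comp_projIcc γ).intervalIntegrable a b) 0).comp
          continuous_subtype_val⟩
      map_add' := fun γ δ => by
        ext t
        exact intervalIntegral.integral_add ((continuous_comp_projIcc γ).intervalIntegrable _ _)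
          ((continuous_comp_projIcc δ).intervalIntegrable _ _)
      map_smul' := fun c γ => by
        ext t
        exact intervalIntegral.integral_smul c _ }
    1 fun γ => by
      rw [one_mul, ContinuousMap.norm_le _ (norm_nonneg _)]
      intro t
      refine (intervalIntegral.norm_integral_le_of_norm_le_const
        fun s _ => γ.norm_coe_le_norm _).trans ?_
      rw [sub_zero, abs_of_nonneg t.2.1]
      exact mul_le_of_le_one_right (norm_nonneg _) t.2.2

variable [CompleteSpace E]

theorem curvePrimitive_apply (γ : C(I, E)) (t : I) :
    curvePrimitive E γ t = ∫ s in (0 : ℝ)..t, γ (Set.projIcc (0 : ℝ) 1 zero_le_one s) := rfl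

/-- Reparametrization by `t ↦ τ t`. -/
def rescaleCurve (τ : I) (γ : C(I, E)) : C(I, E) := ⟨fun t => γ (τ * t), by fun_prop⟩

/-- Substitution `s ↦ τ s` in the integral. It shows that rescaling a solution of the integral
equation for time `z` gives a solution for time `τ z`. -/
theorem curvePrimitive_rescale (γ : C(I, E)) (τ t : I) :
    (τ : ℂ) • curvePrimitive E (rescaleCurve τ γ) t = curvePrimitive E γ (τ * t) := by
  rw [curvePrimitive_apply, curvePrimitive_apply]
  have h := intervalIntegral.smul_integral_comp_mul_left (a := 0) (b := (t : ℝ))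
    (fun s => γ (Set.projIcc (0 : ℝ) 1 zero_le_one s)) (τ : ℝ)
  rw [mul_zero] at h
  rw [show ((τ * t : I) : ℝ) = τ * t from rfl, ← h, Complex.coe_smul]
  congr 1
  refine intervalIntegral.integral_congr fun s hs => ?_
  rw [Set.uIcc_of_le t.2.1] at hs
  have hs' : s ∈ I := ⟨hs.1, hs.2.trans t.2.2⟩
  have hτ : (τ : ℝ) * s ∈ I := ⟨mul_nonneg τ.2.1 hs.1, mul_le_one₀ τ.2.2 hs.1 hs'.2⟩
  change γ (τ * _) = γ _
  rw [Set.projIcc_of_mem _ hs', Set.projIcc_of_mem _ hτ]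
  rfl

theorem hasDerivWithinAt_curvePrimitive (γ : C(I, E)) (t : I) :
    HasDerivWithinAt (fun s : ℝ => ∫ r in (0 : ℝ)..s, γ (Set.projIcc (0 : ℝ) 1 zero_le_one r))
      (γ t) I t := by
  have h := intervalIntegral.integral_hasDerivAt_right (a := 0) (b := (t : ℝ))
    ((continuous_comp_projIcc γ).intervalIntegrable _ _)
    ((continuous_comp_projIcc γ).stronglyMeasurableAtFilter _ _)
    (continuous_comp_projIcc γ).continuousAt
  rw [Set.projIcc_val] at h
  exact h.hasDerivWithinAt

/-- The flow of an analytic vector field on a complex Banach space exists for small complex times and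
is analytic in the time and the starting point. -/
theorem exists_analytic_flow {X : E → E} {p : E} (hX : AnalyticAt ℂ X p) :
    ∃ Φ : ℂ × E → E, AnalyticAt ℂ Φ (0, p) ∧ Φ (0, p) = p ∧
      ∀ᶠ z in 𝓝 ((0, p) : ℂ × E), Φ (0, z.2) = z.2 ∧
        HasDerivAt (fun t => Φ (t, z.2)) (X (Φ z)) z.1 := by
  obtain ⟨N, hN, hNX⟩ := exists_analytic_superposition I hX
  set c := curvePrimitive E (N (ContinuousMap.const I p)) with hc
  let cst : E →L[ℂ] C(I, E) := ContinuousLinearMap.const ℂ I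
  have hcst : ∀ y t, cst y t = y := fun y t => rfl
  have hcp : cst p = ContinuousMap.const I p := rfl
  -- The trajectory `s ↦ Φ (s z, y)`, `s ∈ [0, 1]`, solves `γ = y + z ∫ X(γ)`, that is, `G (γ, (z,
  -- y)) = (0, (z, y))`. Carrying the parameters along turns the equation with parameters into the
  -- inversion of a single map.
  let G : C(I, E) × (ℂ × E) → C(I, E) × (ℂ × E) := fun q =>
    (q.1 - cst q.2.2 - q.2.1 • curvePrimitive E (N q.1), q.2)
  let a : C(I, E) × (ℂ × E) := (cst p, (0, p))
  have hNa : AnalyticAt ℂ (fun q : C(I, E) × (ℂ × E) => N q.1) a :=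
    AnalyticAt.fun_comp (f := fun q : C(I, E) × (ℂ × E) => q.1) (x := a) hN analyticAt_fst
  have hJN : AnalyticAt ℂ (fun q : C(I, E) × (ℂ × E) => curvePrimitive E (N q.1)) a :=
    ((curvePrimitive E).analyticAt _).fun_comp hNa
  have hGa : AnalyticAt ℂ G a := by
    refine AnalyticAt.prod ?_ analyticAt_snd
    refine (analyticAt_fst.sub ((cst.analyticAt _).fun_comp (analyticAt_snd.fun_comp analyticAt_snd))).sub ?_
    exact (analyticAt_fst.fun_comp analyticAt_snd).smul hJN
  -- The derivative of `G` at `a`. The time is `0` there, so the derivative of `N` drops out and the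
  -- map is unipotent, with explicit inverse `L'`.
  let L : (C(I, E) × (ℂ × E)) →L[ℂ] (C(I, E) × (ℂ × E)) :=
    (ContinuousLinearMap.fst ℂ _ _ - cst ∘L (ContinuousLinearMap.snd ℂ _ _ ∘L ContinuousLinearMap.snd ℂ _ _)
      - (ContinuousLinearMap.fst ℂ ℂ E ∘L ContinuousLinearMap.snd ℂ C(I, E) _).smulRight c).prod
      (ContinuousLinearMap.snd ℂ _ _)
  let L' : (C(I, E) × (ℂ × E)) →L[ℂ] (C(I, E) × (ℂ × E)) :=
    (ContinuousLinearMap.fst ℂ _ _ + cst ∘L (ContinuousLinearMap.snd ℂ _ _ ∘L ContinuousLinearMap.snd ℂ _ _)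
      + (ContinuousLinearMap.fst ℂ ℂ E ∘L ContinuousLinearMap.snd ℂ C(I, E) _).smulRight c).prod
      (ContinuousLinearMap.snd ℂ _ _)
  let e : (C(I, E) × (ℂ × E)) ≃L[ℂ] (C(I, E) × (ℂ × E)) :=
    ContinuousLinearEquiv.equivOfInverse L L'
      (fun q => Prod.ext (by simp [L, L']; abel) rfl) (fun q => Prod.ext (by simp [L, L']; abel) rfl)
  have hGd : HasFDerivAt G (e : (C(I, E) × (ℂ × E)) →L[ℂ] (C(I, E) × (ℂ × E))) a := by
    have h1 : HasFDerivAt (fun q : C(I, E) × (ℂ × E) => q.1 - cst q.2.2)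
        (ContinuousLinearMap.fst ℂ _ _ -
          cst ∘L (ContinuousLinearMap.snd ℂ _ _ ∘L ContinuousLinearMap.snd ℂ _ _)) a :=
      ContinuousLinearMap.hasFDerivAt (𝕜 := ℂ) (ContinuousLinearMap.fst ℂ C(I, E) (ℂ × E) -
          cst ∘L (ContinuousLinearMap.snd ℂ _ _ ∘L ContinuousLinearMap.snd ℂ _ _))
    have h2 := ((ContinuousLinearMap.fst ℂ ℂ E ∘L
      ContinuousLinearMap.snd ℂ C(I, E) _).hasFDerivAt (x := a)).smul hJN.differentiableAt.hasFDerivAt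
    have h3 := (h1.sub h2).prodMk (hasFDerivAt_snd (𝕜 := ℂ) (p := a))
    refine HasFDerivAt.congr_fderiv h3 (ContinuousLinearMap.ext fun q => Prod.ext ?_ rfl)
    simp [e, L, a, hc, hcp]
  have hG0 : G a = (0, (0, p)) := by simp [G, a]
  have hGc : ContDiffAt ℂ ω G a := hGa.contDiffAt
  have hω : (ω : WithTop ℕ∞) ≠ 0 := by simp
  let S := hGc.hasStrictFDerivAt' hGd hω
  let Λ := S.localInverse G e a
  have hΛ : AnalyticAt ℂ Λ (0, (0, p)) := by
    have := hGc.to_localInverse hGd hω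
    rw [hG0] at this
    exact this.analyticAt
  have hΛl : ∀ᶠ q in 𝓝 a, Λ (G q) = q := S.eventually_left_inverse
  have hΛr : ∀ᶠ q in 𝓝 ((0, (0, p)) : C(I, E) × (ℂ × E)), G (Λ q) = q := by
    have := S.eventually_right_inverse
    rwa [hG0] at this
  have hΛ0 : Λ (0, (0, p)) = a := by
    have h := hΛl.self_of_nhds
    rwa [hG0] at h
  let Γ : ℂ × E → C(I, E) := fun z => (Λ (0, z)).1
  have hι : AnalyticAt ℂ (fun z : ℂ × E => ((0, z) : C(I, E) × (ℂ × E))) (0, p) :=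
    AnalyticAt.prod analyticAt_const analyticAt_id
  have hΓ : AnalyticAt ℂ Γ (0, p) :=
    analyticAt_fst.fun_comp (AnalyticAt.fun_comp (f := fun z : ℂ × E => ((0, z) : C(I, E) × (ℂ × E))) hΛ hι)
  have hΓ0 : Γ (0, p) = cst p := by simp [Γ, hΛ0, a]
  have hΓeq : ∀ᶠ z in 𝓝 ((0, p) : ℂ × E),
      Γ z = cst z.2 + z.1 • curvePrimitive E (N (Γ z)) := by
    filter_upwards [hι.continuousAt.eventually hΛr] with z hz
    have h1 : (Λ (0, z)).2 = z := congrArg Prod.snd hz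
    have h2 : Γ z - cst (Λ (0, z)).2.2 - (Λ (0, z)).2.1 • curvePrimitive E (N (Γ z)) = 0 :=
      congrArg Prod.fst hz
    rw [h1, sub_sub, sub_eq_zero] at h2
    exact h2
  have hNX' : ∀ᶠ q in 𝓝 a, ∀ t, N q.1 t = X (q.1 t) := (continuous_fst.tendsto a).eventually hNX
  obtain ⟨ε, hε, hεG⟩ := Metric.eventually_nhds_iff_ball.1 (hΛl.and hNX')
  have hΓnear : ∀ᶠ z in 𝓝 ((0, p) : ℂ × E), Γ z ∈ Metric.ball (cst p) ε := by
    refine hΓ.continuousAt.eventually ?_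
    rw [hΓ0]
    exact Metric.ball_mem_nhds _ hε
  obtain ⟨δ, hδ, hδΓ⟩ := Metric.eventually_nhds_iff_ball.1
    (hΓeq.and (hΓnear.and hΓ.eventually_analyticAt))
  -- Local uniqueness: the rescaled curve solves the equation for time `τ z` and stays close to the
  -- constant `p`, so the local left inverse of `G` identifies it with `Γ`.
  have key : ∀ z ∈ Metric.ball ((0, p) : ℂ × E) (min δ ε), ∀ τ : I,
      Γ (τ * z.1, z.2) = rescaleCurve τ (Γ z) := by
    intro z hz τ
    obtain ⟨h1, h2, -⟩ := hδΓ z (Metric.ball_subset_ball (min_le_left _ _) hz)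
    have hz' : z ∈ Metric.ball ((0, p) : ℂ × E) ε := Metric.ball_subset_ball (min_le_right _ _) hz
    have hN1 := (hεG (Γ z, (0, p)) (by simpa [a, Prod.dist_eq] using h2)).2
    have hr : rescaleCurve τ (Γ z) ∈ Metric.ball (cst p) ε := by
      rw [Metric.mem_ball, ContinuousMap.dist_lt_iff hε]
      intro t
      exact (ContinuousMap.dist_apply_le_dist (f := Γ z) (g := cst p) (τ * t)).trans_lt h2
    have hq : ((rescaleCurve τ (Γ z), (τ * z.1, z.2)) : C(I, E) × (ℂ × E)) ∈ Metric.ball a ε := by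
      simp only [Metric.mem_ball, Prod.dist_eq, a, max_lt_iff] at hz' ⊢
      refine ⟨hr, lt_of_le_of_lt ?_ hz'.1, hz'.2⟩
      rw [dist_zero_right, dist_zero_right, norm_mul, Complex.norm_real, Real.norm_of_nonneg τ.2.1]
      exact mul_le_of_le_one_left (norm_nonneg _) τ.2.2
    have hq2 := hεG _ hq
    have hGq : G (rescaleCurve τ (Γ z), (τ * z.1, z.2)) = (0, (τ * z.1, z.2)) := by
      refine Prod.ext ?_ rfl
      change rescaleCurve τ (Γ z) - cst z.2 - ((τ : ℂ) * z.1) •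
        curvePrimitive E (N (rescaleCurve τ (Γ z))) = 0
      have hNr : N (rescaleCurve τ (Γ z)) = rescaleCurve τ (N (Γ z)) := by
        ext t
        rw [hq2.2 t]
        exact (hN1 (τ * t)).symm
      rw [hNr, sub_sub, sub_eq_zero]
      ext t
      have h3 := DFunLike.congr_fun h1 (τ * t)
      change Γ z (τ * t) = z.2 + z.1 • curvePrimitive E (N (Γ z)) (τ * t) at h3
      change Γ z (τ * t) = z.2 + ((τ : ℂ) * z.1) • curvePrimitive E (rescaleCurve τ (N (Γ z))) t
      rw [h3, ← curvePrimitive_rescale, smul_smul, mul_comm z.1]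
    have h4 := hq2.1
    rw [hGq] at h4
    exact congrArg Prod.fst h4
  let Φ : ℂ × E → E := fun z => Γ z 1
  have hev : ∀ (z : ℂ × E), AnalyticAt ℂ Γ z → AnalyticAt ℂ Φ z := fun z hz =>
    ((ContinuousMap.evalCLM ℂ (1 : I)).analyticAt _).fun_comp hz
  -- `Φ` is holomorphic in the time, so its derivative can be read off along the real segment `v ↦ v
  -- z`, where `key` gives `Φ` as an integral. Dividing by the speed of the segment requires `z.1 ≠
  -- 0`.
  have hder : ∀ z ∈ Metric.ball ((0, p) : ℂ × E) (min δ ε), z.1 ≠ 0 → ∀ τ : I,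
      HasDerivAt (fun t => Φ (t, z.2)) (X (Φ (τ * z.1, z.2))) (τ * z.1) := by
    intro z hz hz0 τ
    obtain ⟨h1, h2, -⟩ := hδΓ z (Metric.ball_subset_ball (min_le_left _ _) hz)
    have hN1 := (hεG (Γ z, (0, p)) (by simpa [a, Prod.dist_eq] using h2)).2
    have hw : ((τ * z.1, z.2) : ℂ × E) ∈ Metric.ball ((0, p) : ℂ × E) δ := by
      have hz' : z ∈ Metric.ball ((0, p) : ℂ × E) δ := Metric.ball_subset_ball (min_le_left _ _) hz
      simp only [Metric.mem_ball, Prod.dist_eq, max_lt_iff] at hz' ⊢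
      refine ⟨lt_of_le_of_lt ?_ hz'.1, hz'.2⟩
      rw [dist_zero_right, dist_zero_right, norm_mul, Complex.norm_real, Real.norm_of_nonneg τ.2.1]
      exact mul_le_of_le_one_left (norm_nonneg _) τ.2.2
    have hΦa : AnalyticAt ℂ Φ (τ * z.1, z.2) := hev _ (hδΓ _ hw).2.2
    have hΦd : HasDerivAt (fun t => Φ (t, z.2)) (deriv (fun t => Φ (t, z.2)) (τ * z.1)) (τ * z.1) := by
      refine DifferentiableAt.hasDerivAt ?_
      exact hΦa.differentiableAt.comp (τ * z.1 : ℂ) (by fun_prop : DifferentiableAt ℂ (fun t : ℂ => (t, z.2)) (τ * z.1))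
    have hcurve : ∀ v ∈ I, Φ ((v : ℝ) * z.1, z.2) =
        z.2 + z.1 • ∫ r in (0 : ℝ)..v, N (Γ z) (Set.projIcc (0 : ℝ) 1 zero_le_one r) := by
      intro v hv
      have h5 := DFunLike.congr_fun (key z hz ⟨v, hv⟩) 1
      have h6 := DFunLike.congr_fun h1 ⟨v, hv⟩
      change Φ ((v : ℝ) * z.1, z.2) = Γ z (⟨v, hv⟩ * 1) at h5
      rw [h5, mul_one, h6]
      rfl
    have hd1 : HasDerivWithinAt (fun v : ℝ => Φ ((v : ℝ) * z.1, z.2))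
        (z.1 • deriv (fun t => Φ (t, z.2)) (τ * z.1)) I τ := by
      have hm : HasDerivAt (fun v : ℝ => (v : ℂ) * z.1) z.1 (τ : ℝ) := by
        simpa using (Complex.ofRealCLM.hasDerivAt (x := (τ : ℝ))).mul_const z.1
      exact (HasDerivAt.scomp (τ : ℝ) hΦd hm).hasDerivWithinAt
    have hd2 : HasDerivWithinAt (fun v : ℝ => Φ ((v : ℝ) * z.1, z.2)) (z.1 • N (Γ z) τ) I τ := by
      refine HasDerivWithinAt.congr ?_ (fun v hv => hcurve v hv) (hcurve τ τ.2)
      exact ((hasDerivWithinAt_curvePrimitive (N (Γ z)) τ).const_smul z.1).const_add z.2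
    have hu := (uniqueDiffOn_Icc (zero_lt_one (α := ℝ)) τ τ.2).eq_deriv _ hd1 hd2
    have hu' := smul_right_injective E hz0 hu
    rw [hu', hN1 τ] at hΦd
    have h7 : Φ (τ * z.1, z.2) = Γ z τ := by
      have h5 := DFunLike.congr_fun (key z hz τ) 1
      change Φ (τ * z.1, z.2) = Γ z (τ * 1) at h5
      rw [h5, mul_one]
    rw [h7]
    exact hΦd
  refine ⟨Φ, hev _ hΓ, by simp [Φ, hΓ0, hcst], ?_⟩
  filter_upwards [Metric.ball_mem_nhds ((0, p) : ℂ × E) (lt_min hδ hε)] with z hz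
  constructor
  · have h1 := DFunLike.congr_fun (key z hz 0) 1
    change Γ ((0 : ℝ) * z.1, z.2) 1 = Γ z (0 * 1) at h1
    rw [Complex.ofReal_zero, zero_mul, zero_mul] at h1
    have h2 := DFunLike.congr_fun (hδΓ z (Metric.ball_subset_ball (min_le_left _ _) hz)).1 0
    change Γ z 0 = z.2 + z.1 • curvePrimitive E (N (Γ z)) 0 at h2
    change Γ (0, z.2) 1 = z.2
    rw [h1, h2, curvePrimitive_apply]
    simp
  · by_cases hz0 : z.1 = 0
    · have hz' := hz
      simp only [Metric.mem_ball, Prod.dist_eq, max_lt_iff] at hz'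
      -- Time `0` is reached as the initial point `τ = 0` of a segment of nonzero length `η`.
      obtain ⟨η, hη, hη'⟩ := exists_between (lt_min hδ hε)
      have hη2 : ((η : ℂ), z.2) ∈ Metric.ball ((0, p) : ℂ × E) (min δ ε) := by
        simp only [Metric.mem_ball, Prod.dist_eq, max_lt_iff]
        refine ⟨?_, hz'.2⟩
        rw [dist_zero_right, Complex.norm_real, Real.norm_of_nonneg hη.le]
        exact hη'
      have h := hder _ hη2 (Complex.ofReal_ne_zero.2 hη.ne') 0
      have h8 : (((0 : I) : ℝ) : ℂ) * (η : ℂ) = z.1 := by rw [hz0]; simp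
      rw [h8] at h
      exact h
    · have h := hder z hz hz0 1
      have h8 : (((1 : I) : ℝ) : ℂ) * z.1 = z.1 := by simp
      rw [h8] at h
      exact h

end Flow

end

end OuterPoisson


/-! ### The holomorphic Cauchy problem for a transversal vector field. -/

namespace OuterPoisson

noncomputable section

section Cauchy

variable {E : Type*} [NormedAddCommGroup E] [NormedSpace ℂ E] [CompleteSpace E]

/-- Straightening of an analytic vector field `X` transversal to the hyperplane `ℓ = ℓ p`, together
with a primitive `W` of `g` along `X`. -/
theorem exists_straightening {X : E → E} {g : E → ℂ} {p : E} (hX : AnalyticAt ℂ X p)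
    (hg : AnalyticAt ℂ g p) (l : E →L[ℂ] ℂ) (hl : l (X p) = 1) :
    ∃ (Ψ Λ : E → E) (W : E → ℂ), AnalyticAt ℂ Ψ p ∧ AnalyticAt ℂ Λ p ∧ AnalyticAt ℂ W p ∧
      Ψ p = p ∧ Λ p = p ∧ (∀ᶠ q in 𝓝 p, Λ (Ψ q) = q) ∧ (∀ᶠ q in 𝓝 p, Ψ (Λ q) = q) ∧
      (∀ᶠ q in 𝓝 p, HasDerivAt (fun t : ℂ => Ψ (q + t • X p)) (X (Ψ q)) 0 ∧
        HasDerivAt (fun t : ℂ => W (q + t • X p)) (g (Ψ q)) 0) ∧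
      ∀ᶠ q in 𝓝 p, l q = l p → Ψ q = q ∧ W q = 0 := by
  -- In the flow of `(X, g)` on `E × ℂ` the last component accumulates the integral of `g` along the
  -- trajectories of `X`, so one flow yields both `Ψ` and `W`.
  have hXg : AnalyticAt ℂ (fun q : E × ℂ => (X q.1, g q.1)) (p, 0) :=
    AnalyticAt.prod (AnalyticAt.fun_comp (f := fun q : E × ℂ => q.1) (x := (p, 0)) hX analyticAt_fst)
      (AnalyticAt.fun_comp (f := fun q : E × ℂ => q.1) (x := (p, 0)) hg analyticAt_fst)
  obtain ⟨Φ, hΦ, hΦ0, hev⟩ := exists_analytic_flow hXg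
  -- The flow time of `q`, its projection along `X p` to the hyperplane through `p`, and the initial
  -- value `0` of the primitive.
  let j : E → ℂ × (E × ℂ) := fun q => (l q - l p, (q - (l q - l p) • X p, 0))
  have hj0 : j p = (0, (p, 0)) := by simp [j]
  have hj : AnalyticAt ℂ j p := by
    have h1 : AnalyticAt ℂ (fun q => l q - l p) p := (l.analyticAt p).sub analyticAt_const
    exact h1.prod ((analyticAt_id.sub (h1.smul analyticAt_const)).prod analyticAt_const)
  have hΦ' : AnalyticAt ℂ Φ (j p) := by rwa [hj0]
  have hR : AnalyticAt ℂ (fun q => Φ (j q)) p := AnalyticAt.fun_comp hΦ' hj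
  have hΨ : AnalyticAt ℂ (fun q => (Φ (j q)).1) p := analyticAt_fst.fun_comp hR
  have hW : AnalyticAt ℂ (fun q => (Φ (j q)).2) p := analyticAt_snd.fun_comp hR
  have hevj : ∀ᶠ q in 𝓝 p, Φ (0, (j q).2) = (j q).2 ∧
      HasDerivAt (fun t => Φ (t, (j q).2)) (X (Φ (j q)).1, g (Φ (j q)).1) (j q).1 := by
    have tj : Filter.Tendsto j (𝓝 p) (𝓝 (0, (p, 0))) := by
      simpa only [hj0] using hj.continuousAt.tendsto
    exact tj.eventually hev
  have hder : ∀ᶠ q in 𝓝 p, HasDerivAt (fun t : ℂ => Φ (j (q + t • X p)))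
      (X (Φ (j q)).1, g (Φ (j q)).1) 0 := by
    filter_upwards [hevj] with q hq
    have e : (fun t : ℂ => Φ (j (q + t • X p))) = fun t : ℂ => Φ ((j q).1 + t, (j q).2) := by
      funext t
      congr 1
      simp only [j, map_add, map_smul, hl, smul_eq_mul, mul_one]
      refine Prod.ext ?_ (Prod.ext ?_ rfl)
      · simp only; ring
      · simp only; module
    rw [e]
    have h2 : HasDerivAt (fun t => Φ (t, (j q).2)) (X (Φ (j q)).1, g (Φ (j q)).1) ((j q).1 + 0) := by
      rw [add_zero]; exact hq.2
    exact h2.comp_const_add ((j q).1) 0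
  have hslice : ∀ᶠ q in 𝓝 p, l q = l p → Φ (j q) = (q, 0) := by
    filter_upwards [hevj] with q hq hlq
    have h0 : j q = (0, (q, 0)) := by simp [j, hlq]
    have := hq.1
    rw [h0] at this
    rw [h0]; exact this
  have hΨp : (Φ (j p)).1 = p := by rw [hj0, hΦ0]
  -- The derivative of `Ψ` at `p` fixes `X p` by the flow equation, and fixes `ker l` because `Ψ` is
  -- the identity on the hyperplane. These span `E`, so `Ψ` is locally invertible.
  have hid : HasFDerivAt (fun q => (Φ (j q)).1)
      ((ContinuousLinearEquiv.refl ℂ E : E ≃L[ℂ] E) : E →L[ℂ] E) p := by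
    have hd := hΨ.differentiableAt.hasFDerivAt
    refine hd.congr_fderiv (ContinuousLinearMap.ext fun v => ?_)
    set A := fderiv ℂ (fun q => (Φ (j q)).1) p
    have hA1 : A (X p) = X p := by
      have h1 : HasDerivAt (fun t : ℂ => p + t • X p) (X p) 0 := by
        simpa using ((hasDerivAt_id (0 : ℂ)).smul_const (X p)).const_add p
      have hd' : HasFDerivAt (fun q => (Φ (j q)).1) A (p + (0 : ℂ) • X p) := by
        rw [zero_smul, add_zero]; exact hd
      have h2 := hd'.comp_hasDerivAt (0 : ℂ) h1
      have h3 := (ContinuousLinearMap.fst ℂ E ℂ).hasFDerivAt.comp_hasDerivAt (0 : ℂ) hder.self_of_nhds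
      have h4 := h2.unique h3
      rw [h4]
      simp [hΨp]
    have hA2 : ∀ w, l w = 0 → A w = w := by
      intro w hw
      have h1 : HasDerivAt (fun t : ℂ => p + t • w) w 0 := by
        simpa using ((hasDerivAt_id (0 : ℂ)).smul_const w).const_add p
      have hd' : HasFDerivAt (fun q => (Φ (j q)).1) A (p + (0 : ℂ) • w) := by
        rw [zero_smul, add_zero]; exact hd
      have h2 := hd'.comp_hasDerivAt (0 : ℂ) h1
      refine (h2.congr_of_eventuallyEq ?_).unique h1 |>.symm ▸ rfl
      have hc : Filter.Tendsto (fun t : ℂ => p + t • w) (𝓝 0) (𝓝 p) := by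
        have := h1.continuousAt.tendsto
        rwa [zero_smul, add_zero] at this
      filter_upwards [hc.eventually hslice] with t ht
      have : l (p + t • w) = l p := by simp [hw]
      simp [ht this]
    have hv : v = (v - l v • X p) + l v • X p := by abel
    have h5 : A (v - l v • X p) = v - l v • X p := hA2 _ (by simp [hl])
    change A v = v
    conv_lhs => rw [hv, map_add, map_smul, hA1, h5]
    exact hv.symm
  have hω : (ω : WithTop ℕ∞) ≠ 0 := by simp
  have hΨc : ContDiffAt ℂ ω (fun q => (Φ (j q)).1) p := hΨ.contDiffAt
  let S := hΨc.hasStrictFDerivAt' hid hω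
  have hΛ := (hΨc.to_localInverse hid hω).analyticAt
  rw [hΨp] at hΛ
  refine ⟨fun q => (Φ (j q)).1, S.localInverse _ _ p, fun q => (Φ (j q)).2, hΨ, hΛ, hW, hΨp, ?_,
    S.eventually_left_inverse, ?_, ?_, ?_⟩
  · have := S.localInverse_apply_image
    rwa [hΨp] at this
  · have := S.eventually_right_inverse
    rwa [hΨp] at this
  · filter_upwards [hder] with q hq
    exact ⟨(ContinuousLinearMap.fst ℂ E ℂ).hasFDerivAt.comp_hasDerivAt (0 : ℂ) hq,
      (ContinuousLinearMap.snd ℂ E ℂ).hasFDerivAt.comp_hasDerivAt (0 : ℂ) hq⟩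
  · filter_upwards [hslice] with q hq h
    simp [hq h]

/-- Existence for the holomorphic Cauchy problem `X u = g`, `u = 0` on the hyperplane `l = l p`. -/
theorem exists_solution_cauchy {X : E → E} {g : E → ℂ} {p : E} (hX : AnalyticAt ℂ X p)
    (hg : AnalyticAt ℂ g p) (l : E →L[ℂ] ℂ) (hl : l (X p) = 1) :
    ∃ u : E → ℂ, AnalyticAt ℂ u p ∧ (∀ᶠ q in 𝓝 p, fderiv ℂ u q (X q) = g q) ∧
      ∀ᶠ q in 𝓝 p, l q = l p → u q = 0 := by
  obtain ⟨Ψ, Λ, W, hΨ, hΛ, hW, hΨp, hΛp, hl1, hr1, hd, hs⟩ := exists_straightening hX hg l hl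
  have hW' : AnalyticAt ℂ W (Λ p) := by rwa [hΛp]
  have hu : AnalyticAt ℂ (fun q => W (Λ q)) p := AnalyticAt.fun_comp hW' hΛ
  have tΛ : Filter.Tendsto Λ (𝓝 p) (𝓝 p) := by simpa only [hΛp] using hΛ.continuousAt.tendsto
  have tΨ : Filter.Tendsto Ψ (𝓝 p) (𝓝 p) := by simpa only [hΨp] using hΨ.continuousAt.tendsto
  refine ⟨fun q => W (Λ q), hu, ?_, ?_⟩
  · have key : ∀ᶠ q in 𝓝 p, fderiv ℂ (fun q => W (Λ q)) (Ψ q) (X (Ψ q)) = g (Ψ q) := by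
      filter_upwards [hd, hl1.eventually_nhds, tΨ.eventually hu.eventually_analyticAt] with q h1 h2 h3
      have hc : Filter.Tendsto (fun t : ℂ => q + t • X p) (𝓝 0) (𝓝 q) := by
        have : Continuous fun t : ℂ => q + t • X p := by fun_prop
        simpa using this.tendsto 0
      have h4 : HasFDerivAt (fun q => W (Λ q)) (fderiv ℂ (fun q => W (Λ q)) (Ψ q))
          (Ψ (q + (0 : ℂ) • X p)) := by
        rw [zero_smul, add_zero]; exact h3.differentiableAt.hasFDerivAt
      have h5 := h4.comp_hasDerivAt (0 : ℂ) h1.1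
      refine (h5.congr_of_eventuallyEq ?_).unique h1.2
      filter_upwards [hc.eventually h2] with t ht
      simp [ht]
    filter_upwards [tΛ.eventually key, hr1] with q h1 h2
    rwa [h2] at h1
  · filter_upwards [hs, hl1] with q h1 h2 h3
    obtain ⟨h4, h5⟩ := h1 h3
    rw [h4] at h2
    simp only [h2, h5]

/-- Uniqueness for the holomorphic Cauchy problem. -/
theorem eventually_eq_zero_of_cauchy {X : E → E} {u : E → ℂ} {p : E} (hX : AnalyticAt ℂ X p)
    (hu : AnalyticAt ℂ u p) (l : E →L[ℂ] ℂ) (hl : l (X p) = 1)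
    (h : ∀ᶠ q in 𝓝 p, fderiv ℂ u q (X q) = 0) (h0 : ∀ᶠ q in 𝓝 p, l q = l p → u q = 0) :
    ∀ᶠ q in 𝓝 p, u q = 0 := by
  obtain ⟨Ψ, Λ, W, hΨ, hΛ, -, hΨp, hΛp, hl1, hr1, hd, hs⟩ :=
    exists_straightening hX (analyticAt_const (v := (0 : ℂ))) l hl
  have tΛ : Filter.Tendsto Λ (𝓝 p) (𝓝 p) := by simpa only [hΛp] using hΛ.continuousAt.tendsto
  have tΨ : Filter.Tendsto Ψ (𝓝 p) (𝓝 p) := by simpa only [hΨp] using hΨ.continuousAt.tendsto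
  have hder : ∀ᶠ q in 𝓝 p, HasDerivAt (fun t : ℂ => u (Ψ (q + t • X p))) 0 0 := by
    filter_upwards [hd, tΨ.eventually h, tΨ.eventually hu.eventually_analyticAt] with q h1 h2 h3
    have h4 : HasFDerivAt u (fderiv ℂ u (Ψ q)) (Ψ (q + (0 : ℂ) • X p)) := by
      rw [zero_smul, add_zero]; exact h3.differentiableAt.hasFDerivAt
    have h5 := h4.comp_hasDerivAt (0 : ℂ) h1.1
    rwa [h2] at h5
  obtain ⟨δ, hδ, hb⟩ := Metric.eventually_nhds_iff_ball.1 (hder.and (hs.and h0))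
  -- In straightened coordinates `u ∘ Ψ` has zero derivative along `X p`, hence is constant on the
  -- segment from `q` to its projection `r q` to the hyperplane, where it vanishes. Convexity keeps
  -- the segment in the ball.
  let r : E → E := fun q => q - (l q - l p) • X p
  have tr : Filter.Tendsto r (𝓝 p) (𝓝 p) := by
    have : Continuous r := by fun_prop
    simpa [r] using this.tendsto p
  have hz : ∀ᶠ q in 𝓝 p, u (Ψ q) = 0 := by
    filter_upwards [Metric.ball_mem_nhds p hδ, tr (Metric.ball_mem_nhds p hδ)] with q hq1 hq2
    have hlr : l (r q) = l p := by simp [r, hl]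
    let c : ℂ := l q - l p
    have hseg : ∀ s ∈ Set.Icc (0 : ℝ) 1, r q + ((s : ℂ) * c) • X p ∈ Metric.ball p δ := by
      intro s hs
      have := (convex_ball p δ) hq2 hq1 (sub_nonneg.2 hs.2) hs.1 (by ring)
      convert this using 1
      simp only [r, c]
      rw [← Complex.coe_smul, ← Complex.coe_smul]
      push_cast
      module
    have hcd : ∀ s ∈ Set.Icc (0 : ℝ) 1,
        HasDerivWithinAt (fun s : ℝ => u (Ψ (r q + ((s : ℂ) * c) • X p))) 0 (Set.Icc 0 1) s := by
      intro s hs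
      have h1 := (hb _ (hseg s hs)).1
      have h2 : HasDerivAt (fun v : ℝ => ((v : ℂ) - s) * c) c s := by
        simpa using ((Complex.ofRealCLM.hasDerivAt (x := s)).sub_const (s : ℂ)).mul_const c
      have h1' : HasDerivAt (fun t : ℂ => u (Ψ (r q + ((s : ℂ) * c) • X p + t • X p))) 0
          (((s : ℂ) - s) * c) := by rw [sub_self, zero_mul]; exact h1
      have h3 := HasDerivAt.scomp s h1' h2
      rw [smul_zero] at h3
      refine (h3.congr_of_eventuallyEq (Filter.Eventually.of_forall fun v => ?_)).hasDerivWithinAt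
      simp only [Function.comp]
      congr 2
      module
    have hconst := (convex_Icc (0 : ℝ) 1).is_const_of_fderivWithin_eq_zero (𝕜 := ℝ)
      (f := fun s : ℝ => u (Ψ (r q + ((s : ℂ) * c) • X p)))
      (fun s hs => (hcd s hs).differentiableWithinAt)
      (fun s hs => by
        have := (hcd s hs).hasFDerivWithinAt.fderivWithin (uniqueDiffOn_Icc zero_lt_one s hs)
        rw [this]; ext; simp)
      (Set.left_mem_Icc.2 zero_le_one) (Set.right_mem_Icc.2 zero_le_one)
    have e1 : r q + ((1 : ℝ) * c : ℂ) • X p = q := by simp [r, c]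
    have e0 : r q + ((0 : ℝ) * c : ℂ) • X p = r q := by simp
    simp only [e1, e0] at hconst
    rw [← hconst, ((hb _ hq2).2.1 hlr).1]
    exact (hb _ hq2).2.2 hlr
  filter_upwards [tΛ.eventually hz, hr1] with q h1 h2
  rwa [h2] at h1

end Cauchy

end

end OuterPoisson


/-! ### Algebra of divergences on a ring with coordinate derivations. -/

namespace OuterPoisson

section Algebra

variable {ι R : Type*} [Fintype ι] [DecidableEq ι] [CommRing R]

theorem derivation_prod (X : Derivation ℤ R R) (s : Finset ι) (f : ι → R) :
    X (∏ i ∈ s, f i) = ∑ i ∈ s, X (f i) * ∏ j ∈ s.erase i, f j := by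
  induction s using Finset.induction_on with
  | empty => simp
  | insert a s ha ih =>
    rw [Finset.prod_insert ha, X.leibniz, ih, Finset.sum_insert ha, Finset.erase_insert ha,
      smul_eq_mul, smul_eq_mul, add_comm, Finset.mul_sum, mul_comm]
    congr 1
    refine Finset.sum_congr rfl fun i hi => ?_
    have hia : i ≠ a := fun h => ha (h ▸ hi)
    rw [Finset.erase_insert_of_ne hia.symm, Finset.prod_insert (by simp [ha])]
    ring

/-- Jacobi's formula for the derivative of a determinant. -/
theorem derivation_det (X : Derivation ℤ R R) (A : Matrix ι ι R) :
    X A.det = (A.adjugate * A.map X).trace := by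
  -- By Cramer's rule the diagonal entries are the determinants of `A` with one column
  -- differentiated; their sum is the Leibniz rule.
  have h1 : ∀ i, (A.adjugate * A.map X) i i = (A.updateCol i fun k => X (A k i)).det := by
    intro i
    rw [← Matrix.cramer_apply, Matrix.cramer_eq_adjugate_mulVec]
    rfl
  rw [Matrix.trace]
  simp only [Matrix.diag_apply, h1, Matrix.det_apply']
  rw [map_sum, Finset.sum_comm]
  refine Finset.sum_congr rfl fun p _ => ?_
  rw [X.leibniz, ← eq_intCast (algebraMap ℤ R), X.map_algebraMap, smul_zero, add_zero, derivation_prod, smul_eq_mul,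
    Finset.mul_sum]
  refine Finset.sum_congr rfl fun i _ => ?_
  congr 1
  rw [← Finset.mul_prod_erase Finset.univ _ (Finset.mem_univ i), Matrix.updateCol_self]
  congr 1
  refine Finset.prod_congr rfl fun j hj => ?_
  rw [Matrix.updateCol_ne (Finset.ne_of_mem_erase hj)]

theorem sum_skew_mul_symm {κ : Type*} [Fintype κ] (h2 : ∀ a : R, a + a = 0 → a = 0)
    {a s : κ → κ → R} (ha : ∀ j k, a j k = -a k j) (hs : ∀ j k, s j k = s k j) :
    ∑ j, ∑ k, a j k * s j k = 0 := by
  refine h2 _ ?_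
  conv_lhs => enter [1]; rw [Finset.sum_comm]
  rw [← Finset.sum_add_distrib]
  refine Finset.sum_eq_zero fun j _ => ?_
  rw [← Finset.sum_add_distrib]
  refine Finset.sum_eq_zero fun k _ => ?_
  rw [ha j k, hs j k]
  ring

variable (ι R) in
/-- Coordinates `z` and commuting coordinate derivations `d` on a ring of functions. -/
structure CoordSystem where
  z : ι → R
  d : ι → Derivation ℤ R R
  d_z : ∀ i j, d i (z j) = if i = j then 1 else 0
  d_comm : ∀ i j f, d i (d j f) = d j (d i f)

namespace CoordSystem

variable (C C' : CoordSystem ι R)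

/-- `X` is a combination of the coordinate derivations. -/
def IsField (X : Derivation ℤ R R) : Prop := ∀ f, X f = ∑ i, X (C.z i) * C.d i f

/-- The divergence of `X` for the volume form `h dz_1 ∧ ⋯ ∧ dz_n`. -/
def div (h : Rˣ) (X : Derivation ℤ R R) : R := ∑ j, C.d j (X (C.z j)) + ↑h⁻¹ * X h

variable {C C'}

/-- The commutator of `∂_i` with `X = ∑ X^k ∂_k` only differentiates the coefficients, since the
`∂_k` commute. -/
theorem d_apply_field {X : Derivation ℤ R R} (hX : C.IsField X) (i : ι) (f : R) :
    C.d i (X f) = X (C.d i f) + ∑ k, C.d i (X (C.z k)) * C.d k f := by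
  rw [hX f, hX (C.d i f), map_sum, ← Finset.sum_add_distrib]
  refine Finset.sum_congr rfl fun k _ => ?_
  rw [Derivation.leibniz, smul_eq_mul, smul_eq_mul, C.d_comm i k]
  ring

theorem div_add (h : Rˣ) (X Y : Derivation ℤ R R) : C.div h (X + Y) = C.div h X + C.div h Y := by
  simp only [div, Derivation.add_apply, map_add, Finset.sum_add_distrib]
  ring

theorem div_smul {X : Derivation ℤ R R} (hX : C.IsField X) (h : Rˣ) (a : R) :
    C.div h (a • X) = a * C.div h X + X a := by
  simp only [div, Derivation.smul_apply, smul_eq_mul, Derivation.leibniz, Finset.sum_add_distrib]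
  rw [hX a, mul_add, Finset.mul_sum]
  ring

theorem div_sum {κ : Type*} (s : Finset κ) (h : Rˣ) (X : κ → Derivation ℤ R R) :
    C.div h (∑ k ∈ s, X k) = ∑ k ∈ s, C.div h (X k) := by
  classical
  induction s using Finset.induction_on with
  | empty => simp [div]
  | insert a s ha ih => rw [Finset.sum_insert ha, Finset.sum_insert ha, div_add, ih]

theorem map_unit_inv (X : Derivation ℤ R R) (h : Rˣ) :
    X (↑h⁻¹ : R) = -(↑h⁻¹ * ↑h⁻¹ * X h) := by
  have h1 : X ((h : R) * ↑h⁻¹) = 0 := by rw [Units.mul_inv]; exact X.map_one_eq_zero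
  rw [X.leibniz, smul_eq_mul, smul_eq_mul] at h1
  have h2 : (↑h⁻¹ : R) * h = 1 := h.inv_mul
  linear_combination (↑h⁻¹ : R) * h1 - X (↑h⁻¹ : R) * h2

/-- The terms `∂_j X^k ∂_k Y^j` are symmetric in `X` and `Y` after summation and cancel, as do the
products of logarithmic derivatives of `h`. This identity is what makes the modular field Poisson.
-/
theorem div_lie {X Y : Derivation ℤ R R} (hX : C.IsField X) (hY : C.IsField Y) (h : Rˣ) :
    C.div h ⁅X, Y⁆ = X (C.div h Y) - Y (C.div h X) := by
  have e1 : ∀ {X Y : Derivation ℤ R R}, C.IsField X → X (∑ j, C.d j (Y (C.z j))) =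
      ∑ j, C.d j (X (Y (C.z j))) - ∑ j, ∑ k, C.d j (X (C.z k)) * C.d k (Y (C.z j)) := by
    intro X Y hX
    rw [map_sum, ← Finset.sum_sub_distrib]
    refine Finset.sum_congr rfl fun j _ => ?_
    rw [d_apply_field hX]
    ring
  have e2 : ∑ j, ∑ k, C.d j (X (C.z k)) * C.d k (Y (C.z j)) =
      ∑ j, ∑ k, C.d j (Y (C.z k)) * C.d k (X (C.z j)) := by
    rw [Finset.sum_comm]
    exact Finset.sum_congr rfl fun j _ => Finset.sum_congr rfl fun k _ => mul_comm _ _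
  simp only [div, map_add, e1 hX, e1 hY, e2, Derivation.leibniz, smul_eq_mul, map_unit_inv,
    Derivation.commutator_apply, map_sub, Finset.sum_sub_distrib]
  ring

/-- The chain rule for the two Jacobian matrices. -/
theorem IsField.matrix_inv (hC : ∀ i, C.IsField (C'.d i)) :
    (Matrix.of fun i j => C'.d i (C.z j)) * (Matrix.of fun i j => C.d i (C'.z j)) = 1 := by
  ext i k
  rw [Matrix.mul_apply, Matrix.one_apply]
  simp only [Matrix.of_apply]
  rw [← hC i (C'.z k), C'.d_z]

/-- The divergence does not depend on the coordinates. -/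
theorem div_eq_div (hC : ∀ i, C.IsField (C'.d i)) {X : Derivation ℤ R R} (hX : C.IsField X)
    {h h' : Rˣ} (hh : (h : R) = (Matrix.of fun i j => C.d i (C'.z j)).det * h') :
    C.div h X = C'.div h' X := by
  set A : Matrix ι ι R := Matrix.of fun i j => C.d i (C'.z j) with hA
  set A' : Matrix ι ι R := Matrix.of fun i j => C'.d i (C.z j) with hA'
  have hAA : A' * A = 1 := IsField.matrix_inv hC
  have hAA' : A * A' = 1 := mul_eq_one_comm.1 hAA
  set B : Matrix ι ι R := Matrix.of fun i j => C.d i (X (C.z j)) with hB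
  set N : Matrix ι ι R := Matrix.of fun i j => C.d i (X (C'.z j)) with hN
  have e1 : A.map X = N - B * A := by
    ext i j
    simp only [Matrix.map_apply, Matrix.sub_apply, Matrix.mul_apply, hA, hB, hN, Matrix.of_apply]
    rw [d_apply_field hX]
    ring
  -- By Jacobi's formula the logarithmic derivative of the Jacobian determinant is `tr (A' (N - B
  -- A)) = tr (A' N) - tr B`. It compensates the change from `h` to `h'`.
  have e2 : A'.det * X A.det = ∑ j, C'.d j (X (C'.z j)) - ∑ j, C.d j (X (C.z j)) := by
    have h3 : A'.det • A.adjugate = A' := by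
      have h4 : A' * (A * A.adjugate) = A' * (A.det • 1) := by rw [Matrix.mul_adjugate]
      rw [← Matrix.mul_assoc, hAA, Matrix.one_mul, Matrix.mul_smul, Matrix.mul_one] at h4
      rw [h4, smul_smul, ← Matrix.det_mul, hAA, Matrix.det_one, one_smul]
    rw [derivation_det, ← smul_eq_mul, ← Matrix.trace_smul, ← Matrix.smul_mul, h3, e1,
      Matrix.mul_sub, Matrix.trace_sub, ← Matrix.mul_assoc, Matrix.trace_mul_comm (A' * B),
      ← Matrix.mul_assoc, hAA', Matrix.one_mul]
    congr 1
    rw [Matrix.trace]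
    refine Finset.sum_congr rfl fun i _ => ?_
    rw [Matrix.diag_apply, Matrix.mul_apply, hC i]
    rfl
  have hd : A'.det * A.det = 1 := by rw [← Matrix.det_mul, hAA, Matrix.det_one]
  have e3 : (↑h⁻¹ : R) * X h = A'.det * X A.det + ↑h'⁻¹ * X h' := by
    rw [Units.inv_mul_eq_iff_eq_mul, hh, Derivation.leibniz, smul_eq_mul, smul_eq_mul]
    linear_combination -(h' : R) * X A.det * hd - A.det * X h' * h'.mul_inv
  rw [div, div, e3, e2]
  ring

end CoordSystem

end Algebra

end OuterPoisson


/-! ### Algebra of the modular derivation and of brackets of constant rank. -/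

namespace OuterPoisson

section Algebra

variable {ι κ R : Type*} [Fintype ι] [DecidableEq ι] [Fintype κ] [DecidableEq κ] [CommRing R]

/-- A Poisson bracket on a ring with coordinates, given by the hamiltonian derivations
`ham f = {f, ·}`. -/
structure CoordSystem.Poisson (C : CoordSystem ι R) where
  ham : R → Derivation ℤ R R
  skew : ∀ f g, ham f g = -ham g f
  isField : ∀ f, C.IsField (ham f)
  jacobi : ∀ f g h, ham f (ham g h) = ham (ham f g) h + ham g (ham f h)

namespace CoordSystem

variable {C : CoordSystem ι R}

theorem IsField.add {X Y : Derivation ℤ R R} (hX : C.IsField X) (hY : C.IsField Y) :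
    C.IsField (X + Y) := fun f => by
  simp only [Derivation.add_apply, add_mul, Finset.sum_add_distrib]
  rw [← hX f, ← hY f]

theorem IsField.smul {X : Derivation ℤ R R} (hX : C.IsField X) (a : R) : C.IsField (a • X) :=
  fun f => by
    simp only [Derivation.smul_apply, smul_eq_mul, mul_assoc]
    rw [← Finset.mul_sum, ← hX f]

theorem IsField.sum {α : Type*} {s : Finset α} {X : α → Derivation ℤ R R}
    (hX : ∀ i, C.IsField (X i)) : C.IsField (∑ i ∈ s, X i) := by
  classical
  induction s using Finset.induction_on with
  | empty => intro f; simp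
  | insert a s ha ih => rw [Finset.sum_insert ha]; exact (hX a).add ih

theorem derivation_sum_apply {α : Type*} (s : Finset α) (X : α → Derivation ℤ R R) (f : R) :
    (∑ i ∈ s, X i) f = ∑ i ∈ s, X i f := by
  classical
  induction s using Finset.induction_on with
  | empty => simp
  | insert a s ha ih => rw [Finset.sum_insert ha, Finset.sum_insert ha, Derivation.add_apply, ih]

namespace Poisson

variable (P : C.Poisson) (h : Rˣ)

/-- The modular derivation `f ↦ div (ham f)`. -/
def modular (f : R) : R := C.div h (P.ham f)

theorem ham_bracket (f g : R) : P.ham (P.ham f g) = ⁅P.ham f, P.ham g⁆ := by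
  ext k
  rw [Derivation.commutator_apply, P.jacobi f g k]
  ring

/-- The cocycle property of the divergence applied to `[X_f, X_g] = X_{f, g}`: the modular
derivation is a derivation of the bracket, that is, a Poisson field. -/
theorem modular_bracket (f g : R) :
    P.modular h (P.ham f g) = P.ham f (P.modular h g) - P.ham g (P.modular h f) := by
  rw [modular, ham_bracket, div_lie (P.isField f) (P.isField g)]
  rfl

theorem ham_eq_sum (f : R) : P.ham f = ∑ j, C.d j f • P.ham (C.z j) := by
  ext g
  rw [derivation_sum_apply, P.skew f g, P.isField g f, ← Finset.sum_neg_distrib]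
  refine Finset.sum_congr rfl fun j _ => ?_
  rw [Derivation.smul_apply, smul_eq_mul, P.skew (C.z j)]
  ring

variable (h2 : ∀ a : R, a + a = 0 → a = 0)
include h2

/-- The divergence of `∑ ∂_j f · X_{z_j}` seems to involve second derivatives of `f`, but these
enter as `∑ {z_j, z_k} ∂_k ∂_j f`, a skew array against a symmetric one. Hence `f ↦ div X_f` is a
first-order operator. The hypothesis `h2` excludes 2-torsion. -/
theorem modular_eq_sum (f : R) :
    P.modular h f = ∑ j, C.d j f * P.modular h (C.z j) := by
  have e : ∑ j, P.ham (C.z j) (C.d j f) = 0 := by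
    have e1 : ∀ j, P.ham (C.z j) (C.d j f) = ∑ k, P.ham (C.z j) (C.z k) * C.d k (C.d j f) :=
      fun j => P.isField _ _
    simp only [e1]
    exact sum_skew_mul_symm h2 (fun j k => P.skew _ _) fun j k => C.d_comm _ _ _
  rw [modular, ham_eq_sum, div_sum]
  simp only [div_smul (P.isField _)]
  rw [Finset.sum_add_distrib, e, add_zero]
  rfl

omit h2

/-- A bracket of constant rank: the hamiltonian derivations of the functions `w` have an invertible
matrix of brackets `A`, and generate all hamiltonian derivations. -/
structure RegularFrame where
  w : κ → R
  inv : Matrix κ κ R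
  inv_mul : inv * (Matrix.of fun a b => P.ham (w a) (w b)) = 1
  coeff : R → κ → R
  ham_eq : ∀ f, P.ham f = ∑ a, coeff f a • P.ham (w a)

namespace RegularFrame

variable {P} (F : P.RegularFrame (κ := κ))

/-- The matrix of brackets of a frame. -/
def mat : Matrix κ κ R := Matrix.of fun a b => P.ham (F.w a) (F.w b)

/-- The commuting frame dual to the functions `w`. -/
def Y (b : κ) : Derivation ℤ R R := ∑ a, F.inv b a • P.ham (F.w a)

theorem inv_mul_mat : F.inv * F.mat = 1 := F.inv_mul

theorem mat_mul_inv : F.mat * F.inv = 1 := mul_eq_one_comm.1 F.inv_mul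

theorem Y_apply (b : κ) (f : R) : F.Y b f = ∑ a, F.inv b a * P.ham (F.w a) f := by
  rw [Y, derivation_sum_apply]
  rfl

theorem Y_w (b c : κ) : F.Y b (F.w c) = if b = c then 1 else 0 := by
  rw [Y_apply, ← Matrix.one_apply, ← F.inv_mul, Matrix.mul_apply]
  rfl

theorem isField_Y (b : κ) : C.IsField (F.Y b) :=
  IsField.sum fun _ => (P.isField _).smul _

theorem ham_w_eq (a : κ) : P.ham (F.w a) = ∑ b, F.mat a b • F.Y b := by
  ext f
  simp only [derivation_sum_apply, Derivation.smul_apply, smul_eq_mul, Y_apply, Finset.mul_sum]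
  rw [Finset.sum_comm]
  have e : ∀ c, ∑ b, F.mat a b * (F.inv b c * P.ham (F.w c) f) =
      (if a = c then 1 else 0) * P.ham (F.w c) f := by
    intro c
    rw [← Matrix.one_apply, ← F.mat_mul_inv, Matrix.mul_apply, Finset.sum_mul]
    exact Finset.sum_congr rfl fun b _ => (mul_assoc _ _ _).symm
  simp only [e]
  simp

theorem transpose_mat : F.mat.transpose = -F.mat := by
  ext a b
  exact P.skew _ _

theorem transpose_inv : F.inv.transpose = -F.inv := by
  have e : F.inv.transpose * F.mat = -1 := by
    have h3 := congrArg Matrix.transpose F.mat_mul_inv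
    rw [Matrix.transpose_mul, Matrix.transpose_one, transpose_mat, Matrix.mul_neg] at h3
    rw [← h3, neg_neg]
  calc F.inv.transpose = F.inv.transpose * (F.mat * F.inv) := by rw [mat_mul_inv, Matrix.mul_one]
    _ = -F.inv := by rw [← Matrix.mul_assoc, e, Matrix.neg_mul, Matrix.one_mul]

/-- Evaluating `ham_eq` on the `w_c` gives a linear system for the coefficients whose matrix is
invertible. -/
theorem coeff_eq (f : R) (b : κ) : F.coeff f b = F.Y b f := by
  have e : ∀ c, P.ham f (F.w c) = ∑ a, F.coeff f a * F.mat a c := by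
    intro c
    conv_lhs => rw [F.ham_eq f, derivation_sum_apply]
    rfl
  have e2 : ∀ c, P.ham f (F.w c) * F.inv c b = F.inv b c * P.ham (F.w c) f := by
    intro c
    have h3 : F.inv c b = -F.inv b c := congrFun (congrFun F.transpose_inv b) c
    rw [h3, P.skew f]
    ring
  rw [Y_apply]
  simp only [← e2, e, Finset.sum_mul]
  rw [Finset.sum_comm]
  have e3 : ∀ a, ∑ c, F.coeff f a * F.mat a c * F.inv c b = F.coeff f a * if a = b then 1 else 0 := by
    intro a
    rw [← Matrix.one_apply, ← F.mat_mul_inv, Matrix.mul_apply, Finset.mul_sum]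
    exact Finset.sum_congr rfl fun c _ => mul_assoc _ _ _
  simp only [e3]
  simp

theorem ham_eq_sum_Y_smul (f : R) : P.ham f = ∑ a, F.Y a f • P.ham (F.w a) := by
  conv_lhs => rw [F.ham_eq f]
  simp only [coeff_eq]

/-- A field tangent to the leaves is determined by its values on the functions `w`, which serve as
coordinates along the leaves. -/
theorem apply_eq_of_mem_span {X : Derivation ℤ R R}
    (hX : X ∈ Submodule.span R (Set.range fun a => P.ham (F.w a))) (f : R) :
    X f = ∑ c, X (F.w c) * F.Y c f := by
  induction hX using Submodule.span_induction with
  | mem X hX =>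
    obtain ⟨a, rfl⟩ := hX
    change P.ham (F.w a) f = ∑ c, F.mat a c * F.Y c f
    conv_lhs => rw [F.ham_w_eq a, derivation_sum_apply]
    rfl
  | zero => simp
  | add X Y _ _ hX hY => simp only [Derivation.add_apply, add_mul, Finset.sum_add_distrib, ← hX, ← hY]
  | smul a X _ hX =>
    simp only [Derivation.smul_apply, smul_eq_mul, mul_assoc]
    rw [← Finset.mul_sum, ← hX]

theorem ham_mem_span (f : R) :
    P.ham f ∈ Submodule.span R (Set.range fun a => P.ham (F.w a)) := by
  rw [F.ham_eq f]
  exact Submodule.sum_mem _ fun a _ => Submodule.smul_mem _ _ (Submodule.subset_span ⟨a, rfl⟩)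

theorem ham_apply_eq (f g : R) : P.ham f g = ∑ c, P.ham f (F.w c) * F.Y c g :=
  F.apply_eq_of_mem_span (F.ham_mem_span f) g

theorem lie_smul_right (X Y : Derivation ℤ R R) (a : R) : ⁅X, a • Y⁆ = a • ⁅X, Y⁆ + X a • Y := by
  ext f
  simp only [Derivation.commutator_apply, Derivation.smul_apply, Derivation.add_apply,
    Derivation.leibniz, smul_eq_mul]
  ring

/-- The distribution tangent to the leaves is involutive, because hamiltonian derivations are closed
under commutators. -/
theorem lie_mem_span {X Z : Derivation ℤ R R}
    (hX : X ∈ Submodule.span R (Set.range fun a => P.ham (F.w a)))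
    (hZ : Z ∈ Submodule.span R (Set.range fun a => P.ham (F.w a))) :
    ⁅X, Z⁆ ∈ Submodule.span R (Set.range fun a => P.ham (F.w a)) := by
  induction hX using Submodule.span_induction with
  | mem X hX =>
    induction hZ using Submodule.span_induction with
    | mem Z hZ =>
      obtain ⟨a, rfl⟩ := hX
      obtain ⟨b, rfl⟩ := hZ
      simp only [← ham_bracket]
      exact F.ham_mem_span _
    | zero => rw [lie_zero]; exact Submodule.zero_mem _
    | add Z W _ _ hZ hW => rw [lie_add]; exact Submodule.add_mem _ hZ hW
    | smul a Z hZ' hZ =>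
      rw [lie_smul_right]
      exact Submodule.add_mem _ (Submodule.smul_mem _ _ hZ) (Submodule.smul_mem _ _ hZ')
  | zero => rw [zero_lie]; exact Submodule.zero_mem _
  | add X W _ _ hX hW => rw [add_lie]; exact Submodule.add_mem _ hX hW
  | smul a X hX' hX =>
    rw [← lie_skew, lie_smul_right, ← lie_skew, smul_neg]
    refine Submodule.neg_mem _ (Submodule.add_mem _ (Submodule.neg_mem _ ?_) ?_)
    · exact Submodule.smul_mem _ _ hX
    · exact Submodule.smul_mem _ _ hX'

theorem Y_mem_span (b : κ) : F.Y b ∈ Submodule.span R (Set.range fun a => P.ham (F.w a)) :=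
  Submodule.sum_mem _ fun a _ => Submodule.smul_mem _ _ (Submodule.subset_span ⟨a, rfl⟩)

/-- The commutator is tangent to the leaves and kills every `w_c`, since each `Y_b w_c` is a
constant; so it vanishes by `apply_eq_of_mem_span`. -/
theorem Y_comm (a b : κ) (f : R) : F.Y a (F.Y b f) = F.Y b (F.Y a f) := by
  have h3 := F.apply_eq_of_mem_span (F.lie_mem_span (F.Y_mem_span a) (F.Y_mem_span b)) f
  have h4 : ∀ c, ⁅F.Y a, F.Y b⁆ (F.w c) = 0 := by
    intro c
    rw [Derivation.commutator_apply, Y_w, Y_w]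
    split_ifs <;> simp
  simp only [h4, zero_mul, Finset.sum_const_zero, Derivation.commutator_apply] at h3
  exact sub_eq_zero.1 h3

-- The skew-symmetric cancellation of `modular_eq_sum`, with the commuting frame `Y` in place of the
-- coordinate derivations. It shows that the modular derivation is tangent to the leaves.
include h2 in
theorem modular_eq_sum_Y (f : R) :
    P.modular h f = ∑ a, F.Y a f * P.modular h (F.w a) := by
  have e : ∑ a, P.ham (F.w a) (F.Y a f) = 0 := by
    have e1 : ∀ a, P.ham (F.w a) (F.Y a f) = ∑ b, F.mat a b * F.Y b (F.Y a f) :=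
      fun a => F.ham_apply_eq _ _
    simp only [e1]
    exact sum_skew_mul_symm h2 (fun j k => P.skew _ _) fun j k => F.Y_comm _ _ _
  rw [modular, F.ham_eq_sum_Y_smul f, div_sum]
  simp only [div_smul (P.isField _)]
  rw [Finset.sum_add_distrib, e, add_zero]
  rfl

/-- The components of the 1-form along the leaves that corresponds to the modular derivation. -/
def leafForm (b : κ) : R := -∑ a, F.inv b a * P.modular h (F.w a)

-- Contracting the leafwise form with `X_f` recovers the modular derivation, up to sign: the inverse
-- matrix in `leafForm` is undone by the matrix of brackets.
include h2 in
theorem sum_leafForm (f : R) : ∑ b, P.ham f (F.w b) * F.leafForm h b = -P.modular h f := by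
  have e1 : ∀ b, P.ham f (F.w b) = ∑ a, F.Y a f * F.mat a b := by
    intro b
    conv_lhs => rw [F.ham_eq_sum_Y_smul f, derivation_sum_apply]
    rfl
  have e2 : ∀ a, ∑ b, F.mat a b * F.leafForm h b = -P.modular h (F.w a) := by
    intro a
    simp only [leafForm, mul_neg, Finset.sum_neg_distrib, Finset.mul_sum]
    rw [Finset.sum_comm]
    have e : ∀ c, ∑ b, F.mat a b * (F.inv b c * P.modular h (F.w c)) =
        (if a = c then 1 else 0) * P.modular h (F.w c) := by
      intro c
      rw [← Matrix.one_apply, ← F.mat_mul_inv, Matrix.mul_apply, Finset.sum_mul]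
      exact Finset.sum_congr rfl fun b _ => (mul_assoc _ _ _).symm
    simp only [e]
    simp
  simp only [e1, Finset.sum_mul]
  rw [Finset.sum_comm, F.modular_eq_sum_Y h h2, ← Finset.sum_neg_distrib]
  refine Finset.sum_congr rfl fun a _ => ?_
  simp only [mul_assoc]
  rw [← Finset.mul_sum, e2, mul_neg]

include h2 in
/-- The 1-form along the leaves is closed. -/
theorem Y_leafForm (a b : κ) : F.Y a (F.leafForm h b) = F.Y b (F.leafForm h a) := by
  -- Write `θ` for the leafwise form and apply `sum_leafForm` to `{w_i, w_j}`. Expanding with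
  -- `modular_bracket` and the Leibniz rule, the terms that differentiate matrix entries cancel by
  -- the Jacobi identity; what remains is a symmetry of the derivatives of `θ`.
  have e1 : ∀ i j, ∑ b, F.mat j b * P.ham (F.w i) (F.leafForm h b) =
      ∑ b, F.mat i b * P.ham (F.w j) (F.leafForm h b) := by
    intro i j
    have h3 := F.sum_leafForm h h2 (P.ham (F.w i) (F.w j))
    have h4 : ∀ i j, P.ham (F.w i) (P.modular h (F.w j)) =
        -∑ b, (F.leafForm h b * P.ham (F.w i) (F.mat j b) +
          F.mat j b * P.ham (F.w i) (F.leafForm h b)) := by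
      intro i j
      have h5 : P.modular h (F.w j) = -∑ b, F.mat j b * F.leafForm h b := by
        rw [← neg_eq_iff_eq_neg]
        exact (F.sum_leafForm h h2 (F.w j)).symm
      rw [h5, map_neg, map_sum]
      congr 1
      refine Finset.sum_congr rfl fun b _ => ?_
      rw [Derivation.leibniz, smul_eq_mul, smul_eq_mul, add_comm]
    rw [P.modular_bracket, h4 i j, h4 j i] at h3
    simp only [Finset.sum_add_distrib] at h3
    have h6 : ∀ b, P.ham (P.ham (F.w i) (F.w j)) (F.w b) * F.leafForm h b =
        F.leafForm h b * P.ham (F.w i) (F.mat j b) - F.leafForm h b * P.ham (F.w j) (F.mat i b) := by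
      intro b
      rw [ham_bracket, Derivation.commutator_apply]
      change (P.ham (F.w i) (F.mat j b) - P.ham (F.w j) (F.mat i b)) * _ = _
      ring
    simp only [h6, Finset.sum_sub_distrib] at h3
    linear_combination -h3
  let G : Matrix κ κ R := Matrix.of fun c b => F.Y c (F.leafForm h b)
  have e2 : ∀ i j, ∑ b, F.mat j b * P.ham (F.w i) (F.leafForm h b) =
      (F.mat * G * F.mat.transpose) i j := by
    intro i j
    rw [Matrix.mul_apply]
    refine Finset.sum_congr rfl fun b _ => ?_
    rw [Matrix.mul_apply, F.ham_apply_eq, mul_comm]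
    rfl
  -- The symmetry is that of `G`, the matrix of the `Y_c θ_b`, seen through the invertible matrix of
  -- brackets, which can be removed on both sides.
  have e3 : F.mat * G * F.mat.transpose = F.mat * G.transpose * F.mat.transpose := by
    ext i j
    rw [← e2, e1, e2, ← Matrix.transpose_apply (F.mat * G.transpose * F.mat.transpose),
      Matrix.transpose_mul, Matrix.transpose_mul, Matrix.transpose_transpose,
      Matrix.transpose_transpose, Matrix.mul_assoc]
  have e4 : G = G.transpose := by
    have h5 : F.mat.transpose * F.inv.transpose = 1 := by
      rw [← Matrix.transpose_mul, inv_mul_mat, Matrix.transpose_one]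
    have h6 := congrArg (fun N => F.inv * N * F.inv.transpose) e3
    simp only [Matrix.mul_assoc, h5, Matrix.mul_one] at h6
    simpa only [← Matrix.mul_assoc, inv_mul_mat, Matrix.one_mul] using h6
  exact congrFun (congrFun e4 a) b

include h2 in
/-- A primitive along the leaves is a hamiltonian of the modular derivation. -/
theorem ham_eq_modular {H : R} (hH : ∀ b, F.Y b H = F.leafForm h b) (f : R) :
    P.ham H f = P.modular h f := by
  rw [P.skew, F.ham_apply_eq]
  simp only [hH]
  rw [F.sum_leafForm h h2, neg_neg]

end RegularFrame

end Poisson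

end CoordSystem

end Algebra

end OuterPoisson


/-! ### Holomorphic functions and partial derivatives in a chart. -/

namespace OuterPoisson

noncomputable section

section Charts

variable {n : ℕ} {M : Type u} [TopologicalSpace M] [ChartedSpace (Model n) M]
  [IsManifold 𝓘(ℂ, Model n) ω M]

/-- The expression of a function in the chart at `c`. -/
def inChart (c : M) (f : M → ℂ) : Model n → ℂ := fun q => f ((chartAt (Model n) c).symm q)

theorem inChart_apply {c x : M} (hx : x ∈ (chartAt (Model n) c).source) (f : M → ℂ) :
    inChart c f (chartAt (Model n) c x) = f x := by
  rw [inChart, (chartAt (Model n) c).left_inv hx]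

theorem chart_eventually {c x : M} (hx : x ∈ (chartAt (Model n) c).source) {p : M → Prop} :
    (∀ᶠ q in 𝓝 (chartAt (Model n) c x), p ((chartAt (Model n) c).symm q)) ↔ ∀ᶠ y in 𝓝 x, p y := by
  set φ := chartAt (Model n) c
  constructor
  · intro h
    filter_upwards [(φ.continuousAt hx).eventually h, φ.open_source.mem_nhds hx] with y h1 h2
    rwa [φ.left_inv h2] at h1
  · intro h
    have h1 : Filter.Tendsto φ.symm (𝓝 (φ x)) (𝓝 x) := φ.tendsto_symm hx
    exact h1.eventually h

theorem holAt_iff_inChart {c x : M} (hx : x ∈ (chartAt (Model n) c).source) {f : M → ℂ} :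
    HolAt n f x ↔ AnalyticAt ℂ (inChart c f) (chartAt (Model n) c x) := by
  set φ := chartAt (Model n) c with hφ
  have hs : ContMDiffAt 𝓘(ℂ, Model n) 𝓘(ℂ, Model n) ω φ.symm (φ x) :=
    (contMDiffOn_chart_symm (I := 𝓘(ℂ, Model n)) (x := c)).contMDiffAt
      (φ.open_target.mem_nhds (φ.map_source hx))
  have hc : ContMDiffAt 𝓘(ℂ, Model n) 𝓘(ℂ, Model n) ω φ x :=
    (contMDiffOn_chart (I := 𝓘(ℂ, Model n)) (x := c)).contMDiffAt (φ.open_source.mem_nhds hx)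
  constructor
  · intro h
    have h' : ContMDiffAt 𝓘(ℂ, Model n) 𝓘(ℂ, ℂ) ω f (φ.symm (φ x)) := by
      rw [φ.left_inv hx]; exact h
    exact (h'.comp (φ x) hs).contDiffAt.analyticAt
  · intro h
    have h' : ContDiffAt ℂ ω (inChart c f) (φ x) := h.contDiffAt
    refine HolAt.congr ?_ (h'.contMDiffAt.comp x hc)
    filter_upwards [φ.open_source.mem_nhds hx] with y hy
    exact inChart_apply hy f

/-- The partial derivative `∂f/∂z_i` in the chart at `c`. -/
def partialDeriv (c : M) (i : Fin n) (f : M → ℂ) (x : M) : ℂ := diff n f x (coordVec c i x)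

theorem diff_eq_fderiv {c x : M} (hx : x ∈ (chartAt (Model n) c).source) {f : M → ℂ}
    (hf : HolAt n f x) (v : Tan n x) :
    diff n f x v = fderiv ℂ (inChart c f) (chartAt (Model n) c x)
      ((trivializationAt (Model n) (TangentSpace 𝓘(ℂ, Model n)) c).continuousLinearMapAt ℂ x v) := by
  have h2 := (mdifferentiableAt_extChartAt (I := 𝓘(ℂ, Model n)) hx).hasMFDerivAt
  have h3 : HasMFDerivAt 𝓘(ℂ, Model n) 𝓘(ℂ, ℂ) (inChart c f) (extChartAt 𝓘(ℂ, Model n) c x)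
      (fderiv ℂ (inChart c f) (chartAt (Model n) c x)) :=
    ((holAt_iff_inChart hx).1 hf).differentiableAt.hasFDerivAt.hasMFDerivAt
  have h5 := h3.comp x h2
  have h6 : diff n f x = _ := (h5.congr_of_eventuallyEq (f₁ := f) (by
    filter_upwards [(chartAt (Model n) c).open_source.mem_nhds hx] with y hy
    exact (inChart_apply hy f).symm)).mfderiv
  rw [h6, TangentBundle.continuousLinearMapAt_trivializationAt hx]
  rfl

theorem continuousLinearMapAt_coordVec {c x : M} (hx : x ∈ (chartAt (Model n) c).source) (i : Fin n) :
    (trivializationAt (Model n) (TangentSpace 𝓘(ℂ, Model n)) c).continuousLinearMapAt ℂ x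
      (coordVec c i x) = EuclideanSpace.single i 1 := by
  have hb : x ∈ (trivializationAt (Model n) (TangentSpace 𝓘(ℂ, Model n)) c).baseSet := by
    simpa using hx
  rw [coordVec, ← Trivialization.symmL_apply (R := ℂ) _ hb]
  exact Trivialization.continuousLinearMapAt_symmL _ hb _

theorem partialDeriv_eq_fderiv {c x : M} (hx : x ∈ (chartAt (Model n) c).source) (i : Fin n)
    {f : M → ℂ} (hf : HolAt n f x) :
    partialDeriv c i f x =
      fderiv ℂ (inChart c f) (chartAt (Model n) c x) (EuclideanSpace.single i 1) := by
  rw [partialDeriv, diff_eq_fderiv hx hf, continuousLinearMapAt_coordVec hx]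

theorem inChart_partialDeriv {c x : M} (hx : x ∈ (chartAt (Model n) c).source) (i : Fin n)
    {f : M → ℂ} (hf : HolAt n f x) : ∀ᶠ q in 𝓝 (chartAt (Model n) c x),
      inChart c (partialDeriv c i f) q =
        fderiv ℂ (inChart c f) q (EuclideanSpace.single i 1) := by
  set φ := chartAt (Model n) c
  filter_upwards [(chart_eventually hx).2 hf.eventually,
    φ.open_target.mem_nhds (φ.map_source hx)] with q h1 h2
  rw [inChart, partialDeriv_eq_fderiv (φ.map_target h2) i h1, φ.right_inv h2]

theorem HolAt.partialDeriv {c x : M} (hx : x ∈ (chartAt (Model n) c).source) (i : Fin n)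
    {f : M → ℂ} (hf : HolAt n f x) : HolAt n (partialDeriv c i f) x := by
  rw [holAt_iff_inChart hx]
  have h1 := ((holAt_iff_inChart hx).1 hf).fderiv
  have h2 : AnalyticAt ℂ (fun q => fderiv ℂ (inChart c f) q (EuclideanSpace.single i 1))
      (chartAt (Model n) c x) :=
    ((ContinuousLinearMap.apply ℂ ℂ (EuclideanSpace.single i (1 : ℂ) : Model n)).analyticAt _).fun_comp h1
  refine h2.congr ?_
  filter_upwards [inChart_partialDeriv hx i hf] with q hq using hq.symm

theorem partialDeriv_comm {c x : M} (hx : x ∈ (chartAt (Model n) c).source) (i j : Fin n)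
    {f : M → ℂ} (hf : HolAt n f x) :
    partialDeriv c i (partialDeriv c j f) x = partialDeriv c j (partialDeriv c i f) x := by
  have ha := (holAt_iff_inChart hx).1 hf
  have hs : IsSymmSndFDerivAt ℂ (inChart c f) (chartAt (Model n) c x) := by
    refine (ha.contDiffAt (n := ω)).isSymmSndFDerivAt ?_
    simp
  have key : ∀ i j : Fin n, partialDeriv c i (partialDeriv c j f) x =
      fderiv ℂ (fderiv ℂ (inChart c f)) (chartAt (Model n) c x) (EuclideanSpace.single i 1)
        (EuclideanSpace.single j 1) := by
    intro i j
    rw [partialDeriv_eq_fderiv hx i (hf.partialDeriv hx j),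
      Filter.EventuallyEq.fderiv_eq (inChart_partialDeriv hx j hf)]
    have h1 := ha.fderiv.differentiableAt.hasFDerivAt
    have h2 := (ContinuousLinearMap.apply ℂ ℂ (EuclideanSpace.single j (1 : ℂ) : Model n)).hasFDerivAt.comp
      _ h1
    have h3 := h2.fderiv
    change fderiv ℂ (fun q => fderiv ℂ (inChart c f) q (EuclideanSpace.single j 1)) _ = _ at h3
    rw [h3]
    rfl
  rw [key, key]
  exact hs _ _

theorem holAt_coordFun {c x : M} (hx : x ∈ (chartAt (Model n) c).source) (i : Fin n) :
    HolAt n (coordFun c i) x :=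
  (EuclideanSpace.proj i : Model n →L[ℂ] ℂ).contMDiff.contMDiffAt.comp x
    (contMDiffAt_extChartAt' hx)

theorem holVFAt_coordVec {c x : M} (hx : x ∈ (chartAt (Model n) c).source) (i : Fin n) :
    HolVFAt (coordVec c i) x :=
  HolVFAt.iff_coord.2 fun j =>
    HolAt.partialDeriv hx i (HolAt.coordFun x j)

theorem diff_coordFun_coordVec {c x : M} (hx : x ∈ (chartAt (Model n) c).source) (i j : Fin n) :
    diff n (coordFun c j) x (coordVec c i x) = if i = j then 1 else 0 := by
  rw [diff_coordFun hx, continuousLinearMapAt_coordVec hx]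
  simp [eq_comm]

theorem HolAt.mul {f g : M → ℂ} {x : M} (hf : HolAt n f x) (hg : HolAt n g x) :
    HolAt n (f * g) x := ContMDiffAt.mul hf hg

theorem HolAt.const (a : ℂ) (x : M) : HolAt n (fun _ : M => a) x := contMDiffAt_const

theorem HolAt.comp_analyticAt {g : ℂ → ℂ} {f : M → ℂ} {x : M} (hg : AnalyticAt ℂ g (f x))
    (hf : HolAt n f x) : HolAt n (fun y => g (f y)) x :=
  (hg.contDiffAt (n := ω)).contMDiffAt.comp x hf

theorem diff_comp {g : ℂ → ℂ} {f : M → ℂ} {x : M} (hg : DifferentiableAt ℂ g (f x))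
    (hf : HolAt n f x) (v : Tan n x) :
    diff n (fun y => g (f y)) x v = deriv g (f x) * diff n f x v := by
  have h := (hg.hasFDerivAt.hasMFDerivAt).comp x hf.mdiff.hasMFDerivAt
  have h2 : diff n (fun y => g (f y)) x = _ := h.mfderiv
  rw [h2]
  change fderiv ℂ g (f x) (diff n f x v) = _
  rw [fderiv_eq_smul_deriv, smul_eq_mul, mul_comm]

theorem diff_mul {f g : M → ℂ} {x : M} (hf : HolAt n f x) (hg : HolAt n g x) (v : Tan n x) :
    diff n (f * g) x v = f x * diff n g x v + g x * diff n f x v := by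
  have h := (hf.mdiff.hasMFDerivAt.mul hg.mdiff.hasMFDerivAt).mfderiv
  have h2 : diff n (f * g) x = _ := h
  rw [h2]
  rfl

end Charts

end

end OuterPoisson


/-! ### Germs of holomorphic functions as a ring with coordinates and Poisson bracket. -/

namespace OuterPoisson

noncomputable section

section Germs

variable {n : ℕ} {M : Type u} [TopologicalSpace M] [ChartedSpace (Model n) M]
  [IsManifold 𝓘(ℂ, Model n) ω M]

/-- The ring of germs of holomorphic functions at `x`. -/
def holGerms (n : ℕ) {M : Type u} [TopologicalSpace M] [ChartedSpace (Model n) M]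
    [IsManifold 𝓘(ℂ, Model n) ω M] (x : M) : Subring ((𝓝 x).Germ ℂ) where
  carrier := {g | ∃ f : M → ℂ, HolAt n f x ∧ (f : (𝓝 x).Germ ℂ) = g}
  mul_mem' := by
    rintro _ _ ⟨f, hf, rfl⟩ ⟨g, hg, rfl⟩
    exact ⟨f * g, hf.mul hg, rfl⟩
  one_mem' := ⟨1, HolAt.const 1 x, rfl⟩
  add_mem' := by
    rintro _ _ ⟨f, hf, rfl⟩ ⟨g, hg, rfl⟩
    exact ⟨f + g, hf.add hg, rfl⟩
  zero_mem' := ⟨0, HolAt.zero, rfl⟩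
  neg_mem' := by
    rintro _ ⟨f, hf, rfl⟩
    exact ⟨-f, hf.neg, rfl⟩

namespace holGerms

variable {x : M}

/-- The germ of a function. -/
def germ (f : M → ℂ) (hf : HolAt n f x) : holGerms n x := ⟨(f : (𝓝 x).Germ ℂ), f, hf, rfl⟩

theorem germ_eq_germ {f g : M → ℂ} {hf : HolAt n f x} {hg : HolAt n g x} :
    germ f hf = germ g hg ↔ ∀ᶠ y in 𝓝 x, f y = g y :=
  Subtype.ext_iff.trans Filter.Germ.coe_eq

theorem exists_rep (r : holGerms n x) : ∃ (f : M → ℂ) (hf : HolAt n f x), germ f hf = r := by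
  obtain ⟨_, f, hf, rfl⟩ := r
  exact ⟨f, hf, rfl⟩

/-- A representative of a germ. -/
def rep (r : holGerms n x) : M → ℂ := (exists_rep r).choose

theorem holAt_rep (r : holGerms n x) : HolAt n (rep r) x := (exists_rep r).choose_spec.choose

theorem germ_rep (r : holGerms n x) : germ (rep r) (holAt_rep r) = r :=
  (exists_rep r).choose_spec.choose_spec

theorem rep_germ (f : M → ℂ) (hf : HolAt n f x) : ∀ᶠ y in 𝓝 x, rep (germ f hf) y = f y :=
  germ_eq_germ.1 (germ_rep (germ f hf))

theorem germ_add {f g : M → ℂ} (hf : HolAt n f x) (hg : HolAt n g x) :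
    germ f hf + germ g hg = germ (f + g) (hf.add hg) := rfl

theorem germ_mul {f g : M → ℂ} (hf : HolAt n f x) (hg : HolAt n g x) :
    germ f hf * germ g hg = germ (f * g) (hf.mul hg) := rfl

theorem germ_neg {f : M → ℂ} (hf : HolAt n f x) : -germ f hf = germ (-f) hf.neg := rfl

theorem germ_one : (1 : holGerms n x) = germ 1 (HolAt.const 1 x) := rfl

theorem germ_zero : (0 : holGerms n x) = germ 0 HolAt.zero := rfl

theorem rep_add (r s : holGerms n x) : ∀ᶠ y in 𝓝 x, rep (r + s) y = (rep r + rep s) y := by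
  have h := rep_germ _ ((holAt_rep r).add (holAt_rep s))
  change ∀ᶠ y in 𝓝 x, rep (germ (rep r) (holAt_rep r) + germ (rep s) (holAt_rep s)) y = _ at h
  rwa [germ_rep, germ_rep] at h

theorem rep_mul (r s : holGerms n x) : ∀ᶠ y in 𝓝 x, rep (r * s) y = (rep r * rep s) y := by
  have h := rep_germ _ ((holAt_rep r).mul (holAt_rep s))
  change ∀ᶠ y in 𝓝 x, rep (germ (rep r) (holAt_rep r) * germ (rep s) (holAt_rep s)) y = _ at h
  rwa [germ_rep, germ_rep] at h

/-- The value of a germ at the base point. -/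
def eval (x : M) : holGerms n x →+* ℂ where
  toFun r := rep r x
  map_one' := (rep_germ 1 (HolAt.const 1 x)).self_of_nhds
  map_zero' := (rep_germ 0 HolAt.zero).self_of_nhds
  map_mul' r s := (rep_mul r s).self_of_nhds
  map_add' r s := (rep_add r s).self_of_nhds

theorem eval_germ (f : M → ℂ) (hf : HolAt n f x) : eval x (germ f hf) = f x :=
  (rep_germ f hf).self_of_nhds

/-- Supplies the hypothesis `h2` of the algebraic lemmas. -/
theorem add_self_eq_zero (r : holGerms n x) (h : r + r = 0) : r = 0 := by
  obtain ⟨f, hf, rfl⟩ := exists_rep r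
  rw [germ_add, germ_zero, germ_eq_germ] at h
  rw [germ_zero, germ_eq_germ]
  filter_upwards [h] with y hy
  exact self_eq_neg.1 (eq_neg_of_add_eq_zero_left hy)

/-- The inverse of the germ of a function that does not vanish at `x`. -/
def unit (f : M → ℂ) (hf : HolAt n f x) (h0 : f x ≠ 0) : (holGerms n x)ˣ where
  val := germ f hf
  inv := germ (fun y => (f y)⁻¹) (HolAt.comp_analyticAt (analyticAt_inv h0) hf)
  val_inv := by
    rw [germ_mul, germ_one, germ_eq_germ]
    filter_upwards [hf.continuousAt.eventually_ne h0] with y hy using mul_inv_cancel₀ hy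
  inv_val := by
    rw [germ_mul, germ_one, germ_eq_germ]
    filter_upwards [hf.continuousAt.eventually_ne h0] with y hy using inv_mul_cancel₀ hy

theorem isUnit_iff {r : holGerms n x} : IsUnit r ↔ eval x r ≠ 0 := by
  constructor
  · intro h
    exact (h.map (eval x)).ne_zero
  · obtain ⟨f, hf, rfl⟩ := exists_rep r
    rw [eval_germ]
    exact fun h => ⟨unit f hf h, rfl⟩

theorem germ_sum {κ : Type*} (s : Finset κ) (f : κ → M → ℂ) (hf : ∀ i, HolAt n (f i) x)
    (hs : HolAt n (fun y => ∑ i ∈ s, f i y) x) : ∑ i ∈ s, germ (f i) (hf i) = germ _ hs := by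
  apply Subtype.ext
  change (holGerms n x).subtype (∑ i ∈ s, germ (f i) (hf i)) =
    Filter.Germ.coeRingHom (𝓝 x) (fun y => ∑ i ∈ s, f i y)
  rw [map_sum, show (fun y => ∑ i ∈ s, f i y) = ∑ i ∈ s, f i by funext y; simp, map_sum]
  rfl

theorem _root_.OuterPoisson.HolAt.sum {κ : Type*} {s : Finset κ} {f : κ → M → ℂ}
    (hf : ∀ i, HolAt n (f i) x) : HolAt n (fun y => ∑ i ∈ s, f i y) x := by
  classical
  induction s using Finset.induction_on with
  | empty => simp only [Finset.sum_empty]; exact HolAt.const 0 x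
  | insert a s ha ih =>
    simp only [Finset.sum_insert ha]
    exact (hf a).add ih

/-- The derivation defined by a holomorphic vector field. -/
def vectorField (X : ∀ x : M, Tan n x) (hX : HolVFAt X x) :
    Derivation ℤ (holGerms n x) (holGerms n x) :=
  Derivation.mk'
    (AddMonoidHom.toIntLinearMap (AddMonoidHom.mk'
      (fun r : holGerms n x => germ (fun y => diff n (rep r) y (X y)) (HolAt.diff_apply hX (holAt_rep r)))
      fun r s => by
        rw [germ_add, germ_eq_germ]
        filter_upwards [(rep_add r s).eventually_nhds, (holAt_rep r).eventually,
          (holAt_rep s).eventually] with y h1 h2 h3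
        rw [diff_congr h1, diff_add h2 h3]
        rfl))
    fun r s => by
      change germ (fun y => diff n (rep (r * s)) y (X y)) (HolAt.diff_apply hX (holAt_rep (r * s))) =
        r * germ (fun y => diff n (rep s) y (X y)) (HolAt.diff_apply hX (holAt_rep s)) +
        s * germ (fun y => diff n (rep r) y (X y)) (HolAt.diff_apply hX (holAt_rep r))
      conv_rhs => enter [1, 1]; rw [← germ_rep r]
      conv_rhs => enter [2, 1]; rw [← germ_rep s]
      rw [germ_mul, germ_mul, germ_add, germ_eq_germ]
      filter_upwards [(rep_mul r s).eventually_nhds, (holAt_rep r).eventually,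
        (holAt_rep s).eventually] with y h1 h2 h3
      rw [diff_congr h1, diff_mul h2 h3]
      rfl

theorem vectorField_germ {X : ∀ x : M, Tan n x} (hX : HolVFAt X x) {f : M → ℂ} (hf : HolAt n f x) :
    vectorField X hX (germ f hf) = germ (fun y => diff n f y (X y)) (HolAt.diff_apply hX hf) := by
  change germ (fun y => diff n (rep (germ f hf)) y (X y))
    (HolAt.diff_apply hX (holAt_rep (germ f hf))) = _
  rw [germ_eq_germ]
  filter_upwards [(rep_germ f hf).eventually_nhds] with y hy
  rw [diff_congr hy]

/-- The coordinates of the chart at `c`, on germs at `x`. -/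
def coordSystem (c : M) (hx : x ∈ (chartAt (Model n) c).source) :
    CoordSystem (Fin n) (holGerms n x) where
  z i := germ (coordFun c i) (holAt_coordFun hx i)
  d i := vectorField (coordVec c i) (holVFAt_coordVec hx i)
  d_z i j := by
    have h : ∀ᶠ y in 𝓝 x, diff n (coordFun c j) y (coordVec c i y) = if i = j then 1 else 0 := by
      filter_upwards [(chartAt (Model n) c).open_source.mem_nhds hx] with y hy
      exact diff_coordFun_coordVec hy i j
    rw [vectorField_germ]
    split_ifs with hij
    · rw [germ_one, germ_eq_germ]
      subst hij; simpa using h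
    · rw [germ_zero, germ_eq_germ]
      simpa [hij] using h
  d_comm i j r := by
    obtain ⟨f, hf, rfl⟩ := exists_rep r
    rw [vectorField_germ, vectorField_germ, vectorField_germ, vectorField_germ, germ_eq_germ]
    filter_upwards [(chartAt (Model n) c).open_source.mem_nhds hx, hf.eventually] with y h1 h2
    exact partialDeriv_comm h1 i j h2

variable (c : M) (hx : x ∈ (chartAt (Model n) c).source)

theorem isField_vectorField {X : ∀ x : M, Tan n x} (hX : HolVFAt X x) :
    (coordSystem c hx).IsField (vectorField X hX) := by
  intro r
  obtain ⟨f, hf, rfl⟩ := exists_rep r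
  simp only [coordSystem, vectorField_germ, germ_mul]
  rw [germ_sum _ _ _ (HolAt.sum fun i => HolAt.mul (HolAt.diff_apply hX (holAt_coordFun hx i))
    (HolAt.diff_apply (holVFAt_coordVec hx i) hf)), germ_eq_germ]
  filter_upwards [(chartAt (Model n) c).open_source.mem_nhds hx] with y hy
  conv_lhs => rw [← sum_diff_coordVec hy (X y), map_sum]
  simp

end holGerms

namespace PoissonStructure

variable (P : PoissonStructure n M) {x : M}

open holGerms

/-- The Poisson bracket on germs. -/
def germPoisson (c : M) (hx : x ∈ (chartAt (Model n) c).source) :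
    (coordSystem c hx).Poisson where
  ham r := vectorField (P.ham (rep r)) (P.holVFAt_ham (holAt_rep r))
  skew r s := by
    conv_lhs => rw [← germ_rep s]
    conv_rhs => rw [← germ_rep r]
    rw [vectorField_germ, vectorField_germ, germ_neg, germ_eq_germ]
    refine Filter.Eventually.of_forall fun y => ?_
    simp only [Pi.neg_apply, diff_ham]
    exact P.bracket_swap _ _ _
  isField r := isField_vectorField c hx _
  jacobi r s t := by
    obtain ⟨h, hh, rfl⟩ := exists_rep t
    rw [vectorField_germ, vectorField_germ]
    have e : ∀ (k : M → ℂ) (hk : HolAt n k x) (t : holGerms n x),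
        vectorField (P.ham (rep (germ k hk))) (P.holVFAt_ham (holAt_rep (germ k hk))) t =
        vectorField (P.ham k) (P.holVFAt_ham hk) t := by
      intro k hk t
      obtain ⟨g, hg, rfl⟩ := exists_rep t
      rw [vectorField_germ, vectorField_germ, germ_eq_germ]
      filter_upwards [(rep_germ k hk).eventually_nhds] with y hy
      rw [P.ham_congr hy]
    conv_rhs => rw [← germ_rep s]
    simp only [vectorField_germ, e]
    rw [germ_add, germ_eq_germ]
    filter_upwards [hh.eventually, (holAt_rep r).eventually, (holAt_rep s).eventually] with y h1 h2 h3
    -- The Jacobi identity in the form that `X_r` is a derivation of the bracket.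
    have j := P.isPoissonAt_ham h2 (rep s) h h3 h1
    simp only [diff_ham, Pi.add_apply] at j ⊢
    exact j

theorem holAt_bracket {f g : M → ℂ} (hf : HolAt n f x) (hg : HolAt n g x) :
    HolAt n (P.bracket f g) x := P.hol hf hg

theorem germPoisson_ham_germ (c : M) (hx : x ∈ (chartAt (Model n) c).source) {f g : M → ℂ}
    (hf : HolAt n f x) (hg : HolAt n g x) :
    (P.germPoisson c hx).ham (germ f hf) (germ g hg) = germ (P.bracket f g) (P.holAt_bracket hf hg) := by
  have h := vectorField_germ (P.holVFAt_ham (holAt_rep (germ f hf))) hg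
  refine h.trans (germ_eq_germ.2 ?_)
  filter_upwards [(rep_germ f hf).eventually_nhds] with y hy
  rw [P.ham_congr hy, diff_ham]

end PoissonStructure

end Germs

end

end OuterPoisson


/-! ### Primitives along commuting fields on germs. -/

namespace OuterPoisson

noncomputable section

namespace holGerms

variable {n : ℕ} {M : Type u} [TopologicalSpace M] [ChartedSpace (Model n) M]
  [IsManifold 𝓘(ℂ, Model n) ω M] {x : M} {c : M} {hx : x ∈ (chartAt (Model n) c).source}

/-- The expression in the chart at `c` of a derivation on germs. -/
def chartField (hx : x ∈ (chartAt (Model n) c).source)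
    (Y : Derivation ℤ (holGerms n x) (holGerms n x)) (q : Model n) : Model n :=
  ∑ j, inChart c (rep (Y ((coordSystem c hx).z j))) q • EuclideanSpace.single j (1 : ℂ)

theorem analyticAt_inChart_rep (hx : x ∈ (chartAt (Model n) c).source) (r : holGerms n x) :
    AnalyticAt ℂ (inChart c (rep r)) (chartAt (Model n) c x) :=
  (holAt_iff_inChart hx).1 (holAt_rep r)

theorem analyticAt_chartField (Y : Derivation ℤ (holGerms n x) (holGerms n x)) :
    AnalyticAt ℂ (chartField hx Y) (chartAt (Model n) c x) :=
  Finset.analyticAt_fun_sum _ fun _ _ => (analyticAt_inChart_rep hx _).smul analyticAt_const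

theorem chartField_apply (Y : Derivation ℤ (holGerms n x) (holGerms n x)) (q : Model n) (i : Fin n) :
    chartField hx Y q i = inChart c (rep (Y ((coordSystem c hx).z i))) q := by
  simp [chartField, Finset.sum_apply, Pi.single_apply]

/-- Turns an equation between germs into a first-order linear partial differential equation on `ℂⁿ`,
to which the Cauchy theorems apply. -/
theorem field_germ_eq_iff {Y : Derivation ℤ (holGerms n x) (holGerms n x)}
    (hY : (coordSystem c hx).IsField Y) {f k : M → ℂ} (hf : HolAt n f x) (hk : HolAt n k x) :
    Y (germ f hf) = germ k hk ↔ ∀ᶠ q in 𝓝 (chartAt (Model n) c x),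
      fderiv ℂ (inChart c f) q (chartField hx Y q) = inChart c k q := by
  have h1 : Y (germ f hf) = germ (fun y => ∑ j, (rep (Y ((coordSystem c hx).z j)) * partialDeriv c j f) y)
      (HolAt.sum fun j => (holAt_rep _).mul (hf.partialDeriv hx j)) := by
    rw [hY, ← germ_sum _ _ (fun j => (holAt_rep _).mul (hf.partialDeriv hx j))]
    refine Finset.sum_congr rfl fun j _ => ?_
    conv_lhs => rw [← germ_rep (Y _)]
    rw [← germ_mul (holAt_rep _) (hf.partialDeriv hx j)]
    congr 1
    exact vectorField_germ (holVFAt_coordVec hx j) hf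
  rw [h1, germ_eq_germ, ← chart_eventually hx]
  have h2 := Filter.eventually_all.2 fun j => inChart_partialDeriv hx j hf
  refine Filter.eventually_congr ?_
  filter_upwards [h2] with q hq
  have h3 : ∀ j, partialDeriv c j f ((chartAt (Model n) c).symm q) =
      fderiv ℂ (inChart c f) q (EuclideanSpace.single j 1) := hq
  simp only [Pi.mul_apply, h3, chartField, map_sum, map_smul, smul_eq_mul]
  rfl

/-- The germ vanishes on the coordinate hyperplane through the base point. -/
def VanishesOnSlice (c : M) (i : Fin n) (r : holGerms n x) : Prop :=
  ∀ᶠ y in 𝓝 x, coordFun c i y = coordFun c i x → rep r y = 0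

theorem vanishesOnSlice_iff (hx : x ∈ (chartAt (Model n) c).source) {i : Fin n} {f : M → ℂ}
    (hf : HolAt n f x) : VanishesOnSlice c i (germ f hf) ↔ ∀ᶠ q in 𝓝 (chartAt (Model n) c x),
      (EuclideanSpace.proj i : Model n →L[ℂ] ℂ) q =
        (EuclideanSpace.proj i : Model n →L[ℂ] ℂ) (chartAt (Model n) c x) → inChart c f q = 0 := by
  rw [VanishesOnSlice, ← chart_eventually hx]
  refine Filter.eventually_congr ?_
  filter_upwards [(chart_eventually hx).2 (rep_germ f hf), (chartAt (Model n) c).open_target.mem_nhds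
    ((chartAt (Model n) c).map_source hx)] with q h1 h2
  have h3 : coordFun c i ((chartAt (Model n) c).symm q) = q i := by
    change (chartAt (Model n) c ((chartAt (Model n) c).symm q)) i = q i
    rw [(chartAt (Model n) c).right_inv h2]
  rw [h1, h3]
  rfl

/-- The normalization `Y z_i = 1` is the transversality hypothesis of the Cauchy problem on the
slice where `z_i` is constant. -/
theorem proj_chartField (Y : Derivation ℤ (holGerms n x) (holGerms n x)) {i : Fin n}
    (hi : Y ((coordSystem c hx).z i) = 1) :
    (EuclideanSpace.proj i : Model n →L[ℂ] ℂ) (chartField hx Y (chartAt (Model n) c x)) = 1 := by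
  change chartField hx Y (chartAt (Model n) c x) i = 1
  rw [chartField_apply, hi, inChart_apply hx]
  exact map_one (eval x)

theorem exists_field_eq {Y : Derivation ℤ (holGerms n x) (holGerms n x)}
    (hY : (coordSystem c hx).IsField Y) {i : Fin n} (hi : Y ((coordSystem c hx).z i) = 1)
    (g : holGerms n x) : ∃ r, Y r = g ∧ VanishesOnSlice c i r := by
  obtain ⟨v, hv, h1, h2⟩ := exists_solution_cauchy (analyticAt_chartField (hx := hx) Y)
    (analyticAt_inChart_rep hx g) (EuclideanSpace.proj i) (proj_chartField Y hi)
  have e : ∀ᶠ q in 𝓝 (chartAt (Model n) c x), inChart c (fun y => v (chartAt (Model n) c y)) q = v q := by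
    filter_upwards [(chartAt (Model n) c).open_target.mem_nhds
      ((chartAt (Model n) c).map_source hx)] with q hq
    rw [inChart, (chartAt (Model n) c).right_inv hq]
  have hf : HolAt n (fun y => v (chartAt (Model n) c y)) x := by
    rw [holAt_iff_inChart hx]
    refine hv.congr ?_
    filter_upwards [e] with q hq using hq.symm
  refine ⟨germ _ hf, ?_, ?_⟩
  · rw [← germ_rep g, field_germ_eq_iff hY]
    filter_upwards [h1, e.eventually_nhds] with q hq he
    rw [Filter.EventuallyEq.fderiv_eq he, hq]
  · rw [vanishesOnSlice_iff hx]
    filter_upwards [h2, e] with q hq he h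
    rw [he, hq h]

theorem eq_zero_of_field_eq_zero {Y : Derivation ℤ (holGerms n x) (holGerms n x)}
    (hY : (coordSystem c hx).IsField Y) {i : Fin n} (hi : Y ((coordSystem c hx).z i) = 1)
    {r : holGerms n x} (h : Y r = 0) (h0 : VanishesOnSlice c i r) : r = 0 := by
  rw [← germ_rep r] at h h0 ⊢
  rw [germ_zero, field_germ_eq_iff hY] at h
  rw [vanishesOnSlice_iff hx] at h0
  have h3 := eventually_eq_zero_of_cauchy (analyticAt_chartField (hx := hx) Y)
    (analyticAt_inChart_rep hx r) (EuclideanSpace.proj i) (proj_chartField Y hi) h h0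
  rw [germ_zero, germ_eq_germ]
  exact (chart_eventually hx).1 h3

/-- Since `Y z_i = 0`, the field is tangent to the slice: the line through a point of the slice in
the direction of `Y` stays in it, so the derivative along `Y` sees only zero values. -/
theorem VanishesOnSlice.field {Y : Derivation ℤ (holGerms n x) (holGerms n x)}
    (hY : (coordSystem c hx).IsField Y) {i : Fin n} (hi : Y ((coordSystem c hx).z i) = 0)
    {r : holGerms n x} (h0 : VanishesOnSlice c i r) : VanishesOnSlice c i (Y r) := by
  rw [← germ_rep r] at h0
  rw [vanishesOnSlice_iff hx] at h0
  have h1 := (field_germ_eq_iff hY (holAt_rep r) (holAt_rep (Y r))).1 (by rw [germ_rep, germ_rep])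
  rw [← germ_rep (Y r), vanishesOnSlice_iff hx]
  have h2 : ∀ᶠ y in 𝓝 x, rep (Y ((coordSystem c hx).z i)) y = 0 := by
    rw [hi]
    exact rep_germ 0 HolAt.zero
  filter_upwards [h1, h0.eventually_nhds, (chart_eventually hx).2 h2,
    (analyticAt_inChart_rep hx r).eventually_analyticAt] with q h3 h4 h5 h6 h7
  rw [← h3]
  set l : Model n →L[ℂ] ℂ := EuclideanSpace.proj i with hl
  have h8 : l (chartField hx Y q) = 0 := by
    change chartField hx Y q i = 0
    rw [chartField_apply]
    exact h5
  have h9 : HasDerivAt (fun t : ℂ => q + t • chartField hx Y q) (chartField hx Y q) 0 := by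
    simpa using ((hasDerivAt_id (0 : ℂ)).smul_const (chartField hx Y q)).const_add q
  have h6' : HasFDerivAt (inChart c (rep r)) (fderiv ℂ (inChart c (rep r)) q)
      (q + (0 : ℂ) • chartField hx Y q) := by
    rw [zero_smul, add_zero]; exact h6.differentiableAt.hasFDerivAt
  have h10 := h6'.comp_hasDerivAt (0 : ℂ) h9
  refine h10.unique ((hasDerivAt_const (0 : ℂ) (0 : ℂ)).congr_of_eventuallyEq ?_)
  have h11 : Filter.Tendsto (fun t : ℂ => q + t • chartField hx Y q) (𝓝 0) (𝓝 q) := by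
    have := h9.continuousAt.tendsto
    rwa [zero_smul, add_zero] at this
  filter_upwards [h11.eventually h4] with t ht
  refine ht ?_
  rw [map_add, map_smul, h8, smul_zero, add_zero, h7]

/-- A closed 1-form along commuting fields has a primitive. -/
theorem exists_common_primitive {κ : Type*} [Fintype κ] [DecidableEq κ]
    {Y : κ → Derivation ℤ (holGerms n x) (holGerms n x)} (hY : ∀ a, (coordSystem c hx).IsField (Y a))
    (e : κ → Fin n) (hz : ∀ a b, Y a ((coordSystem c hx).z (e b)) = if a = b then 1 else 0)
    (hc : ∀ a b f, Y a (Y b f) = Y b (Y a f)) {g : κ → holGerms n x}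
    (hg : ∀ a b, Y a (g b) = Y b (g a)) : ∃ H, ∀ a, Y a H = g a := by
  suffices h : ∀ s : Finset κ, ∃ H, ∀ a ∈ s, Y a H = g a by
    obtain ⟨H, hH⟩ := h Finset.univ
    exact ⟨H, fun a => hH a (Finset.mem_univ a)⟩
  intro s
  induction s using Finset.induction_on with
  | empty => exact ⟨0, by simp⟩
  | insert k s hk ih =>
    obtain ⟨H, hH⟩ := ih
    -- The correction repairs the equation for `Y k`; its zero data on the slice ensure that the
    -- equations already solved are not disturbed.
    obtain ⟨r, hr, hr0⟩ := exists_field_eq (hY k) (i := e k) (by rw [hz, if_pos rfl]) (g k - Y k H)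
    refine ⟨H + r, fun a ha => ?_⟩
    rw [map_add]
    rcases Finset.mem_insert.1 ha with rfl | ha
    · rw [hr]; ring
    · have hak : a ≠ k := fun h => hk (h ▸ ha)
      -- `Y k (Y a r) = Y a (g k - Y k H) = Y k (g a - Y a H) = 0` by commutation and closedness. As
      -- `Y a` is tangent to the slice, `Y a r` also vanishes there, so it is zero by uniqueness for
      -- the Cauchy problem.
      have h1 : Y k (Y a r) = 0 := by
        rw [hc k a, hr, map_sub, hg a k, hc a k, hH a ha, sub_self]
      have h2 : Y a r = 0 := eq_zero_of_field_eq_zero (hY k) (i := e k) (by rw [hz, if_pos rfl]) h1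
        (hr0.field (hY a) (by rw [hz, if_neg hak]))
      rw [hH a ha, h2, add_zero]

end holGerms

end

end OuterPoisson


/-! ### Volume forms, and the Koszul field as the divergence of hamiltonian fields. -/

namespace OuterPoisson

noncomputable section

section Volume

variable {n : ℕ} {M : Type u} [TopologicalSpace M] [ChartedSpace (Model n) M]
  [IsManifold 𝓘(ℂ, Model n) ω M] {c c' x : M}

theorem tan_ext (hx : x ∈ (chartAt (Model n) c).source) {v w : Tan n x}
    (h : ∀ j : Fin n, diff n (coordFun c j) x v = diff n (coordFun c j) x w) : v = w := by
  rw [← sum_diff_coordVec hx v, ← sum_diff_coordVec hx w]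
  simp only [h]

/-- The basis `∂/∂z_i` of the tangent space. -/
def coordBasis (hx : x ∈ (chartAt (Model n) c).source) : Module.Basis (Fin n) ℂ (Tan n x) :=
  Module.Basis.ofEquivFun
    { toFun := fun v j => diff n (coordFun c j) x v
      map_add' := fun v w => by funext j; exact map_add _ _ _
      map_smul' := fun a v => by funext j; exact map_smul _ _ _
      invFun := fun w => ∑ j, w j • coordVec c j x
      left_inv := fun v => sum_diff_coordVec hx v
      right_inv := fun w => by
        funext j
        simp only [map_sum, map_smul, diff_coordFun_coordVec hx]
        simp }

theorem coordBasis_repr (hx : x ∈ (chartAt (Model n) c).source) (v : Tan n x)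
    (j : Fin n) : (coordBasis hx).repr v j = diff n (coordFun c j) x v := rfl

theorem coordBasis_apply (hx : x ∈ (chartAt (Model n) c).source) (i : Fin n) :
    coordBasis hx i = coordVec c i x :=
  tan_ext hx fun j => by
    rw [← coordBasis_repr hx, Module.Basis.repr_self, diff_coordFun_coordVec hx,
      Finsupp.single_apply]

theorem volCoeff_change (ν : NForm n M)
    (hx' : x ∈ (chartAt (Model n) c').source) :
    volCoeff ν c x = (Matrix.of fun i j => diff n (coordFun c' j) x (coordVec c i x)).det *
      volCoeff ν c' x := by
  have h := (ν x).eq_smul_basis_det (coordBasis hx')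
  have h1 : volCoeff ν c x = ν x (fun i => coordVec c i x) := rfl
  have h2 : volCoeff ν c' x = ν x (coordBasis hx') := by
    rw [volCoeff]
    congr 1
    funext i
    exact (coordBasis_apply hx' i).symm
  rw [h1, h, h2, AlternatingMap.smul_apply, smul_eq_mul, mul_comm, Module.Basis.det_apply,
    ← Matrix.det_transpose]
  rfl

theorem volCoeff_ne_zero {ν : NForm n M} (hx : x ∈ (chartAt (Model n) c).source) (h : ν x ≠ 0) :
    volCoeff ν c x ≠ 0 := by
  have h2 : volCoeff ν c x = ν x (coordBasis hx) := by
    rw [volCoeff]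
    congr 1
    funext i
    exact (coordBasis_apply hx i).symm
  rw [h2]
  exact (AlternatingMap.map_basis_ne_zero_iff (coordBasis hx) (ν x)).2 h

namespace holGerms

theorem germ_det {κ : Type*} [Fintype κ] [DecidableEq κ] (A : κ → κ → M → ℂ)
    (hA : ∀ i j, HolAt n (A i j) x) :
    ∃ h : HolAt n (fun y => (Matrix.of fun i j => A i j y).det) x,
      (Matrix.of fun i j => germ (A i j) (hA i j)).det = germ _ h := by
  set G : Matrix κ κ (holGerms n x) := Matrix.of fun i j => germ (A i j) (hA i j)
  have h1 : (holGerms n x).subtype G.det =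
      Filter.Germ.coeRingHom (𝓝 x) (fun y => (Matrix.of fun i j => A i j y).det) := by
    have h2 : (fun y => (Matrix.of fun i j => A i j y).det) = (Matrix.of A).det := by
      funext y
      have h3 := (Pi.evalRingHom (fun _ : M => ℂ) y).map_det (Matrix.of A)
      exact h3.symm
    rw [h2, RingHom.map_det, RingHom.map_det]
    rfl
  have h4 : ((rep G.det : M → ℂ) : (𝓝 x).Germ ℂ) =
      ((fun y => (Matrix.of fun i j => A i j y).det : M → ℂ) : (𝓝 x).Germ ℂ) :=
    (congrArg Subtype.val (germ_rep G.det)).trans h1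
  have h5 := (holAt_rep G.det).congr (Filter.Germ.coe_eq.1 h4)
  exact ⟨h5, Subtype.ext h1⟩

end holGerms

theorem holAt_volCoeff {ν : NForm n M} (hx : x ∈ (chartAt (Model n) c).source)
    (hx' : x ∈ (chartAt (Model n) c').source) (h : HolAt n (volCoeff ν c') x) :
    HolAt n (volCoeff ν c) x := by
  obtain ⟨h1, -⟩ := holGerms.germ_det
    (fun i j y => diff n (coordFun c' j) y (coordVec c i y)) fun i j =>
    HolAt.diff_apply (holVFAt_coordVec hx i) (holAt_coordFun hx' j)
  refine (h1.mul h).congr ?_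
  filter_upwards [(chartAt (Model n) c').open_source.mem_nhds hx'] with y h3
  exact (volCoeff_change ν h3).symm

open Classical in
/-- The volume form `dz_1 ∧ ⋯ ∧ dz_n` of the chart at `c`. -/
def chartForm (n : ℕ) {M : Type u} [TopologicalSpace M] [ChartedSpace (Model n) M]
    [IsManifold 𝓘(ℂ, Model n) ω M] (c : M) : NForm n M := fun x =>
  if hx : x ∈ (chartAt (Model n) c).source then (coordBasis hx).det else 0

theorem volCoeff_chartForm (hx : x ∈ (chartAt (Model n) c).source) :
    volCoeff (chartForm n c) c x = 1 := by
  rw [volCoeff, chartForm, dif_pos hx]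
  simp only [← coordBasis_apply hx]
  exact (coordBasis hx).det_self

/-- The domain of the chart at `c`. -/
def chartDomain (n : ℕ) {M : Type u} [TopologicalSpace M] [ChartedSpace (Model n) M] (c : M) :
    Opens M := ⟨(chartAt (Model n) c).source, (chartAt (Model n) c).open_source⟩

theorem isVolumeFormOn_chartForm (c : M) : IsVolumeFormOn (chartForm n c) (chartDomain n c) := by
  intro x hx
  have hx' : x ∈ (chartAt (Model n) c).source := hx
  constructor
  · intro h
    have h1 := volCoeff_chartForm hx'
    rw [volCoeff, h] at h1
    exact zero_ne_one h1
  · refine holAt_volCoeff (mem_chart_source _ x) hx' ((HolAt.const 1 x).congr ?_)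
    filter_upwards [(chartAt (Model n) c).open_source.mem_nhds hx'] with y hy
    exact (volCoeff_chartForm hy).symm

/-- `ν` is a holomorphic volume form near `x`, seen in the chart at `c`. -/
structure IsVolumeAt (ν : NForm n M) (c x : M) : Prop where
  mem : x ∈ (chartAt (Model n) c).source
  hol : HolAt n (volCoeff ν c) x
  ne_zero : volCoeff ν c x ≠ 0

/-- `IsVolumeFormOn` tests holomorphy at each point only in the preferred chart of that point; the
Jacobian determinant carries it to any chart. -/
theorem IsVolumeFormOn.isVolumeAt {ν : NForm n M} {V : Opens M} (hν : IsVolumeFormOn ν V)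
    (hx : x ∈ V) (hc : x ∈ (chartAt (Model n) c).source) : IsVolumeAt ν c x where
  mem := hc
  hol := holAt_volCoeff hc (mem_chart_source _ x) (hν x hx).2
  ne_zero := volCoeff_ne_zero hc (hν x hx).1

namespace PoissonStructure

variable (P : PoissonStructure n M) {ν : NForm n M}

open holGerms

/-- The divergence of the hamiltonian vector field of `f`, computed in the chart at `c`. -/
def divHam (ν : NForm n M) (c : M) (f : M → ℂ) (y : M) : ℂ :=
  ∑ j : Fin n, partialDeriv c j (P.bracket f (coordFun c j)) y +
    (volCoeff ν c y)⁻¹ * P.bracket f (volCoeff ν c) y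

/-- The bridge between algebra and geometry: identities for `modular` on germs become identities for
divergences of functions. -/
theorem modular_germ (hν : IsVolumeAt ν c x) {f : M → ℂ} (hf : HolAt n f x) :
    ∃ h : HolAt n (P.divHam ν c f) x,
      (P.germPoisson c hν.mem).modular (unit _ hν.hol hν.ne_zero) (germ f hf) = germ _ h := by
  have h1 : ∀ j : Fin n, HolAt n (P.bracket f (coordFun c j)) x := fun j => P.holAt_bracket hf (holAt_coordFun hν.mem j)
  have h2 : HolAt n (fun y => ∑ j : Fin n, partialDeriv c j (P.bracket f (coordFun c j)) y) x :=
    HolAt.sum fun j => (h1 j).partialDeriv hν.mem j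
  have h3 : HolAt n (fun y => (volCoeff ν c y)⁻¹) x :=
    HolAt.comp_analyticAt (analyticAt_inv hν.ne_zero) hν.hol
  have h4 : HolAt n (P.bracket f (volCoeff ν c)) x := P.holAt_bracket hf hν.hol
  refine ⟨h2.add (h3.mul h4), ?_⟩
  have e1 : ∀ j : Fin n, (coordSystem c hν.mem).d j ((P.germPoisson c hν.mem).ham (germ f hf)
      ((coordSystem c hν.mem).z j)) =
      germ (partialDeriv c j (P.bracket f (coordFun c j))) ((h1 j).partialDeriv hν.mem j) := by
    intro j
    have e := P.germPoisson_ham_germ c hν.mem hf (holAt_coordFun hν.mem j)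
    exact (congrArg _ e).trans (vectorField_germ (holVFAt_coordVec hν.mem j) (h1 j))
  have e2 := P.germPoisson_ham_germ c hν.mem hf hν.hol
  rw [CoordSystem.Poisson.modular, CoordSystem.div]
  simp only [e1]
  rw [germ_sum _ _ _ h2]
  have e3 : (P.germPoisson c hν.mem).ham (germ f hf) ↑(unit _ hν.hol hν.ne_zero) = germ _ h4 := e2
  rw [e3]
  rfl

theorem divHam_eq (hν : IsVolumeAt ν c x) (hν' : IsVolumeAt ν c' x) {f : M → ℂ}
    (hf : HolAt n f x) : P.divHam ν c f x = P.divHam ν c' f x := by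
  obtain ⟨h1, e1⟩ := P.modular_germ hν hf
  obtain ⟨h2, e2⟩ := P.modular_germ hν' hf
  rw [← eval_germ _ h1, ← eval_germ _ h2, ← e1, ← e2]
  congr 1
  refine CoordSystem.div_eq_div
    (fun i => isField_vectorField c hν.mem (holVFAt_coordVec hν'.mem i))
    ((P.germPoisson c hν.mem).isField (germ f hf)) ?_
  obtain ⟨h3, e3⟩ := germ_det (fun i j y => diff n (coordFun c' j) y (coordVec c i y)) fun i j =>
    HolAt.diff_apply (holVFAt_coordVec hν.mem i) (holAt_coordFun hν'.mem j)
  have e4 : (Matrix.of fun i j => (coordSystem c hν.mem).d i ((coordSystem c' hν'.mem).z j)) =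
      Matrix.of fun i j => germ (fun y => diff n (coordFun c' j) y (coordVec c i y))
        (HolAt.diff_apply (holVFAt_coordVec hν.mem i) (holAt_coordFun hν'.mem j)) := by
    exact Matrix.ext fun i j =>
      vectorField_germ (holVFAt_coordVec hν.mem i) (holAt_coordFun hν'.mem j)
  rw [e4, e3]
  change germ _ hν.hol = germ _ h3 * germ _ hν'.hol
  rw [germ_mul, germ_eq_germ]
  filter_upwards [(chartAt (Model n) c').open_source.mem_nhds hν'.mem] with y h3
  exact volCoeff_change ν h3

/-- `koszul` at `x` is computed in the chart at `x`, and its components there are the divergences of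
the `X_{z_j}`, since the brackets are skew. As the modular derivation is first-order
(`modular_eq_sum`), this extends to all `f`. -/
theorem diff_koszul_self (hν : IsVolumeAt ν x x) {f : M → ℂ} (hf : HolAt n f x) :
    diff n f x (koszul ν P.tensor x) = P.divHam ν x f x := by
  obtain ⟨h1, e1⟩ := P.modular_germ hν hf
  rw [← eval_germ _ h1, ← e1, CoordSystem.Poisson.modular_eq_sum _ _ add_self_eq_zero, map_sum]
  have e2 : ∀ j, eval x ((coordSystem x hν.mem).d j (germ f hf)) = diff n f x (coordVec x j x) := by
    intro j
    have e : (coordSystem x hν.mem).d j (germ f hf) = _ := vectorField_germ (holVFAt_coordVec hν.mem j) hf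
    rw [e, eval_germ]
  have e3 : ∀ j, eval x ((P.germPoisson x hν.mem).modular (unit _ hν.hol hν.ne_zero)
      ((coordSystem x hν.mem).z j)) = P.divHam ν x (coordFun x j) x := by
    intro j
    obtain ⟨h2, e⟩ := P.modular_germ hν (holAt_coordFun hν.mem j)
    rw [← eval_germ _ h2, ← e]
    rfl
  simp only [map_mul, e2, e3]
  rw [koszul, neg_smul, map_neg, map_smul, map_sum, smul_eq_mul, Finset.mul_sum, ← Finset.sum_neg_distrib]
  refine Finset.sum_congr rfl fun j _ => ?_
  rw [map_smul, smul_eq_mul]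
  have e4 : ∀ i : Fin n, diff n (fun y => volCoeff ν x y * P.tensor y ![diff n (coordFun x i) y,
      diff n (coordFun x j) y]) x (coordVec x i x) =
      -(volCoeff ν x x * partialDeriv x i (P.bracket (coordFun x j) (coordFun x i)) x) -
      P.bracket (coordFun x j) (coordFun x i) x * partialDeriv x i (volCoeff ν x) x := by
    intro i
    have e5 : (fun y => volCoeff ν x y * P.tensor y ![diff n (coordFun x i) y,
      diff n (coordFun x j) y]) = volCoeff ν x * -P.bracket (coordFun x j) (coordFun x i) := by
      funext y
      change volCoeff ν x y * P.bracket (coordFun x i) (coordFun x j) y = _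
      rw [P.bracket_swap]
      rfl
    have h3 : HolAt n (P.bracket (coordFun x j) (coordFun x i)) x :=
      P.holAt_bracket (holAt_coordFun hν.mem j) (holAt_coordFun hν.mem i)
    rw [e5, diff_mul hν.hol h3.neg, diff_neg]
    simp only [Pi.neg_apply, partialDeriv]
    change _ * -(diff n (P.bracket (coordFun x j) (coordFun x i)) x (coordVec x i x)) + _ = _
    ring
  have e6 : P.bracket (coordFun x j) (volCoeff ν x) x =
      ∑ i : Fin n, P.bracket (coordFun x j) (coordFun x i) x * partialDeriv x i (volCoeff ν x) x := by
    rw [← P.diff_ham, ← sum_diff_coordVec hν.mem (P.ham (coordFun x j) x), map_sum]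
    refine Finset.sum_congr rfl fun i _ => ?_
    rw [map_smul, smul_eq_mul, P.diff_ham]
    rfl
  simp only [e4, divHam, e6, Finset.sum_sub_distrib, Finset.sum_neg_distrib, ← Finset.mul_sum]
  have h0 := hν.ne_zero
  field_simp
  ring

variable {V : Opens M} (hν : IsVolumeFormOn ν V)
include hν

/-- `koszul` changes charts from point to point, so the identity at the centre of each chart gives
no smoothness by itself. Independence of coordinates allows one fixed chart in a whole
neighbourhood. -/
theorem diff_koszul (hx : x ∈ V) (hc : x ∈ (chartAt (Model n) c).source) {f : M → ℂ}
    (hf : HolAt n f x) : diff n f x (koszul ν P.tensor x) = P.divHam ν c f x := by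
  rw [P.diff_koszul_self (hν.isVolumeAt hx (mem_chart_source _ x)) hf]
  exact P.divHam_eq (hν.isVolumeAt hx (mem_chart_source _ x)) (hν.isVolumeAt hx hc) hf

theorem eventually_diff_koszul (hx : x ∈ V) (hc : x ∈ (chartAt (Model n) c).source) {f : M → ℂ}
    (hf : HolAt n f x) :
    ∀ᶠ y in 𝓝 x, diff n f y (koszul ν P.tensor y) = P.divHam ν c f y := by
  filter_upwards [V.isOpen.mem_nhds hx, (chartAt (Model n) c).open_source.mem_nhds hc,
    hf.eventually] with y h1 h2 h3
  exact P.diff_koszul hν h1 h2 h3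

theorem holVFAt_koszul (hx : x ∈ V) : HolVFAt (koszul ν P.tensor) x := by
  have hxx := mem_chart_source (Model n) x
  refine HolVFAt.iff_coord.2 fun i => ?_
  obtain ⟨h1, -⟩ := P.modular_germ (hν.isVolumeAt hx hxx) (holAt_coordFun hxx i)
  refine h1.congr ?_
  filter_upwards [P.eventually_diff_koszul hν hx hxx (holAt_coordFun hxx i)] with y hy using hy.symm

theorem isPoissonAt_koszul (hx : x ∈ V) : P.IsPoissonAt (koszul ν P.tensor) x := by
  intro f g hf hg
  have hxx := mem_chart_source (Model n) x
  have hv := hν.isVolumeAt hx hxx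
  obtain ⟨hf1, ef⟩ := P.modular_germ hv hf
  obtain ⟨hg1, eg⟩ := P.modular_germ hv hg
  obtain ⟨hb, eb⟩ := P.modular_germ hv (f := P.bracket f g) (P.holAt_bracket hf hg)
  have hvf : ∀ k : M → ℂ, HolAt n k x →
      ∀ᶠ y in 𝓝 x, diff n k y (koszul ν P.tensor y) = P.divHam ν x k y :=
    fun k hk => P.eventually_diff_koszul hν hx hxx hk
  have hfg : HolAt n (P.bracket f g) x := P.holAt_bracket hf hg
  rw [P.diff_koszul hν hx hxx hfg, P.bracket_congr (hvf g hg), P.bracket_swap _ g,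
    P.bracket_congr (hvf f hf), ← eval_germ _ hb, ← eb, ← P.germPoisson_ham_germ x hxx hf hg,
    CoordSystem.Poisson.modular_bracket, ef, eg, germPoisson_ham_germ, germPoisson_ham_germ,
    map_sub, eval_germ, eval_germ]
  ring

omit hν

/-- Dividing `h` by its value at `x` brings it near `1`, where the principal branch of the logarithm
is holomorphic; the constant does not affect the bracket. -/
theorem bracket_log {h : M → ℂ} (hh : HolAt n h x) (h0 : h x ≠ 0) :
    ∃ L : M → ℂ, HolAt n L x ∧ ∀ᶠ y in 𝓝 x, ∀ f, P.bracket f L y = (h y)⁻¹ * P.bracket f h y := by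
  have hs : (h x)⁻¹ * h x ∈ Complex.slitPlane := by
    rw [inv_mul_cancel₀ h0]; exact Complex.one_mem_slitPlane
  have ha : ∀ z : ℂ, (h x)⁻¹ * z ∈ Complex.slitPlane →
      AnalyticAt ℂ (fun z => Complex.log ((h x)⁻¹ * z)) z := fun z hz =>
    (analyticAt_const.mul analyticAt_id).clog hz
  refine ⟨fun y => Complex.log ((h x)⁻¹ * h y),
    HolAt.comp_analyticAt (g := fun z => Complex.log ((h x)⁻¹ * z)) (ha _ hs) hh, ?_⟩
  have hc : ContinuousAt (fun y => (h x)⁻¹ * h y) x := continuousAt_const.mul hh.continuousAt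
  filter_upwards [hc.eventually (Complex.isOpen_slitPlane.mem_nhds hs), hh.eventually,
    hh.continuousAt.eventually_ne h0] with y h1 h2 h3 f
  rw [← P.diff_ham, ← P.diff_ham, diff_comp (ha _ h1).differentiableAt h2]
  congr 1
  have h4 : HasDerivAt (fun z => Complex.log ((h x)⁻¹ * z)) _ (h y) :=
    ((hasDerivAt_id (h y)).const_mul (h x)⁻¹).clog h1
  rw [h4.deriv]
  simp only [id]
  field_simp

/-- The Koszul fields of two volume forms differ by a locally hamiltonian field. -/
theorem koszul_sub_koszul {ν' : NForm n M} (hν : IsVolumeFormOn ν V) (hν' : IsVolumeFormOn ν' V)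
    (hx : x ∈ V) : ∃ H : M → ℂ, HolAt n H x ∧
      ∀ᶠ y in 𝓝 x, koszul ν P.tensor y - koszul ν' P.tensor y = P.ham H y := by
  have hxx := mem_chart_source (Model n) x
  have hv := hν.isVolumeAt hx hxx
  have hv' := hν'.isVolumeAt hx hxx
  obtain ⟨L, hL, h1⟩ := P.bracket_log hv.hol hv.ne_zero
  obtain ⟨L', hL', h1'⟩ := P.bracket_log hv'.hol hv'.ne_zero
  -- The divergences of `X_f` differ by `{f, log h - log h'}`, which is `{log h' - log h, f}`.
  refine ⟨L' + -L, hL'.add hL.neg, ?_⟩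
  filter_upwards [h1, h1', V.isOpen.mem_nhds hx, (chartAt (Model n) x).open_source.mem_nhds hxx,
    hL.eventually, hL'.eventually] with y h2 h2' h3 h4 h5 h6
  refine tan_ext h4 fun j => ?_
  rw [map_sub, P.diff_koszul hν h3 h4 (holAt_coordFun h4 j),
    P.diff_koszul hν' h3 h4 (holAt_coordFun h4 j), P.diff_ham, P.bracket_swap, P.bracket_add h6 h5.neg,
    P.bracket_neg, h2, h2', divHam, divHam]
  ring

end PoissonStructure

end Volume

end

end OuterPoisson


/-! ### The Koszul field is locally hamiltonian on the regular set. -/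

namespace OuterPoisson

noncomputable section

namespace PoissonStructure

variable {n : ℕ} {M : Type u} [TopologicalSpace M] [ChartedSpace (Model n) M]
  [IsManifold 𝓘(ℂ, Model n) ω M] (P : PoissonStructure n M) {c x : M}

open holGerms

theorem contract_sum {κ : Type*} (s : Finset κ) (t : κ → ℂ) (α : κ → Cotan n x) :
    contract x (P.tensor x) (∑ k ∈ s, t k • α k) = ∑ k ∈ s, t k • contract x (P.tensor x) (α k) := by
  classical
  have h0 : contract x (P.tensor x) 0 = 0 := contract_unique fun β => by
    rw [contract_apply, bivector_swap, ← zero_smul ℂ (0 : Cotan n x), bivector_smul]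
    simp
  have ha : ∀ α β : Cotan n x, contract x (P.tensor x) (α + β) =
      contract x (P.tensor x) α + contract x (P.tensor x) β := fun α β => contract_unique fun γ => by
    rw [map_add, contract_apply, contract_apply, contract_apply, bivector_swap, bivector_add,
      bivector_swap _ γ, bivector_swap _ γ]
    ring
  have hs : ∀ (a : ℂ) (α : Cotan n x), contract x (P.tensor x) (a • α) =
      a • contract x (P.tensor x) α := fun a α => contract_unique fun γ => by
    rw [map_smul, contract_apply, contract_apply, bivector_swap, bivector_smul,
      bivector_swap _ γ, smul_eq_mul]
    ring
  induction s using Finset.induction_on with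
  | empty => simp [h0]
  | insert a s hk ih => rw [Finset.sum_insert hk, Finset.sum_insert hk, ha, hs, ih]

theorem span_range_contract (hx : x ∈ (chartAt (Model n) c).source) :
    Submodule.span ℂ (Set.range (contract x (P.tensor x))) =
      Submodule.span ℂ (Set.range fun l : Fin n => P.ham (coordFun c l) x) := by
  apply le_antisymm
  · rw [Submodule.span_le]
    rintro _ ⟨α, rfl⟩
    rw [← cotan_eq_sum hx α, P.contract_sum]
    exact Submodule.sum_mem _ fun l _ => Submodule.smul_mem _ _ (Submodule.subset_span ⟨l, rfl⟩)
  · refine Submodule.span_mono ?_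
    rintro _ ⟨l, rfl⟩
    exact ⟨diff n (coordFun c l) x, rfl⟩

/-- The brackets of the coordinate functions `z_l`, `l` in the range of `e`. -/
def bracketMatrix {κ : Type*} (c : M) (e : κ → Fin n) (y : M) : Matrix κ κ ℂ :=
  Matrix.of fun a b => P.bracket (coordFun c (e a)) (coordFun c (e b)) y

variable {κ : Type*} [Fintype κ] [DecidableEq κ] {e : κ → Fin n}

theorem diff_sum_ham (t : κ → ℂ) (y : M) (b : κ) :
    diff n (coordFun c (e b)) y (∑ a, t a • P.ham (coordFun c (e a)) y) =
      Matrix.vecMul t (P.bracketMatrix c e y) b := by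
  rw [map_sum]
  refine Finset.sum_congr rfl fun a _ => ?_
  rw [map_smul, P.diff_ham]
  rfl

/-- With an invertible matrix of brackets, the chosen `dz_b` separate the combinations of the chosen
hamiltonian vectors. -/
theorem eq_zero_of_diff_eq_zero (hdet : (P.bracketMatrix c e x).det ≠ 0) (t : κ → ℂ)
    (h : ∀ b, diff n (coordFun c (e b)) x (∑ a, t a • P.ham (coordFun c (e a)) x) = 0) :
    t = 0 := by
  by_contra ht
  refine hdet (Matrix.exists_vecMul_eq_zero_iff.1 ⟨t, ht, ?_⟩)
  funext b
  rw [← P.diff_sum_ham, h b]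
  rfl

/-- A skew matrix is invertible on a set of rows that is a basis of its row space. -/
theorem det_bracketMatrix_ne_zero (hx : x ∈ (chartAt (Model n) c).source)
    (hli : LinearIndependent ℂ fun a => P.ham (coordFun c (e a)) x)
    (hspan : Submodule.span ℂ (Set.range fun l : Fin n => P.ham (coordFun c l) x) ≤
      Submodule.span ℂ (Set.range fun a => P.ham (coordFun c (e a)) x)) :
    (P.bracketMatrix c e x).det ≠ 0 := by
  intro h0
  obtain ⟨t, ht, htA⟩ := Matrix.exists_vecMul_eq_zero_iff.2 h0
  refine ht ?_
  have h1 : ∑ a, t a • P.ham (coordFun c (e a)) x = 0 := by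
    -- The contraction of `α` is killed by the chosen differentials. By skewness `α` kills the
    -- chosen hamiltonian vectors, hence all of them, and by skewness again its contraction is zero.
    set α : Cotan n x := ∑ a, t a • diff n (coordFun c (e a)) x with hα
    have h2 : ∑ a, t a • P.ham (coordFun c (e a)) x = contract x (P.tensor x) α := by
      rw [hα, P.contract_sum]
      rfl
    have h3 : ∀ f : M → ℂ, diff n f x (contract x (P.tensor x) α) = -α (P.ham f x) := by
      intro f
      rw [contract_apply, bivector_swap, ham, contract_apply]
    have h4 : ∀ v ∈ Submodule.span ℂ (Set.range fun a => P.ham (coordFun c (e a)) x), α v = 0 := by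
      intro v hv
      have h5 : Submodule.span ℂ (Set.range fun a => P.ham (coordFun c (e a)) x) ≤
          LinearMap.ker (α : Tan n x →ₗ[ℂ] ℂ) := by
        rw [Submodule.span_le]
        rintro _ ⟨b, rfl⟩
        have h6 := P.diff_sum_ham (c := c) (e := e) t x b
        rw [htA, h2, h3] at h6
        exact neg_eq_zero.1 h6
      exact h5 hv
    rw [h2]
    refine tan_ext hx fun l => ?_
    rw [h3, map_zero, h4 _ (hspan (Submodule.subset_span ⟨l, rfl⟩)), neg_zero]
  exact funext (Fintype.linearIndependent_iff.1 hli t h1)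

/-- Dimension count: the chosen vectors are independent and as many as the rank. Both hypotheses
persist at points near a regular point. -/
theorem ham_mem_span_of_rank_eq (hx : x ∈ (chartAt (Model n) c).source)
    (hdet : (P.bracketMatrix c e x).det ≠ 0) (hrank : P.rank x = Fintype.card κ) (l : Fin n) :
    P.ham (coordFun c l) x ∈ Submodule.span ℂ (Set.range fun a => P.ham (coordFun c (e a)) x) := by
  have hli : LinearIndependent ℂ fun a => P.ham (coordFun c (e a)) x := by
    rw [Fintype.linearIndependent_iff]
    intro t ht
    have h1 := P.eq_zero_of_diff_eq_zero hdet t fun b => by rw [ht, map_zero]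
    exact fun a => congrFun h1 a
  have hle : Submodule.span ℂ (Set.range fun a => P.ham (coordFun c (e a)) x) ≤
      Submodule.span ℂ (Set.range fun l : Fin n => P.ham (coordFun c l) x) := by
    refine Submodule.span_mono ?_
    rintro _ ⟨a, rfl⟩
    exact ⟨e a, rfl⟩
  rw [rank, P.span_range_contract hx] at hrank
  have : FiniteDimensional ℂ (Submodule.span ℂ (Set.range fun l : Fin n => P.ham (coordFun c l) x)) :=
    FiniteDimensional.span_of_finite ℂ (Set.finite_range _)
  have h2 := Submodule.eq_of_le_of_finrank_le hle (by
    rw [hrank, finrank_span_eq_card hli])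
  rw [h2]
  exact Submodule.subset_span ⟨l, rfl⟩

/-- At a regular point the germ of the Poisson bracket has a regular frame of coordinate functions. -/
theorem exists_regularFrame (hx : x ∈ P.regularSet) (hc : x ∈ (chartAt (Model n) c).source) :
    ∃ (κ : Type) (_ : Fintype κ) (_ : DecidableEq κ) (e : κ → Fin n)
      (F : (P.germPoisson c hc).RegularFrame (κ := κ)),
      ∀ a, F.w a = (coordSystem c hc).z (e a) := by
  classical
  obtain ⟨κ, e, he, hspan, hli⟩ := exists_linearIndependent' ℂ fun l : Fin n => P.ham (coordFun c l) x
  have : Fintype κ := Fintype.ofInjective e he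
  have hli' : LinearIndependent ℂ fun a => P.ham (coordFun c (e a)) x := hli
  have hdet := P.det_bracketMatrix_ne_zero (e := e) hc hli' hspan.ge
  have hrank : P.rank x = Fintype.card κ := by
    rw [rank, P.span_range_contract hc, ← hspan]
    exact finrank_span_eq_card hli'
  let w : κ → holGerms n x := fun a => (coordSystem c hc).z (e a)
  let Q := P.germPoisson c hc
  have hQ : ∀ {f g : M → ℂ} (hf : HolAt n f x) (hg : HolAt n g x),
      Q.ham (germ f hf) (germ g hg) = germ (P.bracket f g) (P.holAt_bracket hf hg) :=
    fun hf hg => P.germPoisson_ham_germ c hc hf hg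
  have hz : ∀ l : Fin n, HolAt n (coordFun c l) x := fun l => holAt_coordFun hc l
  let G : Matrix κ κ (holGerms n x) := Matrix.of fun a b => Q.ham (w a) (w b)
  obtain ⟨hd, hG⟩ := germ_det (fun (a b : κ) y => P.bracket (coordFun c (e a)) (coordFun c (e b)) y)
    fun a b => P.holAt_bracket (hz (e a)) (hz (e b))
  have hG' : G.det = germ _ hd := by
    rw [← hG]
    congr 1
    exact Matrix.ext fun a b => hQ (hz (e a)) (hz (e b))
  have hunit : IsUnit G.det := by
    rw [isUnit_iff, hG', eval_germ]
    exact hdet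
  have hdet' : ∀ᶠ y in 𝓝 x, (P.bracketMatrix c e y).det ≠ 0 := hd.continuousAt.eventually_ne hdet
  -- The only candidates for the coefficients of `X_{z_l}`: they are forced by the brackets with the
  -- `w_b`.
  let coef : Fin n → κ → holGerms n x := fun l a =>
    ∑ k, Q.ham ((coordSystem c hc).z l) (w k) * G⁻¹ k a
  have hcoef : ∀ l b, ∑ a, coef l a * Q.ham (w a) (w b) = Q.ham ((coordSystem c hc).z l) (w b) := by
    intro l b
    have h1 : ∀ a, coef l a * Q.ham (w a) (w b) =
        ∑ k, Q.ham ((coordSystem c hc).z l) (w k) * (G⁻¹ k a * G a b) := by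
      intro a
      rw [Finset.sum_mul]
      exact Finset.sum_congr rfl fun k _ => mul_assoc _ _ _
    simp only [h1]
    rw [Finset.sum_comm]
    simp only [← Finset.mul_sum, ← Matrix.mul_apply, Matrix.nonsing_inv_mul _ hunit, Matrix.one_apply]
    simp
  have hsum : ∀ (l : Fin n) (g : M → ℂ) (hg : HolAt n g x),
      ∃ h : HolAt n (fun y => ∑ a, (rep (coef l a) * P.bracket (coordFun c (e a)) g) y) x,
      ∑ a, coef l a * Q.ham (w a) (germ g hg) = germ _ h := by
    intro l g hg
    have h1 : ∀ a, HolAt n (rep (coef l a) * P.bracket (coordFun c (e a)) g) x := fun a =>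
      (holAt_rep _).mul (P.holAt_bracket (hz (e a)) hg)
    refine ⟨HolAt.sum h1, ?_⟩
    rw [← germ_sum _ _ h1]
    refine Finset.sum_congr rfl fun a _ => ?_
    rw [← germ_mul (holAt_rep _) (P.holAt_bracket (hz (e a)) hg), germ_rep, ← hQ (hz (e a)) hg]
    rfl
  have hhamz : ∀ l m, Q.ham ((coordSystem c hc).z l) ((coordSystem c hc).z m) =
      ∑ a, coef l a * Q.ham (w a) ((coordSystem c hc).z m) := by
    intro l m
    have h1 : ∀ᶠ y in 𝓝 x, ∀ b : κ, ∑ a, (rep (coef l a) * P.bracket (coordFun c (e a))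
        (coordFun c (e b))) y = P.bracket (coordFun c l) (coordFun c (e b)) y := by
      refine Filter.eventually_all.2 fun b => ?_
      obtain ⟨h2, h3⟩ := hsum l _ (hz (e b))
      rw [← germ_eq_germ (hf := h2) (hg := P.holAt_bracket (hz l) (hz (e b))), ← h3, ← hQ (hz l) (hz (e b))]
      exact hcoef l b
    obtain ⟨h2, h3⟩ := hsum l _ (hz m)
    change Q.ham (germ _ (hz l)) (germ _ (hz m)) = ∑ a, coef l a * Q.ham (w a) (germ _ (hz m))
    rw [h3, hQ, germ_eq_germ]
    -- At each nearby point constancy of the rank gives some coefficients `t`. Since `t` is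
    -- determined by the brackets with the `w_b`, it equals the value of the holomorphic
    -- coefficients, whose identity thereby extends to all coordinates `z_m`.
    filter_upwards [h1, hdet', hx, (chartAt (Model n) c).open_source.mem_nhds hc] with y h4 h5 h6 h7
    have h8 : ∀ m : Fin n, ∑ a, (rep (coef l a) * P.bracket (coordFun c (e a)) (coordFun c m)) y =
        diff n (coordFun c m) y (∑ a, rep (coef l a) y • P.ham (coordFun c (e a)) y) := by
      intro m
      rw [map_sum]
      refine Finset.sum_congr rfl fun a _ => ?_
      rw [map_smul, P.diff_ham]
      rfl
    obtain ⟨t, ht⟩ := (Submodule.mem_span_range_iff_exists_fun ℂ).1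
      (P.ham_mem_span_of_rank_eq h7 h5 (h6.trans hrank) l)
    have h9 : t - (fun a => rep (coef l a) y) = 0 := by
      refine P.eq_zero_of_diff_eq_zero h5 _ fun b => ?_
      have h10 := h4 b
      rw [h8, ← P.diff_ham, ← ht] at h10
      simp only [Pi.sub_apply, sub_smul, Finset.sum_sub_distrib, map_sub, h10, sub_self]
    have h11 : t = fun a => rep (coef l a) y := sub_eq_zero.1 h9
    rw [h8, ← P.diff_ham, ← ht, h11]
  have hham : ∀ l, Q.ham ((coordSystem c hc).z l) = ∑ a, coef l a • Q.ham (w a) := by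
    intro l
    have hF : (coordSystem c hc).IsField (∑ a, coef l a • Q.ham (w a)) :=
      CoordSystem.IsField.sum fun a => (Q.isField _).smul _
    ext1 g
    rw [Q.isField _ g, hF g]
    refine Finset.sum_congr rfl fun m _ => ?_
    rw [hhamz, CoordSystem.derivation_sum_apply]
    rfl
  refine ⟨κ, inferInstance, inferInstance, e,
    { w := w
      inv := G⁻¹
      inv_mul := Matrix.nonsing_inv_mul _ hunit
      coeff := fun f a => ∑ l, (coordSystem c hc).d l f * coef l a
      ham_eq := fun f => ?_ }, fun a => rfl⟩
  rw [Q.ham_eq_sum f]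
  simp only [hham, Finset.smul_sum, Finset.sum_smul, smul_smul]
  rw [Finset.sum_comm]

/-- On the regular set the Koszul field of a volume form is locally hamiltonian. -/
theorem koszul_isHam_of_regular {ν : NForm n M} {V : Opens M} (hν : IsVolumeFormOn ν V)
    (hx : x ∈ V) (hr : x ∈ P.regularSet) : ∃ H : M → ℂ, HolAt n H x ∧
      ∀ᶠ y in 𝓝 x, koszul ν P.tensor y = P.ham H y := by
  have hc := mem_chart_source (Model n) x
  have hv := hν.isVolumeAt hx hc
  obtain ⟨κ, _, _, e, F, hF⟩ := P.exists_regularFrame hr hc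
  obtain ⟨H, hH⟩ := exists_common_primitive F.isField_Y e
    (fun a b => by rw [← hF, F.Y_w]) F.Y_comm
    (F.Y_leafForm (unit _ hv.hol hv.ne_zero) add_self_eq_zero)
  refine ⟨rep H, holAt_rep H, ?_⟩
  have h1 : ∀ᶠ y in 𝓝 x, ∀ j : Fin n, diff n (coordFun x j) y (koszul ν P.tensor y) =
      diff n (coordFun x j) y (P.ham (rep H) y) := by
    refine Filter.eventually_all.2 fun j => ?_
    obtain ⟨h2, h3⟩ := P.modular_germ hv (holAt_coordFun hc j)
    have h4 := F.ham_eq_modular (unit _ hv.hol hv.ne_zero) add_self_eq_zero hH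
      ((coordSystem x hc).z j)
    have h5 := P.germPoisson_ham_germ x hc (holAt_rep H) (holAt_coordFun hc j)
    rw [germ_rep] at h5
    have h6 := germ_eq_germ.1 (h3.symm.trans (h4.symm.trans h5))
    filter_upwards [P.eventually_diff_koszul hν hx hc (holAt_coordFun hc j), h6] with y h7 h8
    rw [h7, h8, P.diff_ham]
  filter_upwards [h1, (chartAt (Model n) x).open_source.mem_nhds hc] with y h2 h3
  exact tan_ext h3 h2

end PoissonStructure

end

end OuterPoisson


/-! ### Sections of sheaves of abelian groups. -/

namespace OuterPoisson

noncomputable section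

section SheafSections

variable {M : Type u} [TopologicalSpace M]

theorem restrictSec_restrictSec (F : AbSheaf M) {V W W' : Opens M} (h : W ≤ V) (h' : W' ≤ W)
    (s : Sec F V) : restrictSec F h' (restrictSec F h s) = restrictSec F (h'.trans h) s := by
  change (F.obj.map _ ≫ F.obj.map _).hom s = _
  rw [← F.obj.map_comp]
  rfl

theorem mapSec_restrictSec {F G : AbSheaf M} (φ : F ⟶ G) {V W : Opens M} (h : W ≤ V) (s : Sec F V) :
    mapSec φ W (restrictSec F h s) = restrictSec G h (mapSec φ V s) := by
  change (F.obj.map _ ≫ φ.hom.app _).hom s = _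
  rw [φ.hom.naturality]
  rfl

theorem mapSec_comp {F G H : AbSheaf M} (φ : F ⟶ G) (ψ : G ⟶ H) (V : Opens M) (s : Sec F V) :
    mapSec (φ ≫ ψ) V s = mapSec ψ V (mapSec φ V s) := rfl

theorem mapSec_id (F : AbSheaf M) (V : Opens M) (s : Sec F V) : mapSec (𝟙 F) V s = s := rfl

theorem mapSec_zero (F G : AbSheaf M) (V : Opens M) (s : Sec F V) :
    mapSec (0 : F ⟶ G) V s = 0 := rfl

theorem mapSec_bijective {F G : AbSheaf M} (φ : F ⟶ G) [IsIso φ] (V : Opens M) :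
    Function.Bijective (mapSec φ V) := by
  refine Function.bijective_iff_has_inverse.2 ⟨mapSec (inv φ) V, fun s => ?_, fun s => ?_⟩
  · rw [← mapSec_comp, IsIso.hom_inv_id, mapSec_id]
  · rw [← mapSec_comp, IsIso.inv_hom_id, mapSec_id]

theorem sec_ext (F : AbSheaf M) {ι : Type u} {V : Opens M} (U : ι → Opens M) (hU : ∀ i, U i ≤ V)
    (hV : V ≤ iSup U) {s t : Sec F V}
    (h : ∀ i, restrictSec F (hU i) s = restrictSec F (hU i) t) : s = t :=
  TopCat.Sheaf.eq_of_locally_eq' (X := TopCat.of M) F U V (fun i => homOfLE (hU i)) hV s t h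

theorem exists_sec_glue (F : AbSheaf M) {ι : Type u} {V : Opens M} (U : ι → Opens M)
    (hU : ∀ i, U i ≤ V) (hV : V ≤ iSup U) (s : ∀ i, Sec F (U i))
    (h : ∀ i j, restrictSec F (inf_le_left : U i ⊓ U j ≤ U i) (s i) =
      restrictSec F (inf_le_right : U i ⊓ U j ≤ U j) (s j)) :
    ∃ t : Sec F V, ∀ i, restrictSec F (hU i) t = s i :=
  (TopCat.Sheaf.existsUnique_gluing' (X := TopCat.of M) F U V (fun i => homOfLE (hU i)) hV s h).exists

namespace GermCondition

variable {T : M → Type} [∀ x, AddCommGroup (T x)] {T' : M → Type} [∀ x, AddCommGroup (T' x)]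

/-- The restriction to `W` of a globally defined section that satisfies the condition on `W`. -/
def sectionOf (P : GermCondition T) {W : Opens M} (s : ∀ x, T x) (h : ∀ x ∈ W, s ∈ P.germs x) :
    P.sections W :=
  ⟨fun x => s x, fun x hx => P.congr (by
    filter_upwards [W.isOpen.mem_nhds hx] with y hy
    rw [extendZero_apply _ (show y ∈ W from hy)]) (h x hx)⟩

end GermCondition

end SheafSections

/-! ### The isomorphism from functions modulo Casimirs to `Ham`, and the outer vector field. -/

namespace PoissonStructure

variable {n : ℕ} {M : Type u} [TopologicalSpace M] [ChartedSpace (Model n) M]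
  [IsManifold 𝓘(ℂ, Model n) ω M] (P : PoissonStructure n M)

theorem hamToDer_apply {V : Opens M} (w : P.hamiltonianFields.sections V) (x : V) :
    (show P.poissonFields.sections V from mapSec P.hamToDer V w).1 x = w.1 x :=
  extendZero_apply w.1 x.2

theorem casimirToFunction_apply {V : Opens M} (f : P.casimirs.sections V) (x : V) :
    (show (holomorphicFunctions n M).sections V from mapSec P.casimirToFunction V f).1 x = f.1 x :=
  extendZero_apply (T := fun _ : M => ℂ) f.1 x.2

/-- Local surjectivity is the definition of a locally hamiltonian field. -/
instance epi_functionToHam : Epi P.functionToHam := by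
  have : Sheaf.IsLocallySurjective P.functionToHam := by
    refine ⟨fun {V} s => ?_⟩
    intro x hx
    let s' : P.hamiltonianFields.sections V := s
    obtain ⟨H, hH, hs⟩ := s'.2 x hx
    obtain ⟨N, hN, hNo, hxN⟩ := eventually_nhds_iff.1 (hs.and (hH.eventually.and
      (V.isOpen.mem_nhds hx)))
    let W : Opens M := ⟨N, hNo⟩
    have hWV : W ≤ V := fun y hy => (hN y hy).2.2
    refine ⟨W, homOfLE hWV, ⟨(holomorphicFunctions n M).sectionOf H fun y hy => (hN y hy).2.1, ?_⟩, hxN⟩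
    apply Subtype.ext
    funext y
    have h1 : s'.1 ⟨y, hWV y.2⟩ = P.ham H y := by
      rw [← extendZero_apply s'.1 (hWV y.2)]
      exact (hN y y.2).1
    refine Eq.trans ?_ h1.symm
    refine P.ham_congr ?_
    filter_upwards [W.isOpen.mem_nhds y.2] with z hz
    rw [extendZero_apply _ (show z ∈ W from hz)]
    rfl
  exact Sheaf.epi_of_isLocallySurjective _

theorem mapSec_casimirToFunction_injective (V : Opens M) :
    Function.Injective (mapSec P.casimirToFunction V) := by
  intro f g hfg
  apply Subtype.ext
  funext x
  have h := congrArg (fun k : (holomorphicFunctions n M).sections V => k.1 x) hfg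
  exact (P.casimirToFunction_apply f x).symm.trans (h.trans (P.casimirToFunction_apply g x))

theorem exists_casimir {V : Opens M} (f : Sec (functionSheaf n M) V)
    (hf : mapSec P.functionToHam V f = 0) : ∃ g, mapSec P.casimirToFunction V g = f := by
  let f' : (holomorphicFunctions n M).sections V := f
  have h1 : ∀ x ∈ V, P.ham (extendZero f'.1) x = 0 := fun x hx =>
    congrArg (fun k : P.hamiltonianFields.sections V => k.1 ⟨x, hx⟩) hf
  refine ⟨(⟨f'.1, fun x hx => ⟨f'.2 x hx, ?_⟩⟩ : P.casimirs.sections V), ?_⟩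
  · filter_upwards [V.isOpen.mem_nhds hx] with y hy using h1 y hy
  · apply Subtype.ext
    funext x
    exact P.casimirToFunction_apply _ x

theorem exists_casimir_of_comp_eq_zero {F : AbSheaf M} {k : F ⟶ functionSheaf n M}
    (hk : k ≫ P.functionToHam = 0) (V : Opens M) (t : Sec F V) :
    ∃ g, mapSec P.casimirToFunction V g = mapSec k V t :=
  P.exists_casimir (mapSec k V t) (by rw [← mapSec_comp, hk, mapSec_zero])

/-- The lift to the Casimir functions of a section whose image in the functions is killed by
`H ↦ X_H`. -/
def casimirPreimage {F : AbSheaf M} {k : F ⟶ functionSheaf n M} (hk : k ≫ P.functionToHam = 0)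
    (V : Opens M) (t : Sec F V) : Sec P.casimirSheaf V :=
  (P.exists_casimir_of_comp_eq_zero hk V t).choose

theorem mapSec_casimirPreimage {F : AbSheaf M} {k : F ⟶ functionSheaf n M}
    (hk : k ≫ P.functionToHam = 0) (V : Opens M) (t : Sec F V) :
    mapSec P.casimirToFunction V (P.casimirPreimage hk V t) = mapSec k V t :=
  (P.exists_casimir_of_comp_eq_zero hk V t).choose_spec

theorem casimirPreimage_add {F : AbSheaf M} {k : F ⟶ functionSheaf n M}
    (hk : k ≫ P.functionToHam = 0) (V : Opens M) (s t : Sec F V) :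
    P.casimirPreimage hk V (s + t) = P.casimirPreimage hk V s + P.casimirPreimage hk V t :=
  P.mapSec_casimirToFunction_injective V (by
    rw [map_add (mapSec P.casimirToFunction V), mapSec_casimirPreimage, mapSec_casimirPreimage,
      mapSec_casimirPreimage, map_add])

theorem casimirPreimage_restrictSec {F : AbSheaf M} {k : F ⟶ functionSheaf n M}
    (hk : k ≫ P.functionToHam = 0) {V W : Opens M} (h : W ≤ V) (t : Sec F V) :
    P.casimirPreimage hk W (restrictSec F h t) =
      restrictSec P.casimirSheaf h (P.casimirPreimage hk V t) :=
  P.mapSec_casimirToFunction_injective W (by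
    rw [mapSec_casimirPreimage, mapSec_restrictSec, mapSec_restrictSec, mapSec_casimirPreimage])

/-- The lift to the Casimir functions of a homomorphism to the functions that is killed by
`H ↦ X_H`. -/
def liftCasimir {F : AbSheaf M} (k : F ⟶ functionSheaf n M) (hk : k ≫ P.functionToHam = 0) :
    F ⟶ P.casimirSheaf := ⟨
  { app := fun W => AddCommGrpCat.ofHom
      (AddMonoidHom.mk' (P.casimirPreimage hk W.unop) (P.casimirPreimage_add hk W.unop))
    naturality := fun V W i => by
      ext t
      exact P.casimirPreimage_restrictSec hk i.unop.le t }⟩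

theorem liftCasimir_comp {F : AbSheaf M} (k : F ⟶ functionSheaf n M) (hk : k ≫ P.functionToHam = 0) :
    P.liftCasimir k hk ≫ P.casimirToFunction = k := by
  ext W t
  exact P.mapSec_casimirPreimage hk W.unop t

instance mono_casimirToFunction : Mono P.casimirToFunction := ⟨fun {F} a b h => by
  ext W t
  apply P.mapSec_casimirToFunction_injective W.unop
  exact congrArg (fun k => mapSec k W.unop t) h⟩

/-- `O_M / C_M → Ham` is an isomorphism. -/
instance isIso_hamiltonianMap : IsIso P.hamiltonianMap := by
  let S : ShortComplex (AbSheaf M) := ShortComplex.mk _ _ P.casimir_functionToHam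
  -- Casimir functions are the kernel of `H ↦ X_H`; exactness at `O_M` is equivalent to injectivity
  -- of the map induced on the cokernel.
  have hS : S.Exact := ShortComplex.exact_of_f_is_kernel S
    (KernelFork.IsLimit.ofι' _ _ fun k hk => ⟨P.liftCasimir k hk, P.liftCasimir_comp k hk⟩)
  have : Mono P.hamiltonianMap := S.exact_iff_mono_cokernel_desc.1 hS
  have : Epi P.hamiltonianMap := by
    have h : cokernel.π P.casimirToFunction ≫ P.hamiltonianMap = P.functionToHam :=
      cokernel.π_desc _ _ _
    have : Epi (cokernel.π P.casimirToFunction ≫ P.hamiltonianMap) := by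
      rw [h]; infer_instance
    exact epi_of_epi (cokernel.π P.casimirToFunction) _
  exact isIso_of_mono_of_epi _

/-- No gluing of local hamiltonians is needed: a section of `Ham` is the field itself, subject to a
condition on germs. -/
theorem exists_hamToDer_eq {V : Opens M} (v : Sec P.derSheaf V) (X : ∀ x : M, Tan n x)
    (hv : ∀ x : V, (show P.poissonFields.sections V from v).1 x = X x)
    (hX : ∀ x ∈ V, ∃ H : M → ℂ, HolAt n H x ∧ ∀ᶠ y in 𝓝 x, X y = P.ham H y) :
    ∃ w : Sec P.hamSheaf V, mapSec P.hamToDer V w = v := by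
  refine ⟨P.hamiltonianFields.sectionOf X hX, ?_⟩
  apply Subtype.ext
  funext x
  exact (P.hamToDer_apply _ x).trans (hv x).symm

theorem derToOuter_hamToDer {V : Opens M} (w : Sec P.hamSheaf V) :
    mapSec P.derToOuter V (mapSec P.hamToDer V w) = 0 := by
  have h : P.hamToDer ≫ P.derToOuter = 0 := cokernel.condition _
  rw [← mapSec_comp, h, mapSec_zero]

variable {P} {ν ν' : NForm n M} {V W : Opens M}

theorem _root_.OuterPoisson.IsVolumeFormOn.mono (hν : IsVolumeFormOn ν V) (h : W ≤ V) :
    IsVolumeFormOn ν W := fun x hx => hν x (h hx)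

theorem IsKoszulField.restrict {v : Sec P.derSheaf V} (hv : P.IsKoszulField ν v) (h : W ≤ V) :
    P.IsKoszulField ν (restrictSec P.derSheaf h v) := fun x => hv ⟨x, h x.2⟩

theorem IsKoszulField.unique {v w : Sec P.derSheaf V} (hv : P.IsKoszulField ν v)
    (hw : P.IsKoszulField ν w) : v = w :=
  Subtype.ext (funext fun x => (hv x).trans (hw x).symm)

variable (P) in
theorem exists_isKoszulField (hν : IsVolumeFormOn ν V) :
    ∃ v : Sec P.derSheaf V, P.IsKoszulField ν v :=
  ⟨P.poissonFields.sectionOf (koszul ν P.tensor) fun x hx => ⟨P.holVFAt_koszul hν hx, by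
    filter_upwards [V.isOpen.mem_nhds hx] with y hy using P.isPoissonAt_koszul hν hy⟩, fun _ => rfl⟩

theorem IsKoszulField.exists_hamToDer {v : Sec P.derSheaf V} (hv : P.IsKoszulField ν v)
    (hν : IsVolumeFormOn ν V) (hV : V ≤ P.regularSet) :
    ∃ w : Sec P.hamSheaf V, mapSec P.hamToDer V w = v :=
  P.exists_hamToDer_eq v _ hv fun _ hx => P.koszul_isHam_of_regular hν hx (hV hx)

theorem IsKoszulField.outer_eq {v v' : Sec P.derSheaf V} (hv : P.IsKoszulField ν v)
    (hv' : P.IsKoszulField ν' v') (hν : IsVolumeFormOn ν V) (hν' : IsVolumeFormOn ν' V) :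
    mapSec P.derToOuter V v = mapSec P.derToOuter V v' := by
  obtain ⟨w, hw⟩ := P.exists_hamToDer_eq (v - v')
    (fun y => koszul ν P.tensor y - koszul ν' P.tensor y)
    (fun x => congrArg₂ (fun a b : Tan n x.1 => a - b) (hv x) (hv' x))
    fun x hx => P.koszul_sub_koszul hν hν' hx
  rw [← sub_eq_zero, ← map_sub, ← hw, derToOuter_hamToDer]

theorem le_iSup_chartDomain (V : Opens M) : V ≤ iSup fun c : M => V ⊓ chartDomain n c :=
  fun x hx => Opens.mem_iSup.2 ⟨x, hx, mem_chart_source (Model n) x⟩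

variable (P) in
/-- The outer vector field exists and is unique. -/
theorem existsUnique_outerField : ∃! ξ : Sec P.outerSheaf ⊤, P.IsOuterField ξ := by
  -- Every chart domain carries `dz_1 ∧ ⋯ ∧ dz_n`, so chart domains suffice for gluing, and also for
  -- testing uniqueness.
  choose v hv using fun c : M => P.exists_isKoszulField (isVolumeFormOn_chartForm (n := n) c)
  have hcov : (⊤ : Opens M) ≤ iSup fun c : M => chartDomain n c :=
    fun x _ => Opens.mem_iSup.2 ⟨x, mem_chart_source (Model n) x⟩
  obtain ⟨ξ, hξ⟩ := exists_sec_glue P.outerSheaf (fun c : M => chartDomain n c) (fun _ => le_top) hcov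
    (fun c => mapSec P.derToOuter _ (v c)) (fun c c' => by
      rw [← mapSec_restrictSec, ← mapSec_restrictSec]
      exact ((hv c).restrict inf_le_left).outer_eq ((hv c').restrict inf_le_right)
        ((isVolumeFormOn_chartForm c).mono inf_le_left)
        ((isVolumeFormOn_chartForm c').mono inf_le_right))
  refine ⟨ξ, fun V ν hν => ?_, fun ξ' hξ' => ?_⟩
  · obtain ⟨w, hw⟩ := P.exists_isKoszulField hν
    refine ⟨w, hw, sec_ext P.outerSheaf (fun c : M => V ⊓ chartDomain n c) (fun _ => inf_le_left)
      (le_iSup_chartDomain V) fun c => ?_⟩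
    rw [restrictSec_restrictSec, ← mapSec_restrictSec]
    rw [← restrictSec_restrictSec P.outerSheaf (le_top : chartDomain n c ≤ ⊤) inf_le_right, hξ,
      ← mapSec_restrictSec]
    exact ((hv c).restrict inf_le_right).outer_eq (hw.restrict inf_le_left)
      ((isVolumeFormOn_chartForm c).mono inf_le_right) (hν.mono inf_le_left)
  · refine sec_ext P.outerSheaf (fun c : M => chartDomain n c) (fun _ => le_top) hcov fun c => ?_
    obtain ⟨w, hw, h⟩ := hξ' _ _ (isVolumeFormOn_chartForm c)
    rw [h, hξ, hw.unique (hv c)]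

theorem IsOuterField.restrict_eq_zero {ξ : Sec P.outerSheaf ⊤} (hξ : P.IsOuterField ξ) :
    restrictSec P.outerSheaf (le_top : P.regularSet ≤ ⊤) ξ = 0 := by
  refine sec_ext P.outerSheaf (fun c : M => P.regularSet ⊓ chartDomain n c) (fun _ => inf_le_left)
    (le_iSup_chartDomain _) fun c => ?_
  obtain ⟨v, hv, h⟩ := hξ _ _ ((isVolumeFormOn_chartForm c).mono
    (inf_le_right : P.regularSet ⊓ chartDomain n c ≤ _))
  obtain ⟨w, hw⟩ := hv.exists_hamToDer ((isVolumeFormOn_chartForm c).mono inf_le_right) inf_le_left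
  rw [restrictSec_restrictSec, h, map_zero, ← hw, derToOuter_hamToDer]

end PoissonStructure

end

end OuterPoisson

/-! ### Cohomology with supports through `Ext`. -/

namespace OuterPoisson

noncomputable section

variable {M : Type u} [TopologicalSpace M]

theorem homEquivSec_comp {F G : AbSheaf M} {V : Opens M} (φ : freeSheaf V ⟶ F) (ψ : F ⟶ G) :
    homEquivSec G V (φ ≫ ψ) = mapSec ψ V (homEquivSec F V φ) := by
  let A := sheafificationAdjunction (Opens.grothendieckTopology M) AddCommGrpCat.{u}
  let B := AddCommGrpCat.adj.{u}.whiskerRight (Opens M)ᵒᵖ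
  let Y := (yoneda ⋙ (Functor.whiskeringRight _ _ _).obj AddCommGrpCat.free.{u}).obj V
  have hA : A.homEquiv Y G (φ ≫ ψ) = A.homEquiv Y F φ ≫ ψ.hom :=
    A.homEquiv_naturality_right φ ψ
  have hB : B.homEquiv (yoneda.obj V) G.obj (A.homEquiv Y F φ ≫ ψ.hom) = _ :=
    B.homEquiv_naturality_right (A.homEquiv Y F φ) ψ.hom
  exact congrArg yonedaEquiv ((congrArg (B.homEquiv (yoneda.obj V) G.obj) hA).trans hB)

theorem homEquivSec_map_comp (F : AbSheaf M) {V W : Opens M} (h : W ≤ V) (φ : freeSheaf V ⟶ F) :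
    homEquivSec F W ((freeSheafFunctor M).map (homOfLE h) ≫ φ) =
      restrictSec F h (homEquivSec F V φ) := by
  let A := sheafificationAdjunction (Opens.grothendieckTopology M) AddCommGrpCat.{u}
  let B := AddCommGrpCat.adj.{u}.whiskerRight (Opens M)ᵒᵖ
  let Y := yoneda ⋙ (Functor.whiskeringRight (Opens M)ᵒᵖ _ _).obj AddCommGrpCat.free.{u}
  have hA : A.homEquiv (Y.obj W) F ((freeSheafFunctor M).map (homOfLE h) ≫ φ) =
      Y.map (homOfLE h) ≫ A.homEquiv (Y.obj V) F φ :=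
    A.homEquiv_naturality_left (Y.map (homOfLE h)) φ
  have hB : B.homEquiv (yoneda.obj W) F.obj (Y.map (homOfLE h) ≫ A.homEquiv (Y.obj V) F φ) =
      yoneda.map (homOfLE h) ≫ B.homEquiv (yoneda.obj V) F.obj (A.homEquiv (Y.obj V) F φ) :=
    B.homEquiv_naturality_left (yoneda.map (homOfLE h)) (A.homEquiv (Y.obj V) F φ)
  exact (congrArg yonedaEquiv ((congrArg (B.homEquiv (yoneda.obj W) F.obj) hA).trans hB)).trans
    (yonedaEquiv_naturality _ _).symm

theorem homEquivSec_zero (F : AbSheaf M) (V : Opens M) :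
    homEquivSec F V (0 : freeSheaf V ⟶ F) = 0 := by
  have h := homEquivSec_comp (𝟙 (freeSheaf V)) (0 : freeSheaf V ⟶ F)
  rwa [comp_zero, mapSec_zero] at h

namespace LocalCohomology

variable {V W : Opens M} (h : W ≤ V)

theorem forget_mk₀ {F : AbSheaf M} (a : relSheaf h ⟶ F) :
    forget h F (Abelian.Ext.mk₀ a) = homEquivSec F V (cokernel.π _ ≫ a) := by
  have e : (Abelian.Ext.mk₀ (pairSequence h).g).comp (Abelian.Ext.mk₀ a) (zero_add 0) =
      Abelian.Ext.mk₀ (cokernel.π ((freeSheafFunctor M).map (homOfLE h)) ≫ a) :=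
    Abelian.Ext.mk₀_comp_mk₀ _ _
  exact congrArg (homEquivSec F V)
    ((congrArg Abelian.Ext.homEquiv₀ e).trans (Abelian.Ext.homEquiv₀.apply_symm_apply _))

/-- A section over `V` is a morphism from `ℤ_V`; it vanishes on `W` exactly when it factors, then
uniquely, through `ℤ_V / ℤ_W`. -/
theorem existsUnique_forget {F : AbSheaf M} (s : Sec F V) (hs : restrictSec F h s = 0) :
    ∃! x : LocalCohomology h F 0, forget h F x = s := by
  have hz : (freeSheafFunctor M).map (homOfLE h) ≫ (homEquivSec F V).symm s = 0 := by
    apply (homEquivSec F W).injective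
    rw [homEquivSec_map_comp, Equiv.apply_symm_apply, hs, homEquivSec_zero]
  refine ⟨Abelian.Ext.mk₀ (cokernel.desc _ _ hz), ?_, fun y hy => ?_⟩
  · change forget h F _ = s
    rw [forget_mk₀, cokernel.π_desc, Equiv.apply_symm_apply]
  · obtain ⟨a, rfl⟩ := (Abelian.Ext.mk₀_bijective _ _).2 y
    congr 1
    rw [← cancel_epi (cokernel.π ((freeSheafFunctor M).map (homOfLE h))), cokernel.π_desc,
      Equiv.eq_symm_apply, ← forget_mk₀]
    exact hy

/-- If `x` comes from a section `v` of the middle sheaf, whose restriction to `W` comes from a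
section `w` of the left sheaf, then the connecting homomorphism sends `x` to the boundary of `w`. -/
theorem connecting_eq_boundary {S : ShortComplex (AbSheaf M)} (hS : S.ShortExact)
    (x : LocalCohomology h S.X₃ 0) (v : Sec S.X₂ V) (w : Sec S.X₁ W)
    (hw : mapSec S.f W w = restrictSec S.X₂ h v) (hx : forget h S.X₃ x = mapSec S.g V v) :
    connecting h hS 0 x = boundary h S.X₁ w := by
  obtain ⟨a, rfl⟩ := (Abelian.Ext.mk₀_bijective _ _).2 x
  rw [forget_mk₀] at hx
  -- The data form a morphism of short exact sequences from `0 → ℤ_W → ℤ_V → ℤ_V / ℤ_W → 0`.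
  -- Naturality of the extension class along it is the claim.
  let f : pairSequence h ⟶ S :=
    { τ₁ := (homEquivSec S.X₁ W).symm w
      τ₂ := (homEquivSec S.X₂ V).symm v
      τ₃ := a
      comm₁₂ := by
        apply (homEquivSec S.X₂ W).injective
        refine (homEquivSec_comp _ _).trans (Eq.trans ?_ (homEquivSec_map_comp _ h _).symm)
        rw [Equiv.apply_symm_apply, Equiv.apply_symm_apply, hw]
      comm₂₃ := by
        apply (homEquivSec S.X₃ V).injective
        refine (homEquivSec_comp _ _).trans (Eq.trans ?_ hx.symm)
        rw [Equiv.apply_symm_apply] }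
  exact ((pairSequence_shortExact h).extClass_naturality hS f).symm

theorem map_apply {F G : AbSheaf M} (φ : F ⟶ G) (k : ℕ) (x : LocalCohomology h F k) :
    map h φ k x = x.comp (Abelian.Ext.mk₀ φ) (add_zero k) := rfl

theorem map_boundary {F G : AbSheaf M} (φ : F ⟶ G) (s : Sec F W) :
    map h φ 1 (boundary h F s) = boundary h G (mapSec φ W s) := by
  have e : (homEquivSec G W).symm (mapSec φ W s) = (homEquivSec F W).symm s ≫ φ := by
    rw [Equiv.symm_apply_eq, homEquivSec_comp, Equiv.apply_symm_apply]
  have e' : (Abelian.Ext.mk₀ ((homEquivSec F W).symm s)).comp (Abelian.Ext.mk₀ φ) (add_zero 0) =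
      Abelian.Ext.mk₀ ((homEquivSec G W).symm (mapSec φ W s)) := by
    rw [e]
    exact Abelian.Ext.mk₀_comp_mk₀ _ _
  exact (Abelian.Ext.comp_assoc_of_third_deg_zero _ _ _ _).trans
    (congrArg (fun y => (pairSequence_shortExact h).extClass.comp y (add_zero 1)) e')

theorem map_bijective {F G : AbSheaf M} (φ : F ⟶ G) [IsIso φ] (k : ℕ) :
    Function.Bijective (map h φ k) := by
  have e : ∀ {F G : AbSheaf M} (φ : F ⟶ G) (ψ : G ⟶ F), φ ≫ ψ = 𝟙 F →
      ∀ x, map h ψ k (map h φ k x) = x := fun φ ψ hφ x => by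
    rw [map_apply, map_apply, Abelian.Ext.comp_assoc_of_third_deg_zero, Abelian.Ext.mk₀_comp_mk₀, hφ,
      Abelian.Ext.comp_mk₀_id]
  exact Function.bijective_iff_has_inverse.2
    ⟨map h (inv φ) k, e _ _ (IsIso.hom_inv_id φ), e _ _ (IsIso.inv_hom_id φ)⟩

variable {V' W' : Opens M} {h' : W' ≤ V'} (hV : V' ≤ V) (hW : W' ≤ W)

/-- This and `connecting_restrict` are associativity of the Yoneda product: restriction composes on
one side, coefficient maps and extension classes on the other. -/
theorem map_restrict {F G : AbSheaf M} (φ : F ⟶ G) (k : ℕ) (x : LocalCohomology h F k) :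
    map h' φ k (restrict h hV hW F k x) = restrict h hV hW G k (map h φ k x) :=
  Abelian.Ext.comp_assoc_of_third_deg_zero _ _ _ (zero_add k)

theorem connecting_restrict {S : ShortComplex (AbSheaf M)} (hS : S.ShortExact) (k : ℕ)
    (x : LocalCohomology h S.X₃ k) :
    connecting h' hS k (restrict h hV hW S.X₃ k x) =
      restrict h hV hW S.X₁ (k + 1) (connecting h hS k x) :=
  Abelian.Ext.comp_assoc _ _ _ (zero_add k) rfl (by omega)

theorem forget_restrict (F : AbSheaf M) (x : LocalCohomology h F 0) :
    forget h' F (restrict h hV hW F 0 x) = restrictSec F hV (forget h F x) := by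
  obtain ⟨a, rfl⟩ := (Abelian.Ext.mk₀_bijective _ _).2 x
  have e : restrict (h' := h') h hV hW F 0 (Abelian.Ext.mk₀ a) = Abelian.Ext.mk₀ _ :=
    Abelian.Ext.mk₀_comp_mk₀ _ _
  rw [e, forget_mk₀, forget_mk₀, ← homEquivSec_map_comp, cokernel.π_desc_assoc, Category.assoc]

end LocalCohomology

end

end OuterPoisson

/-! ### The canonical class and the main theorem. -/

namespace OuterPoisson.PoissonStructure

variable {n : ℕ} {M : Type u} [TopologicalSpace M] [ChartedSpace (Model n) M]
  [IsManifold 𝓘(ℂ, Model n) ω M] {P : PoissonStructure n M}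

/-- The image of a lift of the outer vector field under the connecting homomorphism is the boundary
of the class of `D_ν P`, over every open set with a volume form. -/
theorem IsOuterField.connecting_eq {ξ : Sec P.outerSheaf ⊤} (hξ : P.IsOuterField ξ)
    {V W : Opens M} (h : W ≤ V) {ν : NForm n M} (hν : IsVolumeFormOn ν V)
    {x : LocalCohomology h P.outerSheaf 0}
    (hx : LocalCohomology.forget h P.outerSheaf x = restrictSec P.outerSheaf le_top ξ)
    {f : Sec P.functionModCasimir W} (hf : P.IsSingularityClass ν f) :
    LocalCohomology.connecting h P.outerSequence_shortExact 0 x =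
      LocalCohomology.map h P.hamiltonianMap 1
        (LocalCohomology.boundary h P.functionModCasimir f) := by
  obtain ⟨v, hv, hvξ⟩ := hξ V ν hν
  rw [LocalCohomology.map_boundary]
  exact LocalCohomology.connecting_eq_boundary h P.outerSequence_shortExact x v _
    (IsKoszulField.unique hf (hv.restrict h)) (hx.trans hvξ)

variable (P) in
theorem exists_isSingularityClass {ν : NForm n M} {W : Opens M} (hν : IsVolumeFormOn ν W)
    (hW : W ≤ P.regularSet) : ∃ f : Sec P.functionModCasimir W, P.IsSingularityClass ν f := by
  obtain ⟨v, hv⟩ := P.exists_isKoszulField hν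
  obtain ⟨w, rfl⟩ := hv.exists_hamToDer hν hW
  obtain ⟨f, rfl⟩ := (mapSec_bijective P.hamiltonianMap W).2 w
  exact ⟨f, hv⟩

end OuterPoisson.PoissonStructure

theorem proposition7 {n : ℕ} {M : Type u} [TopologicalSpace M] [ChartedSpace (Model n) M]
    [IsManifold 𝓘(ℂ, Model n) ω M] (P : PoissonStructure n M) :
    -- (1) the Poisson vector field `D_ν P`, its restriction to the regular set and its class there
    (∀ ν : NForm n M, IsVolumeFormOn ν ⊤ →
      ∃ v : Sec P.derSheaf ⊤, P.IsKoszulField ν v ∧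
        ∃ w : Sec P.hamSheaf P.regularSet,
          mapSec P.hamToDer P.regularSet w = restrictSec P.derSheaf le_top v ∧
          ∃! f : Sec P.functionModCasimir P.regularSet,
            mapSec P.hamiltonianMap P.regularSet f = w) ∧
    -- (2) the outer vector field exists and is unique
    (∃! ξ : Sec P.outerSheaf ⊤, P.IsOuterField ξ) ∧
    ∀ ξ : Sec P.outerSheaf ⊤, P.IsOuterField ξ →
      -- it vanishes on the regular set, hence lifts uniquely to `H⁰_S(M, Der / Ham)`
      restrictSec P.outerSheaf (le_top : P.regularSet ≤ ⊤) ξ = 0 ∧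
      (∃! ξS : P.SupportedCohomology P.outerSheaf 0,
        LocalCohomology.forget le_top P.outerSheaf ξS = ξ) ∧
      ∀ ξS : P.SupportedCohomology P.outerSheaf 0,
        LocalCohomology.forget le_top P.outerSheaf ξS = ξ →
        -- it gives a canonical class `c` in `H¹_S(M, O_M / C_M)`
        (∃! c : P.SupportedCohomology P.functionModCasimir 1,
          LocalCohomology.map le_top P.hamiltonianMap 1 c = P.outerConnecting 0 ξS) ∧
        ∀ c : P.SupportedCohomology P.functionModCasimir 1,
          LocalCohomology.map le_top P.hamiltonianMap 1 c = P.outerConnecting 0 ξS →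
          -- for a global volume form, `c` is the boundary of the class in (1)
          (∀ ν : NForm n M, IsVolumeFormOn ν ⊤ →
            ∀ f : Sec P.functionModCasimir P.regularSet, P.IsSingularityClass ν f →
              c = LocalCohomology.boundary le_top P.functionModCasimir f) ∧
          -- and over every open set with a volume form, `c` restricts to the corresponding boundary
          (∀ (V : Opens M) (ν : NForm n M), IsVolumeFormOn ν V →
            ∃ f : Sec P.functionModCasimir (V ⊓ P.regularSet), P.IsSingularityClass ν f ∧
              LocalCohomology.restrict le_top le_top inf_le_right P.functionModCasimir 1 c =
                LocalCohomology.boundary inf_le_left P.functionModCasimir f) := by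
  refine ⟨fun ν hν => ?_, P.existsUnique_outerField, fun ξ hξ => ?_⟩
  · obtain ⟨v, hv⟩ := P.exists_isKoszulField hν
    obtain ⟨w, hw⟩ := (hv.restrict (le_top : P.regularSet ≤ ⊤)).exists_hamToDer
      (hν.mono le_top) le_rfl
    exact ⟨v, hv, w, hw, (mapSec_bijective P.hamiltonianMap _).existsUnique w⟩
  · refine ⟨hξ.restrict_eq_zero,
      LocalCohomology.existsUnique_forget le_top ξ hξ.restrict_eq_zero, fun ξS hξS => ?_⟩
    have hinj {V W : Opens M} (h : W ≤ V) :=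
      LocalCohomology.map_bijective h P.hamiltonianMap 1
    refine ⟨(hinj le_top).existsUnique _, fun c hc => ⟨fun ν hν f hf => ?_, fun V ν hν => ?_⟩⟩
    · refine (hinj le_top).1 (hc.trans (hξ.connecting_eq le_top hν ?_ hf))
      rw [hξS]
      -- Restriction from `⊤` to `⊤` is the identity.
      exact (congrArg (fun k : P.outerSheaf.obj.obj (op ⊤) ⟶ _ => k ξ)
        (P.outerSheaf.obj.map_id (op ⊤))).symm
    · obtain ⟨f, hf⟩ := P.exists_isSingularityClass (hν.mono inf_le_left)
        (inf_le_right : V ⊓ P.regularSet ≤ P.regularSet)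
      -- Both classes are compared in `Ham`. There the restriction of `c` is the connecting image of
      -- the restricted lift of `ξ`, to which the computation over `V` applies.
      refine ⟨f, hf, (hinj inf_le_left).1 ?_⟩
      rw [LocalCohomology.map_restrict, hc]
      refine (LocalCohomology.connecting_restrict le_top le_top inf_le_right
        P.outerSequence_shortExact 0 ξS).symm.trans (hξ.connecting_eq inf_le_left hν ?_ hf)
      exact (LocalCohomology.forget_restrict _ _ _ _ _).trans (by rw [hξS])
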